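/- For a finite arrangement $\mathcal A$ of affine hyperplanes in a finite-dimensional real inner product space $V$, let $\chi(\mathcal A,q)=\sum_{x\in L_{\mathcal A}}\mu(\hat 0,x)\,q^{\dim x}$ be its characteristic polynomial, where $L_{\mathcal A}$ is the set of all nonempty intersections of subfamilies of $\mathcal A$ (including the empty intersection $\hat 0=V$), ordered by reverse inclusion, and $\mu$ is its Möbius function. Let $n\ge 1$, let $e_1,\dots,e_n$ be the standard basis of $\mathbb R^n$, and take the following systems of positive roots $\Phi^+$: - $A_{n-1}$: $e_i-e_j$ for $i<j$, in the space $V=\{x\in\mathbb R^n : x_1+\cdots+x_n=0\}$; - $B_n$: $e_i$ for $1\le i\le n$ and $e_i\pm e_j$ for $i<j$, in $V=\mathbb R^n$; - $C_n$: $2e_i$ for $1\le i\le n$ and $e_i\pm e_j$ for $i<j$, in $V=\mathbb R^n$; - $D_n$: $e_i\pm e_j$ for $i<j$, in $V=\mathbb R^n$; - $BC_n$: the union of those of $B_n$ and $C_n$, in $V=\mathbb R^n$. For integers $c\le d$ let $\hat{\mathcal A}^{[c,d]}(\Phi)$ be the arrangement of all hyperplanes $\{x\in V:(\alpha,x)=k\}$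 with $\alpha\in\Phi^+$ and $k=c,c+1,\dots,d$ (coinciding hyperplanes being counted once). **Proposition 5.3.** Let $a,b$ be integers with $0\le a\le b$. If $\Phi$ is one of $A_{n-1}$, $B_n$, $C_n$, $D_n$, then, as polynomials in $q$, $$\chi(\hat{\mathcal A}^{[-a,b]}(\Phi),q)=\chi(\hat{\mathcal A}^{[0,b-a]}(\Phi),q-ah),$$ where $h=n$ if $\Phi=A_{n-1}$, $h=2n$ if $\Phi=B_n$ or $C_n$, and $h=2n-2$ if $\Phi=D_n$. For $\Phi=BC_n$, $$\chi(\hat{\mathcal A}^{[-a,b]}(BC_n),q)=\begin{cases}\chi(\hat{\mathcal A}^{[0,b-a]}(BC_n),\,q-(2n+1)a-1)&\text{if both } a \text{ and } b \text{ are odd},\\ \chi(\hat{\mathcal A}^{[0,b-a]}(BC_n),\,q-(2n+1)a)&\text{otherwise.}\end{cases}$$ -/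

import Mathlib

open Polynomial

noncomputable section

namespace HypArr

section General

variable {V : Type*} [NormedAddCommGroup V] [InnerProductSpace ℝ V]

/-- The affine hyperplane `(α, x) = k` (for `α ≠ 0`) in a real inner product space. -/
def hyperplane (α : V) (k : ℤ) : AffineSubspace ℝ V where
  carrier := {x | inner ℝ α x = (k : ℝ)}
  smul_vsub_vadd_mem' := by
    intro c p₁ p₂ p₃ h₁ h₂ h₃
    simp only [Set.mem_ofPred_eq, vsub_eq_sub, vadd_eq_add, inner_add_right,
      real_inner_smul_right, inner_sub_right] at *
    rw [h₁, h₂, h₃]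
    ring

/-- The elements of the intersection poset of a finite arrangement `A`: the nonempty affine
subspaces that are the intersection of some of the members of `A`. The intersection of the empty
subfamily is the whole space. -/
def flats (A : Finset (AffineSubspace ℝ V)) : Set (AffineSubspace ℝ V) :=
  {x | x ≠ ⊥ ∧ ∃ B : Finset (AffineSubspace ℝ V), B ⊆ A ∧ x = B.inf id}

theorem flats_finite (A : Finset (AffineSubspace ℝ V)) : (flats A).Finite := by
  classical
  refine (A.powerset.image fun B => B.inf id).finite_toSet.subset ?_
  rintro x ⟨-, B, hB, rfl⟩
  simp only [Finset.coe_image, Set.mem_image, Finset.mem_coe, Finset.mem_powerset]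
  exact ⟨B, hB, rfl⟩

theorem top_mem_flats (A : Finset (AffineSubspace ℝ V)) : (⊤ : AffineSubspace ℝ V) ∈ flats A :=
  ⟨AffineSubspace.bot_ne_top ℝ V V |>.symm, ∅, Finset.empty_subset A, by simp⟩

/-- The intersection poset `L_A`, ordered by reverse inclusion. -/
abbrev IntersectionPoset (A : Finset (AffineSubspace ℝ V)) : Type _ := (flats A)ᵒᵈ

instance (A : Finset (AffineSubspace ℝ V)) : Fintype (IntersectionPoset A) :=
  haveI : Finite (flats A) := (flats_finite A).to_subtype
  Fintype.ofFinite _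

open Classical in
instance (A : Finset (AffineSubspace ℝ V)) : LocallyFiniteOrder (IntersectionPoset A) :=
  Fintype.toLocallyFiniteOrder

/-- The minimal element of `L_A`: the whole space. -/
def zeroHat (A : Finset (AffineSubspace ℝ V)) : IntersectionPoset A :=
  OrderDual.toDual ⟨⊤, top_mem_flats A⟩

open Classical in
/-- The characteristic polynomial `χ(A, q) = ∑_{x ∈ L_A} μ(0̂, x) q ^ dim x`, where `μ` is the
Möbius function of the intersection poset `L_A`. -/
def charPoly (A : Finset (AffineSubspace ℝ V)) : ℤ[X] :=
  ∑ x : IntersectionPoset A,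
    C (IncidenceAlgebra.mu ℤ (zeroHat A) x) *
      X ^ Module.finrank ℝ (OrderDual.ofDual x).1.direction

open Classical in
/-- The arrangement of all hyperplanes `(α, x) = k` with `α ∈ P` and `k = a, a + 1, …, b`.
Coinciding hyperplanes are counted once. -/
def deformation (P : Finset V) (a b : ℤ) : Finset (AffineSubspace ℝ V) :=
  (P ×ˢ Finset.Icc a b).image fun p => hyperplane p.1 p.2

end General

/-- The `i`-th vector of the standard basis of `ℝⁿ`. -/
def e {n : ℕ} (i : Fin n) : EuclideanSpace ℝ (Fin n) := EuclideanSpace.single i 1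

/-- The pairs `(i, j)` with `i < j`. -/
def pairs (n : ℕ) : Finset (Fin n × Fin n) := Finset.univ.filter fun p => p.1 < p.2

/-- The hyperplane of `ℝⁿ` of vectors with coordinate sum zero, the ambient space of the root
system `A_{n-1}`; its dimension is `n - 1` for `n ≥ 1`. -/
def sumZero (n : ℕ) : Submodule ℝ (EuclideanSpace ℝ (Fin n)) where
  carrier := {x | ∑ i, x i = 0}
  add_mem' := by
    intro x y hx hy
    simp only [Set.mem_ofPred_eq, PiLp.add_apply, Finset.sum_add_distrib] at *
    rw [hx, hy, add_zero]
  zero_mem' := by simp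
  smul_mem' := by
    intro c x hx
    simp only [Set.mem_ofPred_eq, PiLp.smul_apply, smul_eq_mul, ← Finset.mul_sum] at *
    rw [hx, mul_zero]

theorem e_sub_e_mem {n : ℕ} (i j : Fin n) : e i - e j ∈ sumZero n := by
  change ∑ k, (e i - e j : EuclideanSpace ℝ (Fin n)) k = 0
  simp [e, Finset.sum_sub_distrib]

open Classical in
/-- Positive roots of `A_{n-1}`: `e_i - e_j` for `i < j`, in the space of vectors with coordinate
sum zero. -/
def posA (n : ℕ) : Finset (sumZero n) :=
  (pairs n).image fun p => ⟨e p.1 - e p.2, e_sub_e_mem p.1 p.2⟩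

open Classical in
/-- Positive roots of `D_n`: `e_i - e_j` and `e_i + e_j` for `i < j`. -/
def posD (n : ℕ) : Finset (EuclideanSpace ℝ (Fin n)) :=
  ((pairs n).image fun p => e p.1 - e p.2) ∪ ((pairs n).image fun p => e p.1 + e p.2)

open Classical in
/-- Positive roots of `B_n`: `e_i`, and `e_i - e_j` and `e_i + e_j` for `i < j`. -/
def posB (n : ℕ) : Finset (EuclideanSpace ℝ (Fin n)) :=
  (Finset.univ.image fun i => e i) ∪ posD n

open Classical in
/-- Positive roots of `C_n`: `2 e_i`, and `e_i - e_j` and `e_i + e_j` for `i < j`. -/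
def posC (n : ℕ) : Finset (EuclideanSpace ℝ (Fin n)) :=
  (Finset.univ.image fun i => (2 : ℝ) • e i) ∪ posD n

open Classical in
/-- Positive roots of the non-reduced system `BC_n`, the union of `B_n` and `C_n`. -/
def posBC (n : ℕ) : Finset (EuclideanSpace ℝ (Fin n)) := posB n ∪ posC n

end HypArr

end

noncomputable section

namespace HypArr

/-! ### Whitney's formula: the Möbius function as a signed sum over subfamilies. -/

section Whitney

variable {V : Type*} [NormedAddCommGroup V] [InnerProductSpace ℝ V]

/-! By the finite field method, the value of the characteristic polynomial at a suitable large `q`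
is the number of points modulo `q` lying on none of the hyperplanes, up to a power of `q` when `V`
is embedded in a larger coordinate space (`charPoly_deformation_eval`). This combines Whitney's
formula with inclusion–exclusion; it needs `q` coprime to certain determinants, which are units for
type A and signed powers of two for subsets of `BC_n`. Hence every `q` works for type A and every
odd `q` for the others, and odd `q` are enough to identify polynomials.

For odd `q`, a coordinate is represented by an integer congruent to its double, of fixed parity and
in `(-q, q]`. A point is then a sign vector `ε`, a ranking `r` of the absolute values, and the
absolute values `S` themselves. The forbidden window from `-a` to `b` becomes a lower bound on gaps:
`2a` at every step and `2b` at descents of a signed labelling that depends only on `ε`. It suffices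
to impose this on neighbours in rank, together with conditions at the two ends of the interval.
Adding `2a` times the rank, plus a constant, to `S` therefore turns the conditions for `(0, b - a)`
into those for `(a, b)`, and enlarges `q` by the total inserted length `a * h`. Type A is the same
argument on a circle cut at one coordinate, without doubling. In type C the shift changes parity
when `a` is odd, which is harmless because representatives of either parity may be used.

In type BC the parity cannot be changed: `e i` acts at the front and `2 e i` at the back. There the
points are counted outright. After removing the forced part of each gap, the class `(ε, r)`
contributes a binomial coefficient in `⌊(Q - (2n+1) - m c) / 2⌋`, where `Q = q - (2n+1)a`, `m = b -
a` and `c` is the number of circular descents. For even `a` this is the count for `a = 0` at the odd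
modulus `Q`. For `a` and `b` odd, `m` is even and the floor does not distinguish the even number `Q`
from `Q - 1`. For odd `m` the count must be shown to be one polynomial on both parities of `Q`
(`exists_polynomial_bcCount`). The case `m = 1` is the decomposition of a cube with `J ^ n` lattice
points (`pow_eq_sum_increasingCount`). Agreement of the two parities says that an alternating sum of
translates is constant, and this property survives multiplying the translations by an odd `m`
(`altSum_mul_periodic`). -/

open Classical in
theorem finset_inf_mem_flats {ι : Type*} (T : Finset ι) (h : ι → AffineSubspace ℝ V)
    {B : Finset ι} (hB : B ⊆ T) (hne : B.inf h ≠ ⊥) : B.inf h ∈ flats (T.image h) :=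
  ⟨hne, B.image h, Finset.image_subset_image hB, by rw [Finset.inf_image]; rfl⟩

-- The subfamilies whose intersection contains `x` are all the subsets of the set of members
-- containing `x`. Their alternating sum vanishes unless that set is empty, which for a flat means
-- `x` is the whole space.
open Classical in
theorem sum_filter_le_inf {ι : Type*} (T : Finset ι) (h : ι → AffineSubspace ℝ V)
    (hT : ∀ i ∈ T, h i ≠ ⊤) (x : IntersectionPoset (T.image h)) :
    ∑ B ∈ T.powerset with (OrderDual.ofDual x).1 ≤ B.inf h, (-1 : ℤ) ^ B.card =
      if zeroHat (T.image h) = x then 1 else 0 := by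
  have h1 : {B ∈ T.powerset | (OrderDual.ofDual x).1 ≤ B.inf h} =
      (T.filter fun i => (OrderDual.ofDual x).1 ≤ h i).powerset := by
    ext B
    simp only [Finset.mem_filter, Finset.mem_powerset, Finset.le_inf_iff]
    constructor
    · rintro ⟨h1, h2⟩ i hi
      exact Finset.mem_filter.2 ⟨h1 hi, h2 i hi⟩
    · intro h1
      exact ⟨fun i hi => (Finset.mem_filter.1 (h1 hi)).1,
        fun i hi => (Finset.mem_filter.1 (h1 hi)).2⟩
  rw [h1, Finset.sum_powerset_neg_one_pow_card]
  refine if_congr ?_ rfl rfl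
  constructor
  · intro he
    obtain ⟨-, B, hB, hx⟩ := (OrderDual.ofDual x).2
    have : B = ∅ := by
      rw [Finset.eq_empty_iff_forall_notMem]
      intro b hb
      obtain ⟨i, hi, rfl⟩ := Finset.mem_image.1 (hB hb)
      have : i ∈ T.filter fun i => (OrderDual.ofDual x).1 ≤ h i := by
        refine Finset.mem_filter.2 ⟨hi, ?_⟩
        rw [hx]
        exact Finset.inf_le (f := id) hb
      rw [he] at this
      exact absurd this (Finset.notMem_empty _)
    subst this
    apply OrderDual.ofDual.injective
    apply Subtype.ext
    rw [hx]
    simp [zeroHat]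
  · rintro rfl
    rw [Finset.eq_empty_iff_forall_notMem]
    intro i hi
    obtain ⟨hi, hi'⟩ := Finset.mem_filter.1 hi
    exact hT i hi (top_le_iff.1 hi')

-- Both sides have the same sums over the intervals from `0̂`, hence agree by induction. The family
-- `h` may repeat hyperplanes, so coincidences such as `x i = 0` and `2 * x i = 0` need no separate
-- treatment.
open Classical in
theorem mu_zeroHat_eq_sum {ι : Type*} (T : Finset ι) (h : ι → AffineSubspace ℝ V)
    (hT : ∀ i ∈ T, h i ≠ ⊤) (x : IntersectionPoset (T.image h)) :
    IncidenceAlgebra.mu ℤ (zeroHat (T.image h)) x =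
      ∑ B ∈ T.powerset with B.inf h = (OrderDual.ofDual x).1, (-1 : ℤ) ^ B.card := by
  set g : IntersectionPoset (T.image h) → ℤ := fun x =>
    ∑ B ∈ T.powerset with B.inf h = (OrderDual.ofDual x).1, (-1 : ℤ) ^ B.card with hg
  have hbot : ∀ y : IntersectionPoset (T.image h), zeroHat (T.image h) ≤ y := by
    intro y
    change (OrderDual.ofDual y).1 ≤ ⊤
    exact le_top
  have hsum : ∀ x, ∑ y ∈ Finset.Icc (zeroHat (T.image h)) x, g y =
      if zeroHat (T.image h) = x then 1 else 0 := by
    intro x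
    rw [← sum_filter_le_inf T h hT x, hg, ← Finset.sum_biUnion]
    · refine Finset.sum_congr ?_ fun _ _ => rfl
      ext B
      simp only [Finset.mem_biUnion, Finset.mem_Icc, Finset.mem_filter, Finset.mem_powerset]
      constructor
      · rintro ⟨y, ⟨-, hy⟩, hB, hBy⟩
        exact ⟨hB, hBy ▸ hy⟩
      · rintro ⟨hB, hx⟩
        refine ⟨OrderDual.toDual ⟨B.inf h, finset_inf_mem_flats T h hB ?_⟩, ⟨hbot _, hx⟩, hB, rfl⟩
        intro hb
        rw [hb] at hx
        exact (OrderDual.ofDual x).2.1 (le_bot_iff.1 hx)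
    · intro y _ z _ hyz
      rw [Function.onFun, Finset.disjoint_left]
      intro B hB hB'
      apply hyz
      apply OrderDual.ofDual.injective
      apply Subtype.ext
      rw [← (Finset.mem_filter.1 hB).2, (Finset.mem_filter.1 hB').2]
  change _ = g x
  induction x using WellFoundedLT.induction with
  | ind x ih =>
    have h1 := hsum x
    have h2 := IncidenceAlgebra.sum_Icc_mu_right (𝕜 := ℤ) (zeroHat (T.image h)) x
    rw [← Finset.Ico_insert_right (hbot x), Finset.sum_insert Finset.right_notMem_Ico] at h1 h2
    have h3 : ∑ y ∈ Finset.Ico (zeroHat (T.image h)) x, g y =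
        ∑ y ∈ Finset.Ico (zeroHat (T.image h)) x,
          IncidenceAlgebra.mu ℤ (zeroHat (T.image h)) y :=
      Finset.sum_congr rfl fun y hy => (ih y (Finset.mem_Ico.1 hy).2).symm
    rw [h3] at h1
    linarith

open Classical in
/-- Whitney's formula for the characteristic polynomial. -/
theorem charPoly_image {ι : Type*} (T : Finset ι) (h : ι → AffineSubspace ℝ V)
    (hT : ∀ i ∈ T, h i ≠ ⊤) :
    charPoly (T.image h) =
      ∑ B ∈ T.powerset with B.inf h ≠ ⊥,
        C ((-1 : ℤ) ^ B.card) * X ^ Module.finrank ℝ (B.inf h).direction := by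
  unfold charPoly
  simp only [mu_zeroHat_eq_sum T h hT, map_sum, Finset.sum_mul]
  have : ∀ x : IntersectionPoset (T.image h),
      (∑ B ∈ T.powerset with B.inf h = (OrderDual.ofDual x).1,
        C ((-1 : ℤ) ^ B.card) * X ^ Module.finrank ℝ (OrderDual.ofDual x).1.direction) =
      ∑ B ∈ T.powerset with B.inf h = (OrderDual.ofDual x).1,
        C ((-1 : ℤ) ^ B.card) * X ^ Module.finrank ℝ (B.inf h).direction := by
    intro x
    refine Finset.sum_congr rfl fun B hB => ?_
    rw [(Finset.mem_filter.1 hB).2]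
  simp only [this]
  rw [← Finset.sum_biUnion]
  · refine Finset.sum_congr ?_ fun _ _ => rfl
    ext B
    simp only [Finset.mem_biUnion, Finset.mem_univ, true_and, Finset.mem_filter,
      Finset.mem_powerset]
    constructor
    · rintro ⟨y, hB, hBy⟩
      exact ⟨hB, hBy ▸ (OrderDual.ofDual y).2.1⟩
    · rintro ⟨hB, hx⟩
      exact ⟨OrderDual.toDual ⟨B.inf h, finset_inf_mem_flats T h hB hx⟩, hB, rfl⟩
  · intro y _ z _ hyz
    rw [Function.onFun, Finset.disjoint_left]
    intro B hB hB'
    apply hyz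
    apply OrderDual.ofDual.injective
    apply Subtype.ext
    rw [← (Finset.mem_filter.1 hB).2, (Finset.mem_filter.1 hB').2]

end Whitney

/-! ### Integral bases and real solution spaces of hyperplane systems. -/

section FiniteField

variable {V : Type*} [NormedAddCommGroup V] [InnerProductSpace ℝ V] {n : ℕ}

open Classical in
/-- A finite set of vectors with integer coordinates contains a linearly independent spanning
subset, which extends by standard basis vectors to the rows of a nonsingular integer matrix. -/
theorem exists_det_ne_zero (φ : V →ₗ[ℝ] (Fin n → ℝ)) (hφ : Function.Injective φ)
    (z : V → Fin n → ℤ) (R : Finset V) (hz : ∀ α ∈ R, ∀ i, φ α i = z α i) :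
    ∃ (M : Matrix (Fin n) (Fin n) ℤ) (I : Finset (Fin n)) (α : Fin n → V),
      M.det ≠ 0 ∧ (∀ r, (∃ β ∈ R, M r = z β) ∨ ∃ j, M r = Pi.single j 1) ∧
      (∀ r ∈ I, α r ∈ R ∧ M r = z (α r)) ∧ LinearIndepOn ℝ α (I : Set (Fin n)) ∧
      (R : Set V) ⊆ Submodule.span ℝ (α '' I) := by
  obtain ⟨b, hbR, hspan, hli⟩ := exists_linearIndependent ℝ (R : Set V)
  have hli' : LinearIndepOn ℝ id (φ '' b) := by
    have : LinearIndepOn ℝ φ b := LinearIndependent.map' hli φ (LinearMap.ker_eq_bot.2 hφ)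
    exact this.id_image
  set t : Set (Fin n → ℝ) := φ '' b ∪ Set.range fun j => Pi.single j (1 : ℝ) with ht
  -- Since `t` contains the unit vectors, the extension inside `t` is a basis of the whole
  -- coordinate space, and it still consists of integral vectors.
  obtain ⟨b', hb't, hbb', htspan, hli''⟩ :=
    exists_linearIndepOn_extension hli' (t := t) Set.subset_union_left
  simp only [Set.image_id] at htspan
  have htop : ⊤ ≤ Submodule.span ℝ (Set.range (Subtype.val : b' → Fin n → ℝ)) := by
    rw [Subtype.range_coe]
    have h1 : Submodule.span ℝ (Set.range fun j : Fin n => Pi.single j (1 : ℝ)) = ⊤ := by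
      have : (fun j : Fin n => (Pi.single j (1 : ℝ) : Fin n → ℝ)) = Pi.basisFun ℝ (Fin n) := by
        funext j
        rw [Pi.basisFun_apply]
      rw [this]
      exact (Pi.basisFun ℝ (Fin n)).span_eq
    rw [← h1, Submodule.span_le]
    exact Set.subset_union_right.trans htspan
  let bas : Module.Basis b' ℝ (Fin n → ℝ) := Module.Basis.mk hli'' htop
  have : Fintype b' := FiniteDimensional.fintypeBasisIndex bas
  have hcard : Fintype.card b' = n := by
    rw [← Module.finrank_eq_card_basis bas]; simp
  let e : Fin n ≃ b' := (Fintype.equivFinOfCardEq hcard).symm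
  have hchoose : ∀ r : Fin n, (e r).1 ∈ φ '' b → ∃ β, β ∈ b ∧ φ β = (e r).1 := fun r h => h
  choose! α hα using hchoose
  let I : Finset (Fin n) := Finset.univ.filter fun r => (e r).1 ∈ φ '' b
  have hI : ∀ r, r ∈ I ↔ (e r).1 ∈ φ '' b := fun r => by simp [I]
  have hstd : ∀ r : Fin n, (e r).1 ∉ φ '' b → ∃ j, (e r).1 = Pi.single j (1 : ℝ) := by
    intro r hr
    rcases hb't (e r).2 with h | ⟨j, h⟩
    · exact absurd h hr
    · exact ⟨j, h.symm⟩
  choose! j hj using hstd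
  let M : Matrix (Fin n) (Fin n) ℤ := fun r =>
    if (e r).1 ∈ φ '' b then z (α r) else Pi.single (j r) 1
  have hM : ∀ r, (fun i => (M r i : ℝ)) = (e r).1 := by
    intro r
    by_cases h : (e r).1 ∈ φ '' b
    · funext i
      simp only [M, if_pos h]
      rw [← hz _ (hbR (hα r h).1) i, (hα r h).2]
    · funext i
      simp only [M, if_neg h]
      rw [hj r h]
      by_cases hi : i = j r
      · subst hi; simp
      · simp [hi]
  refine ⟨M, I, α, ?_, ?_, ?_, ?_, ?_⟩
  · intro hdet
    have h1 : LinearIndependent ℝ (M.map fun x => (x : ℝ)).row := by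
      have : (M.map fun x => (x : ℝ)).row = (Subtype.val : b' → Fin n → ℝ) ∘ e := by
        funext r
        exact hM r
      rw [this]
      exact hli''.comp _ e.injective
    rw [Matrix.linearIndependent_rows_iff_isUnit, Matrix.isUnit_iff_isUnit_det, ← Int.cast_det,
      hdet] at h1
    simp at h1
  · intro r
    by_cases h : (e r).1 ∈ φ '' b
    · exact Or.inl ⟨α r, hbR (hα r h).1, by simp only [M, if_pos h]⟩
    · exact Or.inr ⟨j r, by simp only [M, if_neg h]⟩
  · intro r hr
    have h := (hI r).1 hr
    exact ⟨hbR (hα r h).1, by simp only [M, if_pos h]⟩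
  · apply LinearIndepOn.of_comp φ
    have : ∀ r : (I : Set (Fin n)), (φ ∘ α) r = (e r).1 := fun r => (hα r ((hI r).1 r.2)).2
    unfold LinearIndepOn
    simp only [this]
    exact hli''.comp (fun r : (I : Set (Fin n)) => e r)
      (e.injective.comp Subtype.val_injective)
  · have : b ⊆ α '' I := by
      intro β hβ
      have h1 : φ β ∈ φ '' b := ⟨β, hβ, rfl⟩
      refine ⟨e.symm ⟨φ β, hbb' h1⟩, ?_, ?_⟩
      · rw [Finset.mem_coe, hI]; simpa using h1
      · apply hφ
        rw [(hα _ (by simpa using h1)).2]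
        simp
    refine (Submodule.subset_span (R := ℝ) (s := (R : Set V))).trans ?_
    rw [← hspan]
    exact Submodule.span_mono this

/-- Extend the vectors to a basis, prescribe a functional on it and represent it by Riesz. This
solves the pivot equations of a system over the reals. -/
theorem exists_inner_eq [FiniteDimensional ℝ V] {ι : Type*} {v : ι → V} {s : Finset ι}
    (hv : LinearIndepOn ℝ v (s : Set ι)) (κ : ι → ℝ) : ∃ x : V, ∀ r ∈ s, inner ℝ (v r) x = κ r := by
  let bas := Module.Basis.extend hv.id_image
  have hinj : Set.InjOn v s := by
    intro a ha b hb hab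
    exact congrArg Subtype.val (hv.injective (a₁ := ⟨a, ha⟩) (a₂ := ⟨b, hb⟩) hab)
  classical
  let c : V → ℝ := fun w => if h : ∃ r ∈ s, v r = w then κ h.choose else 0
  have hc : ∀ r ∈ s, c (v r) = κ r := by
    intro r hr
    have h : ∃ r' ∈ s, v r' = v r := ⟨r, hr, rfl⟩
    simp only [c, dif_pos h]
    rw [hinj h.choose_spec.1 hr h.choose_spec.2]
  let f : V →ₗ[ℝ] ℝ := bas.constr ℝ fun i => c i.1
  refine ⟨(InnerProductSpace.toDual ℝ V).symm (LinearMap.toContinuousLinearMap f), fun r hr => ?_⟩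
  rw [real_inner_comm, InnerProductSpace.toDual_symm_apply]
  have h1 : v r ∈ hv.id_image.extend (Set.subset_univ _) :=
    hv.id_image.subset_extend _ ⟨r, hr, rfl⟩
  have h2 : bas ⟨v r, h1⟩ = v r :=
    Module.Basis.extend_apply_self hv.id_image ⟨v r, h1⟩
  have h3 : f (bas ⟨v r, h1⟩) = c (v r) := by
    simp only [f, Module.Basis.constr_basis]
  rw [h2] at h3
  rw [← hc r hr, ← h3]
  rfl

theorem mem_finset_inf {ι : Type*} (B : Finset ι) (h : ι → AffineSubspace ℝ V) (x : V) :
    x ∈ B.inf h ↔ ∀ i ∈ B, x ∈ h i := by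
  rw [Finset.inf_eq_iInf]
  simp [AffineSubspace.mem_iInf_iff]

theorem mem_hyperplane {α : V} {k : ℤ} {x : V} : x ∈ hyperplane α k ↔ inner ℝ α x = (k : ℝ) :=
  Iff.rfl

theorem finset_inf_ne_bot_iff {ι : Type*} (B : Finset ι) (h : ι → AffineSubspace ℝ V) :
    B.inf h ≠ ⊥ ↔ ∃ x, ∀ i ∈ B, x ∈ h i := by
  rw [← AffineSubspace.nonempty_iff_ne_bot]
  simp only [Set.Nonempty, ← mem_finset_inf]
  rfl

theorem direction_inf_hyperplane (B : Finset (V × ℤ)) {S : Set V}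
    (hS : ∀ p ∈ B, p.1 ∈ Submodule.span ℝ S) (hS' : ∀ v ∈ S, ∃ k, (v, k) ∈ B)
    (hne : B.inf (fun p => hyperplane p.1 p.2) ≠ ⊥) :
    (B.inf fun p => hyperplane p.1 p.2).direction = (Submodule.span ℝ S)ᗮ := by
  obtain ⟨x, hx⟩ := (finset_inf_ne_bot_iff _ _).1 hne
  have hx' := (mem_finset_inf B _ x).2 hx
  ext v
  rw [← AffineSubspace.vadd_mem_iff_mem_direction v hx', mem_finset_inf, Submodule.mem_orthogonal]
  constructor
  · intro h1 u hu
    induction hu using Submodule.span_induction with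
    | mem u hu =>
      obtain ⟨k, hk⟩ := hS' u hu
      have h2 := h1 _ hk
      have h3 := hx _ hk
      simp only [mem_hyperplane, vadd_eq_add, inner_add_right] at h2 h3
      linarith
    | zero => simp
    | add u w _ _ hu hw => rw [inner_add_left, hu, hw, add_zero]
    | smul c u _ hu => rw [real_inner_smul_left, hu, mul_zero]
  · intro h1 p hp
    have h3 := hx _ hp
    simp only [mem_hyperplane, vadd_eq_add, inner_add_right] at h3 ⊢
    rw [h1 _ (hS p hp), h3, zero_add]

end FiniteField

/-! ### Counting solutions modulo `q`, and the finite field method. -/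

section FiniteField

open Matrix

variable {V : Type*} [NormedAddCommGroup V] [InnerProductSpace ℝ V] {n : ℕ}

/-- The solutions modulo `q` of a system of congruences with left-hand sides given by `z`. -/
def SolvesMod (z : V → Fin n → ℤ) (B : Finset (V × ℤ)) {q : ℕ} (x : Fin n → ZMod q) : Prop :=
  ∀ p ∈ B, (fun i => (z p.1 i : ZMod q)) ⬝ᵥ x = p.2

/-- All nonsingular matrices with rows in `z '' P` or the standard basis have determinant prime
to `q`. -/
def GoodModulus (z : V → Fin n → ℤ) (P : Finset V) (q : ℕ) : Prop :=
  ∀ M : Matrix (Fin n) (Fin n) ℤ, M.det ≠ 0 →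
    (∀ r, (∃ β ∈ P, M r = z β) ∨ ∃ j, M r = Pi.single j 1) → IsCoprime M.det (q : ℤ)

theorem card_eq_on_finset {q : ℕ} [NeZero q] (I : Finset (Fin n)) (κ : Fin n → ZMod q) :
    Nat.card {y : Fin n → ZMod q // ∀ r ∈ I, y r = κ r} = q ^ (n - I.card) := by
  have h1 : Nat.card {y : Fin n → ZMod q // ∀ r ∈ I, y r = κ r} =
      Nat.card ({r // ¬ r ∈ I} → ZMod q) := by
    refine Nat.card_congr ((Equiv.subtypeEquivRight fun y => ?_).trans
      (Equiv.subtypePreimage (fun r => r ∈ I) fun r => κ r))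
    simp [funext_iff]
  rw [h1, Nat.card_fun, Nat.card_zmod, Nat.card_eq_fintype_card, Fintype.card_subtype_compl]
  simp

theorem card_mulVec_eq {q : ℕ} [NeZero q] (M : Matrix (Fin n) (Fin n) (ZMod q))
    (hM : IsUnit M.det) (I : Finset (Fin n)) (κ : Fin n → ZMod q) :
    Nat.card {x : Fin n → ZMod q // ∀ r ∈ I, (M *ᵥ x) r = κ r} = q ^ (n - I.card) := by
  rw [← card_eq_on_finset I κ]
  let e : (Fin n → ZMod q) ≃ (Fin n → ZMod q) :=
    { toFun := fun x => M *ᵥ x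
      invFun := fun x => M⁻¹ *ᵥ x
      left_inv := fun x => by simp [Matrix.mulVec_mulVec, Matrix.nonsing_inv_mul _ hM]
      right_inv := fun x => by simp [Matrix.mulVec_mulVec, Matrix.mul_nonsing_inv _ hM] }
  exact Nat.card_congr (e.subtypeEquiv fun x => Iff.rfl)

/-- Cramer's rule: multiplying the coordinates of `β` in the rows of `M` by `M.det` gives the
integers `z β ᵥ* M.adjugate`. With denominators cleared, one dependence relation serves both over
the reals and modulo `q`. -/
theorem cramer_relation (φ : V →ₗ[ℝ] (Fin n → ℝ))
    (z : V → Fin n → ℤ) {M : Matrix (Fin n) (Fin n) ℤ} {I : Finset (Fin n)} {α : Fin n → V}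
    (hI : ∀ r ∈ I, (∀ i, φ (α r) i = z (α r) i) ∧ M r = z (α r)) {β : V}
    (hβ : β ∈ Submodule.span ℝ (α '' I)) (hzβ : ∀ i, φ β i = z β i) :
    (∀ r, r ∉ I → (z β ᵥ* M.adjugate) r = 0) ∧
      ∑ r ∈ I, ((z β ᵥ* M.adjugate) r : ℝ) • α r = (M.det : ℝ) • β := by
  classical
  obtain ⟨c, hc⟩ := (Submodule.mem_span_image_finset_iff_exists_fun ℝ).1 hβ
  let c' : Fin n → ℝ := fun r => if h : r ∈ I then c ⟨r, h⟩ else 0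
  have hc' : ∑ r ∈ I, c' r • α r = β := by
    rw [← hc, ← Finset.sum_coe_sort]
    refine Finset.sum_congr rfl fun r _ => ?_
    simp [c']
  have h1 : (fun i => (z β i : ℝ)) = c' ᵥ* M.map (fun x => (x : ℝ)) := by
    funext i
    rw [← hzβ i, ← hc', map_sum, Finset.sum_apply, Matrix.vecMul, dotProduct]
    rw [← Finset.sum_subset (Finset.subset_univ I)]
    · refine Finset.sum_congr rfl fun r hr => ?_
      rw [map_smul, Pi.smul_apply, (hI r hr).1 i, Matrix.map_apply, (hI r hr).2, smul_eq_mul]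
    · intro r _ hr
      simp [c', hr]
  have h2 : ∀ r, ((z β ᵥ* M.adjugate) r : ℝ) = M.det * c' r := by
    intro r
    have h3 : ((z β ᵥ* M.adjugate) r : ℝ) =
        ((fun i => (z β i : ℝ)) ᵥ* (M.map (fun x => (x : ℝ))).adjugate) r := by
      have : (M.map (fun x => (x : ℝ))).adjugate = M.adjugate.map (fun x => (x : ℝ)) :=
        ((Int.castRingHom ℝ).map_adjugate M).symm
      rw [this]
      simp [Matrix.vecMul, dotProduct]
    rw [h3, h1, Matrix.vecMul_vecMul, Matrix.mul_adjugate, Matrix.vecMul_smul, Matrix.vecMul_one,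
      ← Int.cast_det]
    rfl
  refine ⟨fun r hr => ?_, ?_⟩
  · have := h2 r
    simp only [c', dif_neg hr, mul_zero] at this
    exact_mod_cast this
  · simp only [h2, mul_smul]
    rw [← Finset.smul_sum, hc']

open Classical in
/-- For large good moduli, a subsystem of the hyperplane equations has as many solutions modulo
`q` as its real solution space predicts. -/
theorem card_solvesMod [FiniteDimensional ℝ V] (φ : V →ₗ[ℝ] (Fin n → ℝ))
    (hφ : Function.Injective φ) (z : V → Fin n → ℤ) (P : Finset V)
    (hz : ∀ α ∈ P, ∀ i, φ α i = z α i) (B : Finset (V × ℤ)) (hB : ∀ p ∈ B, p.1 ∈ P) :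
    ∃ Q : ℕ, ∀ q : ℕ, Q ≤ q → 0 < q → GoodModulus z P q →
      Nat.card {x : Fin n → ZMod q // SolvesMod z B x} =
        if B.inf (fun p => hyperplane p.1 p.2) ≠ ⊥ then
          q ^ (n - Module.finrank ℝ V) *
            q ^ Module.finrank ℝ (B.inf fun p => hyperplane p.1 p.2).direction
        else 0 := by
  have hRP : ∀ α ∈ B.image Prod.fst, α ∈ P := by
    intro α hα
    obtain ⟨p, hp, rfl⟩ := Finset.mem_image.1 hα
    exact hB p hp
  obtain ⟨M, I, α, hdet, hrows, hI, hli, hspan⟩ :=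
    exists_det_ne_zero φ hφ z (B.image Prod.fst) fun α hα => hz α (hRP α hα)
  have hκ : ∀ r, r ∈ I → ∃ k, (α r, k) ∈ B := by
    intro r hr
    obtain ⟨p, hp, h⟩ := Finset.mem_image.1 (hI r hr).1
    exact ⟨p.2, by rw [← h]; exact hp⟩
  choose! κ hκ using hκ
  have hspan' : ∀ p ∈ B, p.1 ∈ Submodule.span ℝ (α '' I) := fun p hp =>
    hspan (Finset.mem_coe.2 (Finset.mem_image_of_mem _ hp))
  have hrel := fun p hp => cramer_relation φ z (M := M) (I := I) (α := α)
    (fun r hr => ⟨hz _ (hRP _ (hI r hr).1), (hI r hr).2⟩) (hspan' p hp) (hz p.1 (hB p hp))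
  -- `E p` is the defect, scaled by `M.det`, of equation `p` once the pivot equations hold. Real
  -- consistency means that all these integers vanish.
  let E : V × ℤ → ℤ := fun p => ∑ r ∈ I, (z p.1 ᵥ* M.adjugate) r * κ r - M.det * p.2
  -- consistency over the reals
  have hcons : B.inf (fun p => hyperplane p.1 p.2) ≠ ⊥ ↔ ∀ p ∈ B, E p = 0 := by
    rw [finset_inf_ne_bot_iff]
    constructor
    · rintro ⟨x, hx⟩ p hp
      have h1 : ∀ r ∈ I, inner ℝ (α r) x = (κ r : ℝ) := fun r hr => hx _ (hκ r hr)
      have h2 := congrArg (fun v => inner ℝ v x) (hrel p hp).2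
      simp only [sum_inner, real_inner_smul_left] at h2
      rw [show inner ℝ p.1 x = (p.2 : ℝ) from hx p hp, Finset.sum_congr rfl
        fun r hr => by rw [h1 r hr]] at h2
      have h3 : ((E p : ℤ) : ℝ) = 0 := by
        simp only [E, Int.cast_sub, Int.cast_sum, Int.cast_mul]
        rw [h2, sub_self]
      exact_mod_cast h3
    · intro hE
      obtain ⟨x, hx⟩ := exists_inner_eq hli fun r => (κ r : ℝ)
      refine ⟨x, fun p hp => ?_⟩
      have h2 := congrArg (fun v => inner ℝ v x) (hrel p hp).2
      simp only [sum_inner, real_inner_smul_left] at h2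
      rw [Finset.sum_congr rfl fun r hr => by rw [hx r hr]] at h2
      have h3 : ((E p : ℤ) : ℝ) = 0 := by rw [hE p hp]; simp
      simp only [E, Int.cast_sub, Int.cast_sum, Int.cast_mul] at h3
      rw [h2, ← mul_sub] at h3
      rcases mul_eq_zero.1 h3 with h4 | h4
      · exact absurd (by exact_mod_cast h4) hdet
      · exact sub_eq_zero.1 h4
  have hmul : ∀ {q : ℕ} (x : Fin n → ZMod q) (p) (_ : p ∈ B),
      (∑ r ∈ I, ((z p.1 ᵥ* M.adjugate) r : ZMod q) * (M.map (fun a => (a : ZMod q)) *ᵥ x) r) =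
        (M.det : ZMod q) * ((fun i => (z p.1 i : ZMod q)) ⬝ᵥ x) := by
    intro q x p hp
    have h1 : ∑ r ∈ I, ((z p.1 ᵥ* M.adjugate) r : ZMod q) *
        (M.map (fun a => (a : ZMod q)) *ᵥ x) r =
        (fun r => ((z p.1 ᵥ* M.adjugate) r : ZMod q)) ⬝ᵥ (M.map (fun a => (a : ZMod q)) *ᵥ x) := by
      rw [dotProduct]
      refine Finset.sum_subset (Finset.subset_univ I) fun r _ hr => ?_
      rw [(hrel p hp).1 r hr]; simp
    have h2 : (fun r => ((z p.1 ᵥ* M.adjugate) r : ZMod q)) ᵥ* M.map (fun a => (a : ZMod q)) =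
        fun i => (M.det : ZMod q) * (z p.1 i : ZMod q) := by
      funext i
      have h3 : (z p.1 ᵥ* M.adjugate ᵥ* M) i = M.det * z p.1 i := by
        rw [Matrix.vecMul_vecMul, Matrix.adjugate_mul, Matrix.vecMul_smul, Matrix.vecMul_one]
        rfl
      have h4 := congrArg (fun a : ℤ => (a : ZMod q)) h3
      simp only [Int.cast_mul] at h4
      rw [← h4]
      simp only [Matrix.vecMul, dotProduct, Matrix.map_apply]
      push_cast
      rfl
    rw [h1, Matrix.dotProduct_mulVec, h2]
    simp only [dotProduct, Finset.mul_sum, mul_assoc]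
  have hrowI : ∀ {q : ℕ} (x : Fin n → ZMod q), ∀ r ∈ I,
      (M.map (fun a => (a : ZMod q)) *ᵥ x) r = (fun i => (z (α r) i : ZMod q)) ⬝ᵥ x := by
    intro q x r hr
    simp only [Matrix.mulVec, dotProduct, Matrix.map_apply]
    rw [(hI r hr).2]
  -- Beyond this bound a nonzero `E p` is not divisible by `q`, so a system that is inconsistent
  -- over the reals stays inconsistent modulo `q`.
  refine ⟨1 + ∑ p ∈ B, (E p).natAbs, fun q hq hq0 hgood => ?_⟩
  have : NeZero q := ⟨hq0.ne'⟩
  have hunit : IsUnit (M.det : ZMod q) := by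
    have h1 := hgood M hdet fun r => (hrows r).imp_left fun ⟨β, h, h'⟩ => ⟨β, hRP β h, h'⟩
    exact (ZMod.coe_int_isUnit_iff_isCoprime _ _).2 h1.symm
  have hunit' : IsUnit (M.map (fun a => (a : ZMod q))).det := by
    rw [← Int.cast_det]; exact hunit
  by_cases hne : B.inf (fun p => hyperplane p.1 p.2) ≠ ⊥
  · rw [if_pos hne]
    have hE := hcons.1 hne
    have h1 : Nat.card {x : Fin n → ZMod q // SolvesMod z B x} = q ^ (n - I.card) := by
      rw [← card_mulVec_eq _ hunit' I fun r => (κ r : ZMod q)]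
      refine Nat.card_congr (Equiv.subtypeEquivRight fun x => ?_)
      constructor
      · intro hx r hr
        rw [hrowI x r hr]
        exact hx _ (hκ r hr)
      · intro hx p hp
        apply hunit.mul_left_cancel
        rw [← hmul x p hp, Finset.sum_congr rfl fun r hr => by rw [hx r hr]]
        have h3 := congrArg (fun a : ℤ => (a : ZMod q)) (hE p hp)
        simp only [E, Int.cast_sub, Int.cast_sum, Int.cast_mul, Int.cast_zero] at h3
        exact sub_eq_zero.1 h3
    have hS' : ∀ v ∈ α '' (I : Set (Fin n)), ∃ k, (v, k) ∈ B := by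
      rintro _ ⟨r, hr, rfl⟩
      exact ⟨κ r, hκ r hr⟩
    have h2 : Module.finrank ℝ (Submodule.span ℝ (α '' (I : Set (Fin n)))) = I.card := by
      have := finrank_span_eq_card (LinearIndepOn.linearIndependent hli)
      rw [show (Set.range fun x : (I : Set (Fin n)) => α x) = α '' I by ext; simp] at this
      rw [this]; simp
    have h3 := Submodule.finrank_add_finrank_orthogonal
      (Submodule.span ℝ (α '' (I : Set (Fin n))))
    have h4 : Module.finrank ℝ V ≤ n := by
      have := LinearMap.finrank_le_finrank_of_injective hφ
      simpa using this
    rw [h1, direction_inf_hyperplane B hspan' hS' hne, ← pow_add]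
    congr 1
    omega
  · rw [if_neg hne]
    rw [hcons] at hne
    push Not at hne
    obtain ⟨p, hp, hEp⟩ := hne
    rw [Nat.card_eq_zero]
    left
    rw [isEmpty_subtype]
    intro x hx
    have h1 := hmul x p hp
    rw [hx p hp, Finset.sum_congr rfl fun r hr => by rw [hrowI x r hr, hx _ (hκ r hr)]] at h1
    have h2 : ((E p : ℤ) : ZMod q) = 0 := by
      simp only [E, Int.cast_sub, Int.cast_sum, Int.cast_mul]
      rw [h1, sub_self]
    rw [ZMod.intCast_zmod_eq_zero_iff_dvd] at h2
    have h3 := Nat.le_of_dvd (Int.natAbs_pos.2 hEp) (Int.natAbs_dvd_natAbs.2 h2)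
    rw [Int.natAbs_natCast] at h3
    have h4 : (E p).natAbs ≤ ∑ p ∈ B, (E p).natAbs :=
      Finset.single_le_sum (f := fun p => (E p).natAbs) (fun _ _ => Nat.zero_le _) hp
    omega

theorem hyperplane_ne_top {α : V} (hα : α ≠ 0) (k : ℤ) : hyperplane α k ≠ ⊤ := by
  intro h
  have h0 : (0 : V) ∈ hyperplane α k := h ▸ AffineSubspace.mem_top ℝ V 0
  have h1 : α ∈ hyperplane α k := h ▸ AffineSubspace.mem_top ℝ V α
  rw [mem_hyperplane] at h0 h1
  rw [← h0, inner_zero_right, inner_self_eq_zero] at h1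
  exact hα h1

-- Inclusion–exclusion over subsystems; its terms match those of Whitney's formula.
open Classical in
theorem card_avoiding {W : Type*} {q : ℕ} [NeZero q] (z : W → Fin n → ℤ) (T : Finset (W × ℤ)) :
    (Nat.card {x : Fin n → ZMod q // ∀ p ∈ T, (fun i => (z p.1 i : ZMod q)) ⬝ᵥ x ≠ p.2} : ℤ) =
      ∑ B ∈ T.powerset, (-1 : ℤ) ^ B.card *
        Nat.card {x : Fin n → ZMod q // SolvesMod z B x} := by
  have h := Finset.inclusion_exclusion_card_inf_compl T fun p : W × ℤ =>
    (Finset.univ.filter fun x : Fin n → ZMod q => (fun i => (z p.1 i : ZMod q)) ⬝ᵥ x = p.2)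
  have key : ∀ p : (Fin n → ZMod q) → Prop, Nat.card {x // p x} = (Finset.univ.filter p).card := by
    intro p
    rw [Nat.card_eq_fintype_card, Fintype.card_subtype]
  simp only [key]
  refine Eq.trans ?_ (h.trans (Finset.sum_congr rfl fun B _ => ?_))
  · refine congrArg (fun s => ((Finset.card s : ℕ) : ℤ)) ?_
    ext x
    simp [Finset.mem_inf]
  · refine congrArg (fun s => (-1 : ℤ) ^ B.card * ((Finset.card s : ℕ) : ℤ)) ?_
    ext x
    simp [Finset.mem_inf, SolvesMod]

/-- The finite field method: for large good moduli `q`, the characteristic polynomial counts the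
points modulo `q` that avoid all hyperplanes. -/
theorem charPoly_deformation_eval [FiniteDimensional ℝ V] (φ : V →ₗ[ℝ] (Fin n → ℝ))
    (hφ : Function.Injective φ) (z : V → Fin n → ℤ) (P : Finset V)
    (hz : ∀ α ∈ P, ∀ i, φ α i = z α i) (hP : ∀ α ∈ P, α ≠ 0) (a b : ℤ) :
    ∃ Q : ℕ, ∀ q : ℕ, Q ≤ q → 0 < q → GoodModulus z P q →
      (Nat.card {x : Fin n → ZMod q // ∀ α ∈ P, ∀ k : ℤ, a ≤ k → k ≤ b →
        (fun i => (z α i : ZMod q)) ⬝ᵥ x ≠ k} : ℤ) =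
      (q : ℤ) ^ (n - Module.finrank ℝ V) * (charPoly (deformation P a b)).eval (q : ℤ) := by
  classical
  have h1 : ∀ B : Finset (V × ℤ), ∃ Q : ℕ, B ∈ (P ×ˢ Finset.Icc a b).powerset →
      ∀ q : ℕ, Q ≤ q → 0 < q → GoodModulus z P q →
      Nat.card {x : Fin n → ZMod q // SolvesMod z B x} =
        if B.inf (fun p => hyperplane p.1 p.2) ≠ ⊥ then
          q ^ (n - Module.finrank ℝ V) *
            q ^ Module.finrank ℝ (B.inf fun p => hyperplane p.1 p.2).direction
        else 0 := by
    intro B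
    by_cases hB : B ∈ (P ×ˢ Finset.Icc a b).powerset
    · obtain ⟨Q, hQ⟩ := card_solvesMod φ hφ z P hz B fun p hp =>
        (Finset.mem_product.1 (Finset.mem_powerset.1 hB hp)).1
      refine ⟨Q, fun _ => ?_⟩
      convert hQ
    · exact ⟨0, fun h => absurd h hB⟩
  choose Q hQ using h1
  refine ⟨∑ B ∈ (P ×ˢ Finset.Icc a b).powerset, Q B, fun q hq hq0 hgood => ?_⟩
  have : NeZero q := ⟨hq0.ne'⟩
  have h2 : Nat.card {x : Fin n → ZMod q // ∀ α ∈ P, ∀ k : ℤ, a ≤ k → k ≤ b →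
        (fun i => (z α i : ZMod q)) ⬝ᵥ x ≠ k} =
      Nat.card {x : Fin n → ZMod q // ∀ p ∈ P ×ˢ Finset.Icc a b,
        (fun i => (z p.1 i : ZMod q)) ⬝ᵥ x ≠ p.2} := by
    refine Nat.card_congr (Equiv.subtypeEquivRight fun x => ?_)
    constructor
    · intro h p hp
      rw [Finset.mem_product, Finset.mem_Icc] at hp
      exact h p.1 hp.1 p.2 hp.2.1 hp.2.2
    · intro h α hα k hk hk'
      exact h (α, k) (Finset.mem_product.2 ⟨hα, Finset.mem_Icc.2 ⟨hk, hk'⟩⟩)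
  have h3 : charPoly (deformation P a b) = _ :=
    charPoly_image (P ×ˢ Finset.Icc a b) (fun p : V × ℤ => hyperplane p.1 p.2)
      fun p hp => hyperplane_ne_top (hP _ (Finset.mem_product.1 hp).1) _
  rw [h2, card_avoiding, h3, eval_finsetSum, Finset.sum_filter, Finset.mul_sum]
  refine Finset.sum_congr rfl fun B hB => ?_
  rw [hQ B hB q ((Finset.single_le_sum (fun _ _ => Nat.zero_le _) hB).trans hq) hq0 hgood]
  split_ifs with h
  · simp only [eval_mul, eval_C, eval_pow, eval_X]
    push_cast
    ring
  · simp

end FiniteField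

/-! ### Determinants of matrices with root vectors as rows. -/

section Determinants

/-- If a family of integer vectors is stable under elimination with pivots in a set `U`, the
determinants of square matrices with rows in the family are `0` or products of pivots. -/
theorem det_mem_of_pivot (P : ∀ n : ℕ, (Fin n → ℤ) → Prop) (U : Submonoid ℤ) (hU : -1 ∈ U)
    (hP : ∀ (n : ℕ) (v : Fin (n + 1) → ℤ), P (n + 1) v → v ≠ 0 → ∃ i, v i ≠ 0 ∧ v i ∈ U ∧
      ∀ w, P (n + 1) w → ∃ w' : Fin n → ℤ, P n w' ∧
        ∀ k, v i * w (i.succAbove k) = v i * w' k + w i * v (i.succAbove k)) :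
    ∀ (n : ℕ) (M : Matrix (Fin n) (Fin n) ℤ), (∀ r, P n (M r)) → M.det = 0 ∨ M.det ∈ U := by
  intro n
  induction n with
  | zero => intro M _; right; simp [U.one_mem]
  | succ n ih =>
    intro M hM
    by_cases h0 : M 0 = 0
    · left
      exact Matrix.det_eq_zero_of_row_eq_zero 0 fun j => congrFun h0 j
    obtain ⟨i, hi0, hiU, hi⟩ := hP n (M 0) (hM 0) h0
    have h1 : ∀ r : Fin n, ∃ w' : Fin n → ℤ, P n w' ∧ ∀ k,
      M 0 i * M r.succ (i.succAbove k) = M 0 i * w' k + M r.succ i * M 0 (i.succAbove k) :=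
      fun r => hi _ (hM r.succ)
    choose N hN hN' using h1
    have hiQ : (M 0 i : ℚ) ≠ 0 := by exact_mod_cast hi0
    -- Row reduction clears column `i` below row `0`. The quotients are rational, but by `hN'` the
    -- remaining minor is the integer matrix `N`.
    let B : Matrix (Fin (n + 1)) (Fin (n + 1)) ℚ := fun r j =>
      (M r j : ℚ) - (if r = 0 then 0 else (M r i : ℚ) / M 0 i) * M 0 j
    have hB : (M.map fun x => (x : ℚ)).det = B.det := by
      refine Matrix.det_eq_of_forall_row_eq_smul_add_const
        (fun r => if r = 0 then 0 else (M r i : ℚ) / M 0 i) 0 (by simp) fun r j => ?_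
      simp [B]
    have hdet : (M.det : ℚ) = ((-1) ^ (0 + (i : ℕ)) * M 0 i * (Matrix.of N).det : ℤ) := by
      rw [Int.cast_det, hB, Matrix.det_succ_column _ i, Fin.sum_univ_succ]
      rw [Finset.sum_eq_zero, add_zero]
      · have h2 : B.submatrix (Fin.succAbove 0) i.succAbove =
            (Matrix.of N).map fun x => (x : ℚ) := by
          ext r k
          have h3 : (M 0 i : ℚ) * M r.succ (i.succAbove k) =
              M 0 i * N r k + M r.succ i * M 0 (i.succAbove k) := by
            exact_mod_cast hN' r k
          rw [Matrix.submatrix_apply, Matrix.map_apply, Matrix.of_apply, Fin.zero_succAbove]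
          simp only [B, Fin.succ_ne_zero, if_false]
          field_simp
          linarith
        rw [h2]
        push_cast
        simp [B]
      · intro r _
        have : B r.succ i = 0 := by
          simp only [B, Fin.succ_ne_zero, if_false]
          field_simp
          ring
        rw [this]
        ring
    have hdet' : M.det = (-1) ^ (0 + (i : ℕ)) * M 0 i * (Matrix.of N).det := by
      exact_mod_cast hdet
    rcases ih (Matrix.of N) hN with h | h
    · left; rw [hdet', h, mul_zero]
    · right; rw [hdet']
      exact U.mul_mem (U.mul_mem (U.pow_mem hU _) hiU) h

/-- The integers `±2 ^ k`. -/
def signedTwoPowers : Submonoid ℤ := Submonoid.closure {-1, 2}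

theorem isCoprime_of_mem_signedTwoPowers {d : ℤ} (hd : d ∈ signedTwoPowers) {q : ℕ}
    (hq : Odd q) : IsCoprime d q := by
  induction hd using Submonoid.closure_induction with
  | mem x hx =>
    rcases hx with rfl | rfl
    · exact isCoprime_one_left.neg_left
    · obtain ⟨m, rfl⟩ := hq
      exact ⟨-m, 1, by push_cast; ring⟩
  | one => exact isCoprime_one_left
  | mul x y _ _ hx hy => exact hx.mul_left hy

/-- An entry `±2` is alone in its row, so eliminating with it only deletes a column. A pivot `±1`
leaves norm at most `1` in its row, so elimination adds to another row no more than the norm of the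
entry it removes. -/
theorem det_of_l1_le_two {n : ℕ} (M : Matrix (Fin n) (Fin n) ℤ)
    (hM : ∀ r, ∑ i, |M r i| ≤ 2) : M.det = 0 ∨ M.det ∈ signedTwoPowers := by
  have hm1 : (-1 : ℤ) ∈ signedTwoPowers := Submonoid.subset_closure (by simp)
  have h2 : (2 : ℤ) ∈ signedTwoPowers := Submonoid.subset_closure (by simp)
  refine det_mem_of_pivot (fun n v => ∑ i, |v i| ≤ 2) _ hm1 ?_ n M hM
  intro n v hv hv0
  have hsplit : ∀ (i : Fin (n + 1)) (w : Fin (n + 1) → ℤ),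
      ∑ k, |w k| = |w i| + ∑ k : Fin n, |w (i.succAbove k)| := fun i w =>
    Fin.sum_univ_succAbove _ i
  by_cases h : ∃ i, 2 ≤ |v i|
  · obtain ⟨i, hi⟩ := h
    have hs := hsplit i v
    have hz : ∑ k : Fin n, |v (i.succAbove k)| = 0 :=
      le_antisymm (by linarith) (Finset.sum_nonneg fun _ _ => abs_nonneg _)
    have hz' : ∀ k, v (i.succAbove k) = 0 := fun k =>
      abs_eq_zero.1 ((Finset.sum_eq_zero_iff_of_nonneg fun _ _ => abs_nonneg _).1 hz k
        (Finset.mem_univ k))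
    have hvi : |v i| = 2 := by linarith
    refine ⟨i, fun h => by simp [h] at hi, ?_, fun w hw => ⟨fun k => w (i.succAbove k), ?_, ?_⟩⟩
    · rcases (abs_eq (by norm_num)).1 hvi with h | h
      · rw [h]; exact h2
      · rw [h, show (-2 : ℤ) = -1 * 2 by norm_num]; exact Submonoid.mul_mem _ hm1 h2
    · have := hsplit i w
      have := abs_nonneg (w i)
      linarith
    · intro k; rw [hz' k]; ring
  · push Not at h
    obtain ⟨i, hi⟩ : ∃ i, v i ≠ 0 := by
      by_contra hcon
      push Not at hcon
      exact hv0 (funext hcon)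
    have hvi : |v i| = 1 := le_antisymm (by have := h i; omega) (Int.one_le_abs hi)
    have hsq : v i * v i = 1 := by rw [← abs_mul_abs_self, hvi, one_mul]
    refine ⟨i, hi, ?_, fun w hw =>
      ⟨fun k => w (i.succAbove k) - v i * w i * v (i.succAbove k), ?_, ?_⟩⟩
    · rcases (abs_eq (by norm_num)).1 hvi with h | h
      · rw [h]; exact Submonoid.one_mem _
      · rw [h]; exact hm1
    · have hsv := hsplit i v
      have hsw := hsplit i w
      have h3 : ∑ k : Fin n, |w (i.succAbove k) - v i * w i * v (i.succAbove k)| ≤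
          ∑ k : Fin n, |w (i.succAbove k)| + |w i| * ∑ k : Fin n, |v (i.succAbove k)| := by
        rw [Finset.mul_sum, ← Finset.sum_add_distrib]
        refine Finset.sum_le_sum fun k _ => (abs_sub _ _).trans ?_
        rw [abs_mul, abs_mul, hvi, one_mul]
      have h4 : |w i| * ∑ k : Fin n, |v (i.succAbove k)| ≤ |w i| * 1 :=
        mul_le_mul_of_nonneg_left (by linarith) (abs_nonneg _)
      linarith
    · intro k
      linear_combination (w i * v (i.succAbove k)) * hsq

/-- Bounded subset sums characterise a class containing the roots of type A and the unit vectors and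
stable under elimination. Stability compares the sums over `s` with and without the pivot index. -/
theorem det_of_abs_subset_sum_le_one {n : ℕ} (M : Matrix (Fin n) (Fin n) ℤ)
    (hM : ∀ r, ∀ s : Finset (Fin n), |∑ i ∈ s, M r i| ≤ 1) :
    M.det = 0 ∨ IsUnit M.det := by
  refine (det_mem_of_pivot (fun n v => ∀ s : Finset (Fin n), |∑ i ∈ s, v i| ≤ 1)
    (IsUnit.submonoid ℤ) (by simp [IsUnit.mem_submonoid_iff]) ?_ n M hM)
  intro n v hv hv0
  obtain ⟨i, hi⟩ : ∃ i, v i ≠ 0 := by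
    by_contra hcon
    push Not at hcon
    exact hv0 (funext hcon)
  have hvi : |v i| ≤ 1 := by simpa using hv {i}
  have hvi' : v i = 1 ∨ v i = -1 := by
    have := abs_le.1 hvi; omega
  refine ⟨i, hi, Int.isUnit_iff.2 hvi', fun w hw =>
    ⟨fun k => w (i.succAbove k) - v i * w i * v (i.succAbove k), fun s => ?_, fun k => ?_⟩⟩
  · have hmap : ∀ u : Fin (n + 1) → ℤ, (∀ s : Finset (Fin (n + 1)), |∑ i ∈ s, u i| ≤ 1) →
        |∑ k ∈ s, u (i.succAbove k)| ≤ 1 ∧ |u i + ∑ k ∈ s, u (i.succAbove k)| ≤ 1 := by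
      intro u hu
      have h1 := hu (s.map i.succAboveEmb)
      have h2 := hu (insert i (s.map i.succAboveEmb))
      rw [Finset.sum_insert (by simp [Fin.succAbove_ne])] at h2
      simp only [Finset.sum_map, Fin.coe_succAboveEmb] at h1 h2
      exact ⟨h1, h2⟩
    obtain ⟨hv1, hv2⟩ := hmap v hv
    obtain ⟨hw1, hw2⟩ := hmap w hw
    have hwi : |w i| ≤ 1 := by simpa using hw {i}
    rw [Finset.sum_sub_distrib, ← Finset.mul_sum]
    generalize ∑ k ∈ s, v (i.succAbove k) = x at *
    generalize ∑ k ∈ s, w (i.succAbove k) = y at *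
    rw [abs_le] at *
    have hwi' : w i = -1 ∨ w i = 0 ∨ w i = 1 := by omega
    rcases hvi' with h | h <;> rcases hwi' with h' | h' | h' <;> simp only [h, h'] at * <;> omega
  · rcases hvi' with h | h <;> rw [h] <;> ring

end Determinants

/-! ### The root systems in coordinates, and their point counts. -/

section Specialization

open Matrix

variable {n : ℕ}

/-- The coordinate map of Euclidean space. -/
def coordMap (n : ℕ) : EuclideanSpace ℝ (Fin n) →ₗ[ℝ] (Fin n → ℝ) :=
  (WithLp.linearEquiv 2 ℝ (Fin n → ℝ)).toLinearMap

theorem coordMap_injective (n : ℕ) : Function.Injective (coordMap n) :=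
  (WithLp.linearEquiv 2 ℝ (Fin n → ℝ)).injective

theorem coordMap_apply (α : EuclideanSpace ℝ (Fin n)) (i : Fin n) : coordMap n α i = α i := rfl

/-- The integer parts of the coordinates. -/
def intCoord (α : EuclideanSpace ℝ (Fin n)) : Fin n → ℤ := fun i => ⌊α i⌋

theorem intCoord_eq {α : EuclideanSpace ℝ (Fin n)} {w : Fin n → ℤ} (h : ∀ i, α i = w i) :
    intCoord α = w := by
  funext i
  simp [intCoord, h i]

theorem e_apply (i k : Fin n) : (e i : EuclideanSpace ℝ (Fin n)) k =
    ((Pi.single i 1 : Fin n → ℤ) k : ℤ) := by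
  by_cases h : k = i
  · subst h; simp [e]
  · simp [e, h]

theorem e_sub_apply (i j k : Fin n) : (e i - e j : EuclideanSpace ℝ (Fin n)) k =
    ((Pi.single i 1 - Pi.single j 1 : Fin n → ℤ) k : ℤ) := by
  rw [PiLp.sub_apply, e_apply, e_apply, Pi.sub_apply, Int.cast_sub]

theorem e_add_apply (i j k : Fin n) : (e i + e j : EuclideanSpace ℝ (Fin n)) k =
    ((Pi.single i 1 + Pi.single j 1 : Fin n → ℤ) k : ℤ) := by
  rw [PiLp.add_apply, e_apply, e_apply, Pi.add_apply, Int.cast_add]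

theorem two_e_apply (i k : Fin n) : ((2 : ℝ) • e i : EuclideanSpace ℝ (Fin n)) k =
    ((Pi.single i 2 : Fin n → ℤ) k : ℤ) := by
  rw [PiLp.smul_apply, e_apply]
  by_cases h : k = i
  · subst h; simp
  · simp [h]

theorem mem_posD {α : EuclideanSpace ℝ (Fin n)} : α ∈ posD n ↔
    (∃ i j, i < j ∧ α = e i - e j) ∨ ∃ i j, i < j ∧ α = e i + e j := by
  simp [posD, pairs, eq_comm]

theorem mem_posB {α : EuclideanSpace ℝ (Fin n)} : α ∈ posB n ↔
    (∃ i, α = e i) ∨ α ∈ posD n := by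
  simp [posB, eq_comm]

theorem mem_posC {α : EuclideanSpace ℝ (Fin n)} : α ∈ posC n ↔
    (∃ i, α = (2 : ℝ) • e i) ∨ α ∈ posD n := by
  simp [posC, eq_comm]

theorem mem_posBC {α : EuclideanSpace ℝ (Fin n)} : α ∈ posBC n ↔
    (∃ i, α = e i) ∨ (∃ i, α = (2 : ℝ) • e i) ∨ α ∈ posD n := by
  simp only [posBC, Finset.mem_union, mem_posB, mem_posC]
  tauto

/-- Types B, C and D are subsets of `posBC n`, so this single bound makes every odd modulus good for
all four. -/
theorem exists_int_of_mem_posBC {α : EuclideanSpace ℝ (Fin n)} (hα : α ∈ posBC n) :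
    ∃ w : Fin n → ℤ, w ≠ 0 ∧ ∑ i, |w i| ≤ 2 ∧ ∀ i, α i = w i := by
  have hs : ∀ (i : Fin n) (c : ℤ), ∑ k, |(Pi.single i c : Fin n → ℤ) k| = |c| := by
    intro i c
    rw [Finset.sum_eq_single i] <;> simp +contextual
  rw [mem_posBC, mem_posD] at hα
  rcases hα with ⟨i, rfl⟩ | ⟨i, rfl⟩ | ⟨i, j, hij, rfl⟩ | ⟨i, j, hij, rfl⟩
  · exact ⟨_, by simp, by rw [hs]; simp, e_apply i⟩
  · exact ⟨_, by simp, by rw [hs]; simp, two_e_apply i⟩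
  · refine ⟨_, fun h => ?_, ?_, e_sub_apply i j⟩
    · have := congrFun h i
      simp [hij.ne] at this
    · calc _ ≤ ∑ k, (|(Pi.single i 1 : Fin n → ℤ) k| + |(Pi.single j 1 : Fin n → ℤ) k|) :=
            Finset.sum_le_sum fun k _ => abs_sub _ _
        _ ≤ 2 := by rw [Finset.sum_add_distrib, hs, hs]; simp
  · refine ⟨_, fun h => ?_, ?_, e_add_apply i j⟩
    · have := congrFun h i
      simp [hij.ne] at this
    · calc _ ≤ ∑ k, (|(Pi.single i 1 : Fin n → ℤ) k| + |(Pi.single j 1 : Fin n → ℤ) k|) :=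
            Finset.sum_le_sum fun k _ => abs_add_le _ _
        _ ≤ 2 := by rw [Finset.sum_add_distrib, hs, hs]; simp

theorem goodModulus_of_odd {P : Finset (EuclideanSpace ℝ (Fin n))} (hP : P ⊆ posBC n) {q : ℕ}
    (hq : Odd q) : GoodModulus intCoord P q := by
  intro M hM hrows
  refine isCoprime_of_mem_signedTwoPowers ((det_of_l1_le_two M fun r => ?_).resolve_left hM) hq
  rcases hrows r with ⟨β, hβ, h⟩ | ⟨j, h⟩
  · obtain ⟨w, -, hw, hw'⟩ := exists_int_of_mem_posBC (hP hβ)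
    rw [h, intCoord_eq hw']
    exact hw
  · rw [h, Finset.sum_eq_single j] <;> simp +contextual

theorem charPoly_eval_of_odd {P : Finset (EuclideanSpace ℝ (Fin n))} (hP : P ⊆ posBC n) (a b : ℤ) :
    ∃ Q : ℕ, ∀ q : ℕ, Q ≤ q → Odd q →
      (Nat.card {x : Fin n → ZMod q // ∀ α ∈ P, ∀ k : ℤ, a ≤ k → k ≤ b →
        (fun i => (intCoord α i : ZMod q)) ⬝ᵥ x ≠ k} : ℤ) =
      (charPoly (deformation P a b)).eval (q : ℤ) := by
  obtain ⟨Q, hQ⟩ := charPoly_deformation_eval (coordMap n) (coordMap_injective n) intCoord P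
    (fun α hα i => by
      obtain ⟨w, -, -, hw⟩ := exists_int_of_mem_posBC (hP hα)
      rw [intCoord_eq hw, coordMap_apply, hw])
    (fun α hα h => by
      obtain ⟨w, hw0, -, hw⟩ := exists_int_of_mem_posBC (hP hα)
      apply hw0
      funext i
      have h1 : (w i : ℝ) = 0 := by rw [← hw i, h]; rfl
      exact_mod_cast h1) a b
  refine ⟨Q, fun q hq hodd => ?_⟩
  rw [hQ q hq hodd.pos (goodModulus_of_odd hP hodd)]
  simp

/-- The coordinates avoid the hyperplanes `x i - x j = k` and `x i + x j = k`. -/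
def AvoidsPairs (a b : ℤ) {q : ℕ} (x : Fin n → ZMod q) : Prop :=
  ∀ i j, i < j → ∀ k : ℤ, a ≤ k → k ≤ b → x i - x j ≠ k ∧ x i + x j ≠ k

/-- The coordinates avoid the hyperplanes `c * x i = k`. -/
def AvoidsMultiples (c : ℤ) (a b : ℤ) {q : ℕ} (x : Fin n → ZMod q) : Prop :=
  ∀ i, ∀ k : ℤ, a ≤ k → k ≤ b → (c : ZMod q) * x i ≠ k

theorem single_dotProduct_cast {q : ℕ} (i : Fin n) (c : ℤ) (x : Fin n → ZMod q) :
    (fun k => (((Pi.single i c : Fin n → ℤ) k : ℤ) : ZMod q)) ⬝ᵥ x = c * x i := by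
  rw [dotProduct, Finset.sum_eq_single i] <;> simp +contextual

theorem intCoord_e_sub_dotProduct {q : ℕ} (x : Fin n → ZMod q) (i j : Fin n) :
    (fun k => (intCoord (e i - e j) k : ZMod q)) ⬝ᵥ x = x i - x j := by
  rw [intCoord_eq (e_sub_apply i j)]
  have := congrArg₂ (fun a b => a - b) (single_dotProduct_cast i 1 x)
    (single_dotProduct_cast j 1 x)
  simp only [← sub_dotProduct, Int.cast_one, one_mul] at this
  rw [← this]
  congr 1
  funext k
  simp

theorem intCoord_e_add_dotProduct {q : ℕ} (x : Fin n → ZMod q) (i j : Fin n) :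
    (fun k => (intCoord (e i + e j) k : ZMod q)) ⬝ᵥ x = x i + x j := by
  rw [intCoord_eq (e_add_apply i j)]
  have := congrArg₂ (fun a b => a + b) (single_dotProduct_cast i 1 x)
    (single_dotProduct_cast j 1 x)
  simp only [← add_dotProduct, Int.cast_one, one_mul] at this
  rw [← this]
  congr 1
  funext k
  simp

theorem avoidsPairs_iff {q : ℕ} (a b : ℤ) (x : Fin n → ZMod q) :
    (∀ α ∈ posD n, ∀ k : ℤ, a ≤ k → k ≤ b → (fun i => (intCoord α i : ZMod q)) ⬝ᵥ x ≠ k) ↔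
      AvoidsPairs a b x := by
  have h1 := intCoord_e_sub_dotProduct x
  have h2 := intCoord_e_add_dotProduct x
  constructor
  · intro h i j hij k hk hk'
    rw [← h1, ← h2]
    exact ⟨h _ (mem_posD.2 (Or.inl ⟨i, j, hij, rfl⟩)) k hk hk',
      h _ (mem_posD.2 (Or.inr ⟨i, j, hij, rfl⟩)) k hk hk'⟩
  · intro h α hα k hk hk'
    rcases mem_posD.1 hα with ⟨i, j, hij, rfl⟩ | ⟨i, j, hij, rfl⟩
    · rw [h1]; exact (h i j hij k hk hk').1
    · rw [h2]; exact (h i j hij k hk hk').2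

theorem avoidsMultiples_one_iff {q : ℕ} (a b : ℤ) (x : Fin n → ZMod q) :
    (∀ α, (∃ i, α = e i) → ∀ k : ℤ, a ≤ k → k ≤ b →
      (fun i => (intCoord α i : ZMod q)) ⬝ᵥ x ≠ k) ↔ AvoidsMultiples 1 a b x := by
  have h1 : ∀ i : Fin n, (fun k => (intCoord (e i) k : ZMod q)) ⬝ᵥ x = (1 : ℤ) * x i := by
    intro i
    rw [intCoord_eq (e_apply i), single_dotProduct_cast]
  constructor
  · intro h i k hk hk'
    rw [← h1]; exact h _ ⟨i, rfl⟩ k hk hk'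
  · rintro h _ ⟨i, rfl⟩ k hk hk'
    rw [h1]; exact h i k hk hk'

theorem avoidsMultiples_two_iff {q : ℕ} (a b : ℤ) (x : Fin n → ZMod q) :
    (∀ α, (∃ i, α = (2 : ℝ) • e i) → ∀ k : ℤ, a ≤ k → k ≤ b →
      (fun i => (intCoord α i : ZMod q)) ⬝ᵥ x ≠ k) ↔ AvoidsMultiples 2 a b x := by
  have h1 : ∀ i : Fin n, (fun k => (intCoord ((2 : ℝ) • e i) k : ZMod q)) ⬝ᵥ x =
      (2 : ℤ) * x i := by
    intro i
    rw [intCoord_eq (two_e_apply i), single_dotProduct_cast]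
  constructor
  · intro h i k hk hk'
    rw [← h1]; exact h _ ⟨i, rfl⟩ k hk hk'
  · rintro h _ ⟨i, rfl⟩ k hk hk'
    rw [h1]; exact h i k hk hk'

theorem charPoly_posD_eval (n : ℕ) (a b : ℤ) : ∃ Q : ℕ, ∀ q : ℕ, Q ≤ q → Odd q →
    (Nat.card {x : Fin n → ZMod q // AvoidsPairs a b x} : ℤ) =
      (charPoly (deformation (posD n) a b)).eval (q : ℤ) := by
  have hsub : posD n ⊆ posBC n := fun α h => mem_posBC.2 (Or.inr (Or.inr h))
  obtain ⟨Q, hQ⟩ := charPoly_eval_of_odd hsub a b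
  refine ⟨Q, fun q hq hodd => (congrArg Nat.cast ?_).trans (hQ q hq hodd)⟩
  exact Nat.card_congr (Equiv.subtypeEquivRight fun x => (avoidsPairs_iff a b x).symm)

theorem charPoly_posB_eval (n : ℕ) (a b : ℤ) : ∃ Q : ℕ, ∀ q : ℕ, Q ≤ q → Odd q →
    (Nat.card {x : Fin n → ZMod q // AvoidsMultiples 1 a b x ∧ AvoidsPairs a b x} : ℤ) =
      (charPoly (deformation (posB n) a b)).eval (q : ℤ) := by
  have hsub : posB n ⊆ posBC n := fun α h => mem_posBC.2 ((mem_posB.1 h).imp_right Or.inr)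
  obtain ⟨Q, hQ⟩ := charPoly_eval_of_odd hsub a b
  refine ⟨Q, fun q hq hodd => (congrArg Nat.cast ?_).trans (hQ q hq hodd)⟩
  refine Nat.card_congr (Equiv.subtypeEquivRight fun x => ?_)
  rw [← avoidsPairs_iff, ← avoidsMultiples_one_iff]
  simp only [mem_posB, or_imp, forall_and]

theorem charPoly_posC_eval (n : ℕ) (a b : ℤ) : ∃ Q : ℕ, ∀ q : ℕ, Q ≤ q → Odd q →
    (Nat.card {x : Fin n → ZMod q // AvoidsMultiples 2 a b x ∧ AvoidsPairs a b x} : ℤ) =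
      (charPoly (deformation (posC n) a b)).eval (q : ℤ) := by
  have hsub : posC n ⊆ posBC n := fun α h => mem_posBC.2 (Or.inr (mem_posC.1 h))
  obtain ⟨Q, hQ⟩ := charPoly_eval_of_odd hsub a b
  refine ⟨Q, fun q hq hodd => (congrArg Nat.cast ?_).trans (hQ q hq hodd)⟩
  refine Nat.card_congr (Equiv.subtypeEquivRight fun x => ?_)
  rw [← avoidsPairs_iff, ← avoidsMultiples_two_iff]
  simp only [mem_posC, or_imp, forall_and]

theorem charPoly_posBC_eval (n : ℕ) (a b : ℤ) : ∃ Q : ℕ, ∀ q : ℕ, Q ≤ q → Odd q →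
    (Nat.card {x : Fin n → ZMod q //
      AvoidsMultiples 1 a b x ∧ AvoidsMultiples 2 a b x ∧ AvoidsPairs a b x} : ℤ) =
      (charPoly (deformation (posBC n) a b)).eval (q : ℤ) := by
  obtain ⟨Q, hQ⟩ := charPoly_eval_of_odd (Finset.Subset.refl (posBC n)) a b
  refine ⟨Q, fun q hq hodd => (congrArg Nat.cast ?_).trans (hQ q hq hodd)⟩
  refine Nat.card_congr (Equiv.subtypeEquivRight fun x => ?_)
  rw [← avoidsPairs_iff, ← avoidsMultiples_one_iff, ← avoidsMultiples_two_iff]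
  simp only [mem_posBC, or_imp, forall_and]

/-- The coordinates avoid the hyperplanes `x i - x j = k`. -/
def AvoidsDifferences (a b : ℤ) {q : ℕ} (x : Fin n → ZMod q) : Prop :=
  ∀ i j, i < j → ∀ k : ℤ, a ≤ k → k ≤ b → x i - x j ≠ k

theorem finrank_sumZero (n : ℕ) : Module.finrank ℝ (sumZero (n + 1)) + 1 = n + 1 := by
  let f : Module.Dual ℝ (EuclideanSpace ℝ (Fin (n + 1))) :=
    { toFun := fun x => ∑ i, x i
      map_add' := fun x y => by simp [Finset.sum_add_distrib]
      map_smul' := fun c x => by simp [Finset.mul_sum] }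
  have h0 : f ≠ 0 := by
    intro h
    have := LinearMap.congr_fun h (e 0)
    simp [f, e] at this
  have h1 : sumZero (n + 1) = LinearMap.ker f := by
    ext x
    rfl
  rw [h1, Module.Dual.finrank_ker_add_one_of_ne_zero h0]
  simp

theorem goodModulus_posA (n q : ℕ) :
    GoodModulus (fun α : sumZero n => intCoord α.1) (posA n) q := by
  intro M hM hrows
  have := (det_of_abs_subset_sum_le_one M fun r => ?_).resolve_left hM
  · obtain ⟨u, hu⟩ := this
    rw [← hu]
    exact isCoprime_one_left.of_isCoprime_of_dvd_left (Units.isUnit u).dvd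
  · intro s
    rcases hrows r with ⟨β, hβ, h⟩ | ⟨j, h⟩
    · simp only [posA, Finset.mem_image] at hβ
      obtain ⟨p, -, rfl⟩ := hβ
      rw [h]
      simp only [intCoord_eq (e_sub_apply p.1 p.2)]
      simp only [Pi.sub_apply, Finset.sum_sub_distrib, Finset.sum_pi_single']
      split_ifs <;> simp
    · rw [h]
      simp only [Finset.sum_pi_single']
      split_ifs <;> simp

/-- Differences are invariant under translation, so coordinate `0` is free and the others may be
measured from it. The multiple `-1` records `x 0 - x j`. The factor `q` will cancel the one caused
by the codimension of `sumZero`. -/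
theorem card_avoidsDifferences_cons (n : ℕ) (a b : ℤ) (q : ℕ) [NeZero q] :
    Nat.card {x : Fin (n + 1) → ZMod q // AvoidsDifferences a b x} =
      q * Nat.card {y : Fin n → ZMod q //
        AvoidsMultiples (-1) a b y ∧ AvoidsDifferences a b y} := by
  have h1 : Nat.card {x : Fin (n + 1) → ZMod q // AvoidsDifferences a b x} =
      Nat.card (ZMod q × {y : Fin n → ZMod q //
        AvoidsMultiples (-1) a b y ∧ AvoidsDifferences a b y}) := by
    refine Nat.card_congr
      { toFun := fun x => (x.1 0, ⟨fun i => x.1 i.succ - x.1 0, fun i k hk hk' => ?_,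
          fun i j hij k hk hk' => ?_⟩)
        invFun := fun p => ⟨Fin.cons p.1 fun i => p.2.1 i + p.1, fun i j hij k hk hk' => ?_⟩
        left_inv := fun x => ?_
        right_inv := fun p => ?_ }
    · have := x.2 0 i.succ (Fin.succ_pos i) k hk hk'
      intro h
      apply this
      rw [← h]; push_cast; ring
    · have := x.2 i.succ j.succ (Fin.succ_lt_succ_iff.2 hij) k hk hk'
      intro h
      apply this
      rw [← h]; ring
    · refine Fin.cases (fun hij => ?_) (fun i hij => ?_) i hij
      · obtain ⟨j, rfl⟩ := Fin.exists_succ_eq.2 hij.ne'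
        have := p.2.2.1 j k hk hk'
        intro h
        apply this
        rw [← h]; simp
      · obtain ⟨j, rfl⟩ := Fin.exists_succ_eq.2 ((Fin.succ_pos i).trans hij).ne'
        have := p.2.2.2 i j (Fin.succ_lt_succ_iff.1 hij) k hk hk'
        intro h
        apply this
        rw [← h]; simp
    · apply Subtype.ext
      funext i
      refine Fin.cases ?_ (fun i => ?_) i <;> simp
    · ext <;> simp
  rw [h1, Nat.card_prod, Nat.card_zmod]

theorem charPoly_posA_eval (n : ℕ) (a b : ℤ) : ∃ Q : ℕ, ∀ q : ℕ, Q ≤ q → 0 < q →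
    (Nat.card {y : Fin n → ZMod q // AvoidsMultiples (-1) a b y ∧ AvoidsDifferences a b y} : ℤ) =
      (charPoly (deformation (posA (n + 1)) a b)).eval (q : ℤ) := by
  have hroot : ∀ α ∈ posA (n + 1), ∃ i j, i < j ∧ α.1 = e i - e j := by
    intro α hα
    simp only [posA, pairs, Finset.mem_image, Finset.mem_filter] at hα
    obtain ⟨p, ⟨-, hp⟩, rfl⟩ := hα
    exact ⟨_, _, hp, rfl⟩
  obtain ⟨Q, hQ⟩ := charPoly_deformation_eval
    ((coordMap (n + 1)).comp (sumZero (n + 1)).subtype)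
    ((coordMap_injective _).comp Subtype.val_injective)
    (fun α : sumZero (n + 1) => intCoord α.1) (posA (n + 1))
    (fun α hα i => by
      obtain ⟨i, j, -, h⟩ := hroot α hα
      rw [h, intCoord_eq (e_sub_apply i j), ← e_sub_apply, ← h]
      rfl)
    (fun α hα h0 => by
      obtain ⟨i, j, hij, h⟩ := hroot α hα
      rw [h0] at h
      have := e_sub_apply i j i
      rw [← h] at this
      simp [hij.ne] at this) a b
  refine ⟨Q, fun q hq hq0 => ?_⟩
  have : NeZero q := ⟨hq0.ne'⟩
  have h1 := hQ q hq hq0 (goodModulus_posA _ _)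
  have h2 : n + 1 - Module.finrank ℝ (sumZero (n + 1)) = 1 := by
    have := finrank_sumZero n; omega
  rw [h2, pow_one] at h1
  have h4 : Nat.card {x : Fin (n + 1) → ZMod q // ∀ α ∈ posA (n + 1), ∀ k : ℤ, a ≤ k → k ≤ b →
      (fun i => (intCoord α.1 i : ZMod q)) ⬝ᵥ x ≠ k} =
      Nat.card {x : Fin (n + 1) → ZMod q // AvoidsDifferences a b x} := by
    refine Nat.card_congr (Equiv.subtypeEquivRight fun x => ?_)
    constructor
    · intro h i j hij k hk hk'
      rw [← intCoord_e_sub_dotProduct]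
      exact h ⟨e i - e j, e_sub_e_mem i j⟩
        (Finset.mem_image.2 ⟨(i, j), by simp [pairs, hij], rfl⟩) k hk hk'
    · intro h α hα k hk hk'
      obtain ⟨i, j, hij, h'⟩ := hroot α hα
      rw [h', intCoord_e_sub_dotProduct]
      exact h i j hij k hk hk'
  rw [h4, card_avoidsDifferences_cons] at h1
  push_cast at h1
  exact mul_left_cancel₀ (by exact_mod_cast hq0.ne') h1

end Specialization

/-! ### Gap conditions, and their reduction to neighbours and to the ends. -/

section Gaps

variable {n : ℕ}

/-- Consecutive-or-not gaps between the values of `S`, listed in the order `r`, exceed `A`, and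
even `B` at descents of `l`. -/
def GapCond (r : Equiv.Perm (Fin n)) (l : Fin n → ℤ) (A B : ℤ) (S : Fin n → ℤ) : Prop :=
  ∀ u v, r u < r v → A < S v - S u ∧ (l v < l u → B < S v - S u)

/-- The values of `S` exceed `A`, and even `B` where `l` is negative. -/
def FrontSingle (l : Fin n → ℤ) (A B : ℤ) (S : Fin n → ℤ) : Prop :=
  ∀ u, A < S u ∧ (l u < 0 → B < S u)

/-- The sums of two values of `S` exceed `A`, and even `B` where the sum of `l` is negative. -/
def FrontPair (l : Fin n → ℤ) (A B : ℤ) (S : Fin n → ℤ) : Prop :=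
  ∀ u v, u ≠ v → A < S u + S v ∧ (l u + l v < 0 → B < S u + S v)

/-- If the label drops between two ranks, it drops on some step between them; that step exceeds `B`,
and the others are nonnegative integers because `A ≥ -1`. -/
theorem gapCond_iff_adjacent (r : Equiv.Perm (Fin n)) (l : Fin n → ℤ) {A B : ℤ} (hA : -1 ≤ A)
    (S : Fin n → ℤ) : GapCond r l A B S ↔
      ∀ u v, (r v : ℕ) = r u + 1 → A < S v - S u ∧ (l v < l u → B < S v - S u) := by
  constructor
  · intro h u v huv
    exact h u v (by rw [Fin.lt_def]; omega)
  · intro h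
    have key : ∀ (d : ℕ) (u v : Fin n), (r v : ℕ) = r u + 1 + d →
        A < S v - S u ∧ (l v < l u → B < S v - S u) := by
      intro d
      induction d with
      | zero => exact fun u v huv => h u v huv
      | succ d ih =>
        intro u v huv
        have hlt : (r u : ℕ) + 1 < n := by have := (r v).2; omega
        obtain ⟨w, hw⟩ : ∃ w, (r w : ℕ) = r u + 1 := ⟨r.symm ⟨r u + 1, hlt⟩, by simp⟩
        have h1 := h u w hw
        have h2 := ih w v (by omega)
        refine ⟨by linarith [h1.1, h2.1], fun hl => ?_⟩
        by_cases hc : l w < l u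
        · linarith [h1.2 hc, h2.1]
        · linarith [h1.1, h2.2 (by omega)]
    intro u v huv
    rw [Fin.lt_def] at huv
    exact key (r v - r u - 1) u v (by omega)

/-- Adding `t` times the rank changes every adjacent gap by exactly `t`. More distant gaps change by
more, whence the passage to neighbours on both sides. -/
theorem gapCond_shift (r : Equiv.Perm (Fin n)) (l : Fin n → ℤ) {A B t : ℤ} (c : ℤ)
    (hA : -1 ≤ A) (hAt : -1 ≤ A - t) (S : Fin n → ℤ) :
    GapCond r l A B (fun u => S u + (t * (r u : ℕ) + c)) ↔ GapCond r l (A - t) (B - t) S := by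
  rw [gapCond_iff_adjacent r l hA, gapCond_iff_adjacent r l hAt]
  refine forall₃_congr fun u v huv => ?_
  have : (((r v : Fin n) : ℕ) : ℤ) = (r u : ℕ) + 1 := by exact_mod_cast huv
  rw [this]
  refine and_congr ?_ (imp_congr Iff.rfl ?_) <;> constructor <;> intro h <;> linarith

/-- Reflection reverses ranks and negates labels, so conditions at the back end can be treated as
front conditions. -/
theorem GapCond.mirror {r : Equiv.Perm (Fin n)} {l : Fin n → ℤ} {A B : ℤ} {S : Fin n → ℤ}
    (h : GapCond r l A B S) (q : ℤ) :
    GapCond (r.trans Fin.revPerm) (fun u => -l u) A B (fun u => q - S u) := by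
  intro u v huv
  have := h v u (by simpa using huv)
  refine ⟨by linarith [this.1], fun hl => ?_⟩
  linarith [this.2 (by linarith)]

theorem GapCond.le {r : Equiv.Perm (Fin n)} {l : Fin n → ℤ} {A B : ℤ} {S : Fin n → ℤ}
    (h : GapCond r l A B S) (hA : -1 ≤ A) {u v : Fin n} (huv : r u ≤ r v) : S u ≤ S v := by
  rcases huv.lt_or_eq with h1 | h1
  · linarith [(h u v h1).1]
  · rw [r.injective h1]

/-- The first value controls the rest: if its label is not negative, a later negative label is a
descent from it, and the gap supplies the larger bound. -/
theorem frontSingle_iff_first {r : Equiv.Perm (Fin n)} {l : Fin n → ℤ} {A' B' A B : ℤ}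
    {S : Fin n → ℤ} (h : GapCond r l A' B' S) (hA' : -1 ≤ A') (hB : B ≤ B' + A + 1) :
    FrontSingle l A B S ↔ ∀ u, (r u : ℕ) = 0 → A < S u ∧ (l u < 0 → B < S u) := by
  constructor
  · exact fun h1 u _ => h1 u
  · intro h1 u
    have hn : 0 < n := Fin.pos u
    obtain ⟨f, hf⟩ : ∃ f, (r f : ℕ) = 0 := ⟨r.symm ⟨0, hn⟩, by simp⟩
    have h2 := h1 f hf
    have h3 := h.le hA' (u := f) (v := u) (by rw [Fin.le_def]; omega)
    refine ⟨by linarith [h2.1], fun hl => ?_⟩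
    by_cases hlf : l f < 0
    · linarith [h2.2 hlf]
    · have hne : r f ≠ r u := by
        intro he
        rw [r.injective he] at hlf
        exact hlf hl
      have h4 := (h f u (by rw [Fin.lt_def]; rw [Ne, Fin.ext_iff] at hne; omega)).2 (by omega)
      linarith [h2.1]

/-- Lower the larger rank step by step, by induction on the sum of the ranks. Either the label drops
on the way, and the gap alone exceeds `B`, or the smaller pair still has negative label sum. -/
theorem frontPair_iff_first {r : Equiv.Perm (Fin n)} {l : Fin n → ℤ} {A B : ℤ}
    {S : Fin n → ℤ} (h : GapCond r l A B S) (hA : -1 ≤ A) :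
    FrontPair l A B S ↔ ∀ u v, (r u : ℕ) = 0 → (r v : ℕ) = 1 →
      A < S u + S v ∧ (l u + l v < 0 → B < S u + S v) := by
  constructor
  · intro h1 u v hu hv
    exact h1 u v (by rintro rfl; omega)
  · intro h1
    have key : ∀ (d : ℕ) (u v : Fin n), (r u : ℕ) + r v = d → (r u : ℕ) < r v →
        A < S u + S v ∧ (l u + l v < 0 → B < S u + S v) := by
      intro d
      induction d using Nat.strong_induction_on with
      | _ d ih =>
        intro u v hd huv
        by_cases hv : (r v : ℕ) = 1
        · exact h1 u v (by omega) hv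
        obtain ⟨w, hwu, hw⟩ : ∃ w, (r w : ℕ) ≠ r u ∧ (r w : ℕ) < r v := by
          have hvn := (r v).2
          by_cases hu : (r u : ℕ) = 0
          · exact ⟨r.symm ⟨1, by omega⟩, by simp; omega, by simp; omega⟩
          · exact ⟨r.symm ⟨0, by omega⟩, by simp; omega, by simp; omega⟩
        have h2 : A < S u + S w ∧ (l u + l w < 0 → B < S u + S w) := by
          rcases lt_or_gt_of_ne hwu with h3 | h3
          · have := ih _ (by omega) w u rfl h3
            rwa [add_comm (S w), add_comm (l w)] at this
          · exact ih _ (by omega) u w rfl h3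
        have h4 := h w v hw
        refine ⟨by linarith [h2.1, h4.1], fun hl => ?_⟩
        by_cases hc : l v < l w
        · linarith [h4.2 hc, h2.1]
        · linarith [h2.2 (by omega), h4.1]
    intro u v huv
    have hne : (r u : ℕ) ≠ r v := fun h => huv (r.injective (Fin.ext h))
    rcases lt_or_gt_of_ne hne with h3 | h3
    · exact key _ u v rfl h3
    · have := key _ v u rfl h3
      rwa [add_comm (S v), add_comm (l v)] at this

theorem frontSingle_shift {r : Equiv.Perm (Fin n)} {l : Fin n → ℤ} {A' B' A B t c : ℤ}
    {S S' : Fin n → ℤ} (hS : ∀ u, S' u = S u + (t * (r u : ℕ) + c))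
    (h' : GapCond r l A' B' S') (h : GapCond r l (A' - t) (B' - t) S)
    (hA' : -1 ≤ A') (hA : -1 ≤ A' - t) (hB' : B ≤ B' + A + 1) (hB : B ≤ B' - t + A + 1) :
    FrontSingle l A B S' ↔ FrontSingle l (A - c) (B - c) S := by
  rw [frontSingle_iff_first h' hA' hB', frontSingle_iff_first h hA (by linarith)]
  refine forall₂_congr fun u hu => ?_
  rw [hS u, hu]
  refine and_congr ?_ (imp_congr Iff.rfl ?_) <;> constructor <;> intro h <;>
    simp only [Nat.cast_zero, mul_zero] at * <;> linarith

theorem frontPair_shift {r : Equiv.Perm (Fin n)} {l : Fin n → ℤ} {A B t : ℤ}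
    {S S' : Fin n → ℤ} (hS : ∀ u, S' u = S u + t * (r u : ℕ))
    (h' : GapCond r l A B S') (h : GapCond r l (A - t) (B - t) S)
    (hA' : -1 ≤ A) (hA : -1 ≤ A - t) :
    FrontPair l A B S' ↔ FrontPair l (A - t) (B - t) S := by
  rw [frontPair_iff_first h' hA', frontPair_iff_first h hA]
  refine forall₄_congr fun u v hu hv => ?_
  rw [hS u, hS v, hu, hv]
  refine and_congr ?_ (imp_congr Iff.rfl ?_) <;> constructor <;> intro h <;>
    simp only [Nat.cast_zero, Nat.cast_one, mul_zero, mul_one] at * <;> linarith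

/-- A negative sum of labels has a negative summand. This makes the front pair conditions redundant
in the presence of the roots `e i`. -/
theorem frontPair_of_frontSingle {l : Fin n → ℤ} {A B : ℤ} {S : Fin n → ℤ} (hA : 0 ≤ A)
    (h : FrontSingle l A B S) : FrontPair l A B S := by
  intro u v _
  have hu := h u
  have hv := h v
  refine ⟨by linarith [hu.1, hv.1], fun hl => ?_⟩
  by_cases hc : l u < 0
  · linarith [hu.2 hc, hv.1]
  · linarith [hu.1, hv.2 (by omega)]

/-- For the roots `2 e i` the single bounds are only half as large. Either the smaller value exceeds
`b`, and then so does the larger, or the pair is a descent and its gap exceeds `2 * b`. -/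
theorem frontPair_of_gapCond {r : Equiv.Perm (Fin n)} {l : Fin n → ℤ} {a b : ℤ} {S : Fin n → ℤ}
    (ha : 0 ≤ a) (hg : GapCond r l (2 * a) (2 * b) S) (h : FrontSingle l a b S) :
    FrontPair l (2 * a) (2 * b) S := by
  have key : ∀ u v, r u < r v → 2 * a < S u + S v ∧ (l u + l v < 0 → 2 * b < S u + S v) := by
    intro u v huv
    have hu := h u
    have hv := h v
    have hg := hg u v huv
    refine ⟨by linarith [hu.1, hv.1], fun hl => ?_⟩
    by_cases hc : l u < 0
    · linarith [hu.2 hc, hg.1]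
    · linarith [hg.2 (by omega), hu.1]
  intro u v huv
  rcases lt_or_gt_of_ne fun h => huv (r.injective h) with h3 | h3
  · exact key u v h3
  · have := key v u h3
    rwa [add_comm (S v), add_comm (l v)] at this

theorem low_iff_first {r : Equiv.Perm (Fin n)} {l : Fin n → ℤ} {A B : ℤ} {S : Fin n → ℤ}
    (h : GapCond r l A B S) (hA : 0 ≤ A) (ε : Fin n → Bool) :
    (∀ u, 0 ≤ S u ∧ (ε u = false → 1 ≤ S u)) ↔
      ∀ u, (r u : ℕ) = 0 → 0 ≤ S u ∧ (ε u = false → 1 ≤ S u) := by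
  constructor
  · exact fun h1 u _ => h1 u
  · intro h1 u
    by_cases hu : (r u : ℕ) = 0
    · exact h1 u hu
    · obtain ⟨f, hf⟩ : ∃ f, (r f : ℕ) = 0 := ⟨r.symm ⟨0, Fin.pos u⟩, by simp⟩
      have h2 := (h1 f hf).1
      have h3 := (h f u (by rw [Fin.lt_def]; omega)).1
      exact ⟨by linarith, fun _ => by linarith⟩

end Gaps

/-! ### Shifting by rank: the translation identity for each sign vector and ranking. -/

section Shift

variable {n : ℕ}

/-- The order of the signed labels: `1 < ⋯ < n < 0 < -n < ⋯ < -1`. -/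
def signedLabel (ε : Fin n → Bool) (i : Fin n) : ℤ := if ε i then (i : ℤ) - n else n - i

/-- Absolute values of doubled coordinates avoiding the hyperplanes of type `D`. -/
def CondD (r : Equiv.Perm (Fin n)) (ε : Fin n → Bool) (a b q : ℤ) (S : Fin n → ℤ) : Prop :=
  (∀ u, Even (S u)) ∧ (∀ u, 0 ≤ S u ∧ (ε u = false → 1 ≤ S u)) ∧
    GapCond r (signedLabel ε) (2 * a) (2 * b) S ∧
    FrontPair (signedLabel ε) (2 * a) (2 * b) S ∧
    FrontSingle (fun u => -signedLabel ε u) 0 0 (fun u => q - S u) ∧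
    FrontPair (fun u => -signedLabel ε u) (2 * a) (2 * b) (fun u => q - S u)

/-- Absolute values of doubled coordinates avoiding the hyperplanes of type `B`. -/
def CondB (r : Equiv.Perm (Fin n)) (ε : Fin n → Bool) (a b q : ℤ) (S : Fin n → ℤ) : Prop :=
  (∀ u, Even (S u)) ∧ GapCond r (signedLabel ε) (2 * a) (2 * b) S ∧
    FrontSingle (signedLabel ε) (2 * a) (2 * b) S ∧
    FrontSingle (fun u => -signedLabel ε u) 0 0 (fun u => q - S u) ∧
    FrontPair (fun u => -signedLabel ε u) (2 * a) (2 * b) (fun u => q - S u)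

/-- Absolute values of doubled coordinates of parity `π` avoiding the hyperplanes of type `C`. -/
def CondC (π : ℤ) (r : Equiv.Perm (Fin n)) (ε : Fin n → Bool) (a b q : ℤ) (S : Fin n → ℤ) :
    Prop :=
  (∀ u, Even (S u - π)) ∧ GapCond r (signedLabel ε) (2 * a) (2 * b) S ∧
    FrontSingle (signedLabel ε) a b S ∧
    FrontSingle (fun u => -signedLabel ε u) a b (fun u => q - S u)

/-- Coordinates on a circle, cut at the position of the first one, avoiding the hyperplanes of
type `A`. -/
def CondA (r : Equiv.Perm (Fin n)) (a b q : ℤ) (S : Fin n → ℤ) : Prop :=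
  GapCond r (fun u => (u : ℤ) + 1) a b S ∧ FrontSingle (fun u => (u : ℤ) + 1) a b S ∧
    FrontSingle (fun u => -((u : ℤ) + 1)) a b (fun u => q - S u)

theorem card_shift {C C' : (Fin n → ℤ) → Prop} (c : Fin n → ℤ)
    (h : ∀ S, C (fun u => S u + c u) ↔ C' S) : Nat.card {S // C S} = Nat.card {S // C' S} :=
  (Nat.card_congr ((Equiv.addRight c).subtypeEquiv fun S => (h S).symm)).symm

theorem rev_cast (r : Equiv.Perm (Fin n)) (u : Fin n) :
    (((r.trans Fin.revPerm) u : ℕ) : ℤ) = n - 1 - (r u : ℕ) := by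
  have := (r u).2
  simp only [Equiv.trans_apply, Fin.revPerm_apply, Fin.val_rev]
  omega

/-- Length `2 * a` is inserted in each of the `n - 1` gaps and nothing at the ends: there the sum of
the two extreme values already gains `2 * a`. -/
theorem card_condD_shift (r : Equiv.Perm (Fin n)) (ε : Fin n → Bool) {a b : ℤ} (ha : 0 ≤ a)
    (hab : a ≤ b) (q : ℤ) : Nat.card {S // CondD r ε a b q S} =
      Nat.card {S // CondD r ε 0 (b - a) (q - a * (2 * n - 2)) S} := by
  refine card_shift (fun u => 2 * a * (r u : ℕ) + 0) fun S => ?_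
  unfold CondD
  have hg := gapCond_shift r (signedLabel ε) (A := 2 * a) (B := 2 * b) (t := 2 * a) 0
    (by linarith) (by linarith) S
  rw [show 2 * (b - a) = 2 * b - 2 * a by ring, show (2 * 0 : ℤ) = 2 * a - 2 * a by ring, ← hg]
  have hback : ∀ u, q - (S u + (2 * a * (r u : ℕ) + 0)) = (q - a * (2 * n - 2) - S u) +
      (2 * a * (((r.trans Fin.revPerm) u : ℕ) : ℤ) + 0) := by
    intro u; rw [rev_cast]; ring
  refine and_congr (forall_congr' fun u => ?_) ?_
  · rw [Int.even_add]
    exact iff_true_right (by rw [add_zero, mul_assoc]; exact even_two_mul _)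
  -- The end conditions correspond only in the presence of the gap condition, which lets them be
  -- tested at extreme ranks.
  suffices H : GapCond r (signedLabel ε) (2 * a) (2 * b) (fun u => S u + (2 * a * (r u : ℕ) + 0)) →
      (((∀ u, 0 ≤ S u + (2 * a * (r u : ℕ) + 0) ∧
        (ε u = false → 1 ≤ S u + (2 * a * (r u : ℕ) + 0))) ↔
          ∀ u, 0 ≤ S u ∧ (ε u = false → 1 ≤ S u)) ∧ (_ ↔ _) ∧ (_ ↔ _) ∧ (_ ↔ _)) by
    constructor
    · rintro ⟨h1, h2, h3, h4, h5⟩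
      have H := H h2
      exact ⟨H.1.1 h1, h2, H.2.1.1 h3, H.2.2.1.1 h4, H.2.2.2.1 h5⟩
    · rintro ⟨h1, h2, h3, h4, h5⟩
      have H := H h2
      exact ⟨H.1.2 h1, h2, H.2.1.2 h3, H.2.2.1.2 h4, H.2.2.2.2 h5⟩
  intro h'
  have h := hg.1 h'
  refine ⟨?_, ?_, ?_, ?_⟩
  · rw [low_iff_first h' (by linarith) ε, low_iff_first h (by linarith) ε]
    refine forall₂_congr fun u hu => ?_
    simp [hu]
  · exact frontPair_shift (fun u => by ring) h' h (by linarith) (by linarith)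
  · have := frontSingle_shift (A := 0) (B := 0) (t := 2 * a) (c := 0) hback (h'.mirror q)
      (h.mirror _) (by linarith) (by linarith) (by linarith) (by linarith)
    simpa only [sub_zero] using this
  · exact frontPair_shift (fun u => by rw [hback u]; ring) (h'.mirror q) (h.mirror _)
      (by linarith) (by linarith)

/-- Compared with type D, the roots `e i` require a further `2 * a` in front of the first value. -/
theorem card_condB_shift (r : Equiv.Perm (Fin n)) (ε : Fin n → Bool) {a b : ℤ} (ha : 0 ≤ a)
    (hab : a ≤ b) (q : ℤ) : Nat.card {S // CondB r ε a b q S} =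
      Nat.card {S // CondB r ε 0 (b - a) (q - a * (2 * n)) S} := by
  refine card_shift (fun u => 2 * a * (r u : ℕ) + 2 * a) fun S => ?_
  unfold CondB
  have hg := gapCond_shift r (signedLabel ε) (A := 2 * a) (B := 2 * b) (t := 2 * a) (2 * a)
    (by linarith) (by linarith) S
  rw [show 2 * (b - a) = 2 * b - 2 * a by ring, show (2 * 0 : ℤ) = 2 * a - 2 * a by ring, ← hg]
  have hback : ∀ u, q - (S u + (2 * a * (r u : ℕ) + 2 * a)) = (q - a * (2 * n) - S u) +
      (2 * a * (((r.trans Fin.revPerm) u : ℕ) : ℤ) + 0) := by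
    intro u; rw [rev_cast]; ring
  refine and_congr (forall_congr' fun u => ?_) ?_
  · rw [Int.even_add]
    exact iff_true_right (by rw [mul_assoc, ← mul_add]; exact even_two_mul _)
  refine and_congr_right fun h' => ?_
  have h := hg.1 h'
  refine and_congr ?_ (and_congr ?_ ?_)
  · exact frontSingle_shift (fun u => rfl) h' h (by linarith) (by linarith) (by linarith)
      (by linarith)
  · have := frontSingle_shift (A := 0) (B := 0) (t := 2 * a) (c := 0) hback (h'.mirror q)
      (h.mirror _) (by linarith) (by linarith) (by linarith) (by linarith)
    simpa only [sub_zero] using this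
  · exact frontPair_shift (fun u => by rw [hback u]; ring) (h'.mirror q) (h.mirror _)
      (by linarith) (by linarith)

/-- The roots `2 e i` require `a` at either end, besides `2 * a` in each gap. Shifting by `a` at the
front is what moves the parity from `π` to `π + a`. -/
theorem card_condC_shift (π : ℤ) (r : Equiv.Perm (Fin n)) (ε : Fin n → Bool) {a b : ℤ}
    (ha : 0 ≤ a) (hab : a ≤ b) (q : ℤ) : Nat.card {S // CondC π r ε a b q S} =
      Nat.card {S // CondC (π + a) r ε 0 (b - a) (q - a * (2 * n)) S} := by
  refine card_shift (fun u => 2 * a * (r u : ℕ) + a) fun S => ?_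
  unfold CondC
  have hg := gapCond_shift r (signedLabel ε) (A := 2 * a) (B := 2 * b) (t := 2 * a) a
    (by linarith) (by linarith) S
  rw [show 2 * (b - a) = 2 * b - 2 * a by ring, show (2 * 0 : ℤ) = 2 * a - 2 * a by ring, ← hg,
    show (0 : ℤ) = a - a by ring]
  have hback : ∀ u, q - (S u + (2 * a * (r u : ℕ) + a)) = (q - a * (2 * n) - S u) +
      (2 * a * (((r.trans Fin.revPerm) u : ℕ) : ℤ) + a) := by
    intro u; rw [rev_cast]; ring
  refine and_congr (forall_congr' fun u => ?_) ?_
  · rw [show S u + (2 * a * (r u : ℕ) + a) - π = (S u - (π + a)) + 2 * (a * (r u : ℕ) + a) by ring,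
      Int.even_add]
    exact iff_true_right (even_two_mul _)
  refine and_congr_right fun h' => ?_
  have h := hg.1 h'
  refine and_congr ?_ ?_
  · exact frontSingle_shift (fun u => rfl) h' h (by linarith) (by linarith) (by linarith)
      (by linarith)
  · exact frontSingle_shift hback (h'.mirror q) (h.mirror _) (by linarith) (by linarith)
      (by linarith) (by linarith)

/-- The `n` points and the cut divide the circle into `n + 1` arcs, each of which loses `a`. -/
theorem card_condA_shift (r : Equiv.Perm (Fin n)) {a b : ℤ} (ha : 0 ≤ a) (q : ℤ) : Nat.card {S // CondA r a b q S} =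
      Nat.card {S // CondA r 0 (b - a) (q - a * (n + 1)) S} := by
  refine card_shift (fun u => a * (r u : ℕ) + a) fun S => ?_
  unfold CondA
  have hg := gapCond_shift r (fun u => (u : ℤ) + 1) (A := a) (B := b) (t := a) a
    (by linarith) (by linarith) S
  rw [show (0 : ℤ) = a - a by ring, ← hg]
  have hback : ∀ u, q - (S u + (a * (r u : ℕ) + a)) = (q - a * (n + 1) - S u) +
      (a * (((r.trans Fin.revPerm) u : ℕ) : ℤ) + a) := by
    intro u; rw [rev_cast]; ring
  refine and_congr_right fun h' => ?_
  have h := hg.1 h'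
  refine and_congr ?_ ?_
  · exact frontSingle_shift (fun u => rfl) h' h (by linarith) (by linarith) (by linarith)
      (by linarith)
  · exact frontSingle_shift hback (h'.mirror q) (h.mirror _) (by linarith) (by linarith)
      (by linarith) (by linarith)

end Shift

/-! ### Sorting points by signs and by the order of absolute values. -/

section Partition

variable {n : ℕ}

theorem card_eq_sum_of_existsUnique {X ι : Type*} [Fintype ι] (F : X → Prop) (G : ι → X → Prop)
    [Finite {x // F x}] (h : ∀ x, F x → ∃! i, G i x) :
    Nat.card {x // F x} = ∑ i, Nat.card {x // F x ∧ G i x} := by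
  have : ∀ i, Finite {x // F x ∧ G i x} := fun i =>
    Finite.of_injective (fun x => (⟨x.1, x.2.1⟩ : {x // F x})) fun x y hxy => by
      simpa [Subtype.ext_iff] using hxy
  rw [← Nat.card_sigma]
  refine (Nat.card_congr (Equiv.ofBijective
    (fun y : Σ i, {x // F x ∧ G i x} => (⟨y.2.1, y.2.2.1⟩ : {x // F x})) ⟨?_, ?_⟩)).symm
  · rintro ⟨i, x, hF, hG⟩ ⟨j, y, hF', hG'⟩ hxy
    obtain rfl : x = y := by simpa using hxy
    obtain rfl : i = j := (h x hF).unique hG hG'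
    rfl
  · rintro ⟨x, hx⟩
    obtain ⟨i, hi, -⟩ := h x hx
    exact ⟨⟨i, x, hx, hi⟩, rfl⟩

theorem existsUnique_perm_of_injective (K : Fin n → ℤ) (hK : Function.Injective K) :
    ∃! r : Equiv.Perm (Fin n), ∀ u v, r u < r v → K u < K v := by
  refine ⟨(Tuple.sort K).symm, fun u v huv => ?_, fun r hr => ?_⟩
  · have h1 := Tuple.monotone_sort K huv.le
    simp only [Function.comp_apply, Equiv.apply_symm_apply] at h1
    refine h1.lt_of_ne fun h2 => ?_
    rw [hK h2] at huv
    exact lt_irrefl _ huv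
  · have hs : ∀ u v, (Tuple.sort K).symm u < (Tuple.sort K).symm v → K u < K v := by
      intro u v huv
      have h1 := Tuple.monotone_sort K huv.le
      simp only [Function.comp_apply, Equiv.apply_symm_apply] at h1
      refine h1.lt_of_ne fun h2 => ?_
      rw [hK h2] at huv
      exact lt_irrefl _ huv
    have hiff : ∀ r : Equiv.Perm (Fin n), (∀ u v, r u < r v → K u < K v) →
        ∀ u v, r u < r v ↔ K u < K v := by
      refine fun r hr u v => ⟨hr u v, fun h => ?_⟩
      rcases lt_trichotomy (r u) (r v) with h1 | h1 | h1
      · exact h1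
      · rw [r.injective h1] at h; exact absurd h (lt_irrefl _)
      · exact absurd (hr v u h1) h.asymm
    -- Two rankings of the same values differ by an order automorphism of `Fin n`, which is the
    -- identity.
    let o : Fin n ≃o Fin n := ⟨(Tuple.sort K).trans r, by
      intro x y
      rw [← not_lt, ← not_lt, not_iff_not]
      simp only [Equiv.trans_apply]
      rw [hiff r hr, ← hiff _ hs]
      simp⟩
    have ho : o = OrderIso.refl _ := Subsingleton.elim _ _
    ext u
    have := congrArg (fun f : Fin n ≃o Fin n => f ((Tuple.sort K).symm u)) ho
    simp only [o, OrderIso.refl_apply, RelIso.coe_fn_mk, Equiv.trans_apply,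
      Equiv.apply_symm_apply] at this
    rw [this]

/-- The vector with absolute values `S` and signs `ε`. -/
def signed (ε : Fin n → Bool) (S : Fin n → ℤ) : Fin n → ℤ := fun i => if ε i then S i else -S i

/-- `S` lists absolute values of a vector with signs `ε`, where `0` counts as positive. -/
def Low (ε : Fin n → Bool) (S : Fin n → ℤ) : Prop := ∀ u, 0 ≤ S u ∧ (ε u = false → 1 ≤ S u)

theorem card_eq_sum_signs (F : (Fin n → ℤ) → Prop) [Finite {Y // F Y}] :
    Nat.card {Y // F Y} = ∑ ε : Fin n → Bool, Nat.card {S // Low ε S ∧ F (signed ε S)} := by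
  rw [card_eq_sum_of_existsUnique F fun (ε : Fin n → Bool) Y => ∀ i, ε i = true ↔ 0 ≤ Y i]
  · refine Finset.sum_congr rfl fun ε _ => Nat.card_congr ?_
    have hinv : ∀ S, signed ε (signed ε S) = S := by
      intro S
      funext i
      simp only [signed]
      split_ifs <;> simp
    let f : (Fin n → ℤ) ≃ (Fin n → ℤ) := ⟨signed ε, signed ε, hinv, hinv⟩
    refine f.subtypeEquiv fun Y => ?_
    simp only [f, Equiv.coe_fn_mk, hinv]
    rw [and_comm]
    refine and_congr_left fun _ => forall_congr' fun i => ?_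
    simp only [signed]
    cases ε i
    · simp; omega
    · simp
  · intro Y _
    refine ⟨fun i => decide (0 ≤ Y i), by simp, fun ε hε => ?_⟩
    funext i
    rw [Bool.eq_iff_iff]
    simp [hε i]

theorem card_eq_sum_signs_perms (F : (Fin n → ℤ) → Prop) [Finite {Y // F Y}]
    (hF : ∀ ε S, Low ε S → F (signed ε S) → Function.Injective S) :
    Nat.card {Y // F Y} = ∑ ε : Fin n → Bool, ∑ r : Equiv.Perm (Fin n),
      Nat.card {S // (Low ε S ∧ F (signed ε S)) ∧ ∀ u v, r u < r v → S u < S v} := by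
  rw [card_eq_sum_signs]
  refine Finset.sum_congr rfl fun ε _ => ?_
  have : Finite {S // Low ε S ∧ F (signed ε S)} := by
    refine Finite.of_injective (fun S => (⟨signed ε S.1, S.2.2⟩ : {Y // F Y})) fun S T h => ?_
    have h1 := congrArg Subtype.val h
    apply Subtype.ext
    funext i
    have h2 := congrFun h1 i
    simp only [signed] at h2
    split_ifs at h2
    · exact h2
    · exact neg_injective h2
  exact card_eq_sum_of_existsUnique (fun S => Low ε S ∧ F (signed ε S)) _ fun S hS =>
    existsUnique_perm_of_injective S (hF ε S hS.1 hS.2)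

/-- The interval `(-q, q]` contains two representatives of each residue, differing by the odd number
`q`; exactly one has the parity of `π`. Doubling is invertible modulo `q`. -/
theorem half_bijective {q : ℕ} (hq : Odd q) (π : ℤ) :
    Function.Bijective fun y : {y : ℤ // (-(q : ℤ) < y ∧ y ≤ q) ∧ Even (y - π)} =>
      ((2 : ZMod q)⁻¹ * (y.1 : ZMod q)) := by
  have : NeZero q := ⟨hq.pos.ne'⟩
  have hu : IsUnit (2 : ZMod q) := by
    have := (ZMod.isUnit_iff_coprime 2 q).2 (Nat.coprime_two_left.2 hq)
    exact_mod_cast this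
  have h2 : (2 : ZMod q) * 2⁻¹ = 1 := ZMod.mul_inv_of_unit _ hu
  constructor
  · rintro ⟨y, ⟨hy1, hy2⟩, hy⟩ ⟨y', ⟨hy1', hy2'⟩, hy'⟩ h
    have h3 : ((y - y' : ℤ) : ZMod q) = 0 := by
      push_cast
      have h4 := congrArg (fun t => 2 * t) h
      simp only [← mul_assoc, h2, one_mul] at h4
      rw [h4, sub_self]
    rw [ZMod.intCast_zmod_eq_zero_iff_dvd] at h3
    obtain ⟨c, hc⟩ := h3
    apply Subtype.ext
    simp only
    have h4 : Even ((q : ℤ) * c) := by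
      rw [← hc, show y - y' = (y - π) - (y' - π) by ring]
      exact hy.sub hy'
    have h5 : Even c := by
      rcases Int.even_mul.1 h4 with h | h
      · exact absurd ((Int.even_coe_nat q).1 h) (Nat.not_even_iff_odd.2 hq)
      · exact h
    obtain ⟨d, rfl⟩ := h5
    have hq0 : (0 : ℤ) < q := by exact_mod_cast hq.pos
    have h6 : d = 0 := by
      by_contra hd
      rcases lt_or_gt_of_ne hd with h | h
      · nlinarith
      · nlinarith
    subst h6
    linarith [hc]
  · intro z
    have hq0 : (0 : ℤ) < q := by exact_mod_cast hq.pos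
    have hw1 : (((2 * z).val : ℤ) : ZMod q) = 2 * z := by simp
    have hw2 : ((2 * z).val : ℤ) < q := by exact_mod_cast ZMod.val_lt _
    have hw0 : (0 : ℤ) ≤ (2 * z).val := by positivity
    generalize ((2 * z).val : ℤ) = w at hw1 hw2 hw0
    have hfin : ∀ y : ℤ, (y : ZMod q) = 2 * z → (2 : ZMod q)⁻¹ * (y : ZMod q) = z := by
      intro y hy
      rw [hy, ← mul_assoc, mul_comm _ (2 : ZMod q), h2, one_mul]
    by_cases he : Even (w - π)
    · exact ⟨⟨w, ⟨by linarith, hw2.le⟩, he⟩, hfin w hw1⟩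
    · have hqo : Odd (q : ℤ) := by exact_mod_cast hq
      -- The alternative representative is `w - q`, except for `w = 0`, where `-q` is excluded from
      -- the interval and `q` takes its place.
      by_cases h0 : w = 0
      · refine ⟨⟨w + q, ⟨by linarith, by linarith⟩, ?_⟩, hfin _ (by push_cast; rw [hw1]; simp)⟩
        rw [show w + q - π = (w - π) + q by ring]
        exact (Int.not_even_iff_odd.1 he).add_odd hqo
      · refine ⟨⟨w - q, ⟨by omega, by linarith⟩, ?_⟩, hfin _ (by push_cast; rw [hw1]; simp)⟩
        rw [show w - q - π = (w - π) - q by ring]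
        exact (Int.not_even_iff_odd.1 he).sub_odd hqo

/-- The doubled representatives of coordinates modulo `q`. -/
def Box (π : ℤ) (q : ℕ) (Y : Fin n → ℤ) : Prop :=
  ∀ i, (-(q : ℤ) < Y i ∧ Y i ≤ q) ∧ Even (Y i - π)

/-- The coordinates modulo `q` with doubled representatives `Y`. -/
def halve (q : ℕ) (Y : Fin n → ℤ) : Fin n → ZMod q := fun i => (2 : ZMod q)⁻¹ * (Y i : ZMod q)

theorem halve_bijective {q : ℕ} (hq : Odd q) (π : ℤ) (F : (Fin n → ZMod q) → Prop) :
    Function.Bijective fun Y : {Y : Fin n → ℤ // Box π q Y ∧ F (halve q Y)} =>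
      (⟨halve q Y.1, Y.2.2⟩ : {x // F x}) := by
  have hb := half_bijective hq π
  constructor
  · rintro ⟨Y, hY, _⟩ ⟨Y', hY', _⟩ h
    have h1 : halve q Y = halve q Y' := congrArg Subtype.val h
    apply Subtype.ext
    funext i
    have := @hb.1 ⟨Y i, hY i⟩ ⟨Y' i, hY' i⟩ (congrFun h1 i)
    exact congrArg Subtype.val this
  · rintro ⟨x, hx⟩
    choose y hy using fun i => hb.2 (x i)
    have h1 : halve q (fun i => (y i).1) = x := funext hy
    refine ⟨⟨fun i => (y i).1, fun i => (y i).2, by rw [h1]; exact hx⟩, ?_⟩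
    apply Subtype.ext
    exact h1

theorem card_zmod_eq_sum {q : ℕ} (hq : Odd q) (π : ℤ) (F : (Fin n → ZMod q) → Prop)
    (hF : ∀ ε S, Low ε S → Box π q (signed ε S) → F (halve q (signed ε S)) →
      Function.Injective S) :
    Nat.card {x // F x} = ∑ ε : Fin n → Bool, ∑ r : Equiv.Perm (Fin n),
      Nat.card {S // (Low ε S ∧ Box π q (signed ε S) ∧ F (halve q (signed ε S))) ∧
        ∀ u v, r u < r v → S u < S v} := by
  have : NeZero q := ⟨hq.pos.ne'⟩
  have hb := halve_bijective hq π F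
  have : Finite {Y : Fin n → ℤ // Box π q Y ∧ F (halve q Y)} := Finite.of_injective _ hb.1
  rw [← Nat.card_congr (Equiv.ofBijective _ hb)]
  exact card_eq_sum_signs_perms (fun Y => Box π q Y ∧ F (halve q Y)) fun ε S h1 h2 =>
    hF ε S h1 h2.1 h2.2

end Partition

/-! ### From congruences to forbidden intervals. -/

section Residues

variable {n : ℕ}

/-- Since `q` is odd and `Z - 2 * k` even, the quotient is even. The size bounds leave only `Z = 2 *
k` and `Z = 2 * k ± 2 * q`, one interval for each. -/
theorem forall_not_dvd_sub_two_mul_iff {Z a b q : ℤ} (hZ : Even Z) (hZq : -(2 * q) < Z)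
    (hZq' : Z < 2 * q) (ha : 0 ≤ a) (hab : a ≤ b) (hb : b < q) (hq : Odd q) :
    (∀ k, -a ≤ k → k ≤ b → ¬ q ∣ Z - 2 * k) ↔
      (Z < -(2 * a) ∨ 2 * b < Z) ∧ 2 * b - 2 * q < Z ∧ Z < 2 * q - 2 * a := by
  obtain ⟨z, rfl⟩ := hZ
  constructor
  · intro h
    refine ⟨?_, ?_, ?_⟩
    · by_contra hcon
      exact h z (by omega) (by omega) ⟨0, by ring⟩
    · by_contra hcon
      exact h (z + q) (by omega) (by omega) ⟨-2, by ring⟩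
    · by_contra hcon
      exact h (z - q) (by omega) (by omega) ⟨2, by ring⟩
  · rintro ⟨h1, h2, h3⟩ k hk hk' ⟨c, hc⟩
    have hce : Even c := by
      have : Even (q * c) := by rw [← hc]; exact ⟨z - k, by ring⟩
      rcases Int.even_mul.1 this with h | h
      · exact absurd hq (Int.not_odd_iff_even.2 h)
      · exact h
    obtain ⟨d, rfl⟩ := hce
    have hd : d = -1 ∨ d = 0 ∨ d = 1 := by
      have h4 : d < 2 := by by_contra; nlinarith
      have h5 : -2 < d := by by_contra; nlinarith
      omega
    rcases hd with rfl | rfl | rfl <;> omega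

theorem forall_not_dvd_sub_iff {Y a b q : ℤ} (hY : -q < Y) (hY' : Y ≤ q) (ha : 0 ≤ a)
    (hab : a ≤ b) (hb : b < q) :
    (∀ k, -a ≤ k → k ≤ b → ¬ q ∣ Y - k) ↔ (Y < -a ∨ b < Y) ∧ b - q < Y ∧ Y < q - a := by
  constructor
  · intro h
    refine ⟨?_, ?_, ?_⟩
    · by_contra hcon
      exact h Y (by omega) (by omega) ⟨0, by ring⟩
    · by_contra hcon
      exact h (Y + q) (by omega) (by omega) ⟨-1, by ring⟩
    · by_contra hcon
      exact h (Y - q) (by omega) (by omega) ⟨1, by ring⟩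
  · rintro ⟨h1, h2, h3⟩ k hk hk' ⟨d, hd⟩
    have hd : d = -1 ∨ d = 0 ∨ d = 1 := by
      have h4 : d < 2 := by by_contra; nlinarith
      have h5 : -2 < d := by by_contra; nlinarith
      omega
    rcases hd with rfl | rfl | rfl <;> omega

theorem forall_not_dvd_sub_two_mul_iff_of_lt {Y a b q : ℤ} (hYe : Even Y) (hY : -q < Y)
    (hY' : Y < q) (ha : 0 ≤ a) (hab : a ≤ b) (hb : 2 * b < q) (hq : Odd q) :
    (∀ k, -a ≤ k → k ≤ b → ¬ q ∣ Y - 2 * k) ↔ (Y < -(2 * a) ∨ 2 * b < Y) := by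
  rw [forall_not_dvd_sub_two_mul_iff hYe (by linarith) (by linarith) ha hab (by linarith) hq]
  omega

theorem isUnit_two_zmod {q : ℕ} (hq : Odd q) : IsUnit (2 : ZMod q) := by
  have := (ZMod.isUnit_iff_coprime 2 q).2 (Nat.coprime_two_left.2 hq)
  exact_mod_cast this

theorem inv_two_mul_eq_iff {q : ℕ} (hq : Odd q) (Z k : ℤ) :
    (2 : ZMod q)⁻¹ * (Z : ZMod q) = k ↔ (q : ℤ) ∣ Z - 2 * k := by
  have h2 : (2 : ZMod q) * 2⁻¹ = 1 := ZMod.mul_inv_of_unit _ (isUnit_two_zmod hq)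
  rw [← ZMod.intCast_zmod_eq_zero_iff_dvd]
  push_cast
  rw [sub_eq_zero]
  constructor
  · intro h
    rw [← h, ← mul_assoc, h2, one_mul]
  · intro h
    rw [h, ← mul_assoc, mul_comm _ (2 : ZMod q), h2, one_mul]

theorem avoidsPairs_halve_iff {q : ℕ} (hq : Odd q) (a b : ℤ) (Y : Fin n → ℤ) :
    AvoidsPairs a b (halve q Y) ↔ ∀ i j, i < j →
      (∀ k, a ≤ k → k ≤ b → ¬ (q : ℤ) ∣ (Y i - Y j) - 2 * k) ∧
      (∀ k, a ≤ k → k ≤ b → ¬ (q : ℤ) ∣ (Y i + Y j) - 2 * k) := by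
  unfold AvoidsPairs
  refine forall₃_congr fun i j _ => ?_
  simp only [← forall_and, halve]
  refine forall₃_congr fun k _ _ => ?_
  rw [← inv_two_mul_eq_iff hq, ← inv_two_mul_eq_iff hq]
  push_cast
  rw [mul_sub, mul_add]

theorem avoidsMultiples_one_halve_iff {q : ℕ} (hq : Odd q) (a b : ℤ) (Y : Fin n → ℤ) :
    AvoidsMultiples 1 a b (halve q Y) ↔ ∀ i, ∀ k, a ≤ k → k ≤ b → ¬ (q : ℤ) ∣ Y i - 2 * k := by
  unfold AvoidsMultiples
  refine forall₄_congr fun i k _ _ => ?_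
  rw [← inv_two_mul_eq_iff hq]
  simp [halve]

theorem avoidsMultiples_two_halve_iff {q : ℕ} (hq : Odd q) (a b : ℤ) (Y : Fin n → ℤ) :
    AvoidsMultiples 2 a b (halve q Y) ↔ ∀ i, ∀ k, a ≤ k → k ≤ b → ¬ (q : ℤ) ∣ Y i - k := by
  unfold AvoidsMultiples
  refine forall₄_congr fun i k _ _ => ?_
  have h2 : (2 : ZMod q) * 2⁻¹ = 1 := ZMod.mul_inv_of_unit _ (isUnit_two_zmod hq)
  rw [← ZMod.intCast_zmod_eq_zero_iff_dvd]
  simp only [halve]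
  push_cast
  rw [← mul_assoc, h2, one_mul, sub_eq_zero]

end Residues

/-! ### Avoidance in types B, C, D and BC as gap and end conditions. -/

section Conditions

variable {n : ℕ}

/-- Labels have absolute value `n - i`, so the smaller index dominates both the sum and the
difference. -/
theorem signedLabel_of_true {ε : Fin n → Bool} {i j : Fin n} (hij : i < j) (h : ε i = true) :
    signedLabel ε i < signedLabel ε j ∧ signedLabel ε i + signedLabel ε j < 0 := by
  have := j.2
  rw [Fin.lt_def] at hij
  simp only [signedLabel, h, if_true]
  split_ifs <;> omega

theorem signedLabel_of_false {ε : Fin n → Bool} {i j : Fin n} (hij : i < j) (h : ε i = false) :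
    signedLabel ε j < signedLabel ε i ∧ 0 < signedLabel ε i + signedLabel ε j := by
  have := j.2
  rw [Fin.lt_def] at hij
  simp only [signedLabel, h, Bool.false_eq_true, if_false]
  split_ifs <;> omega

theorem signedLabel_neg_iff (ε : Fin n → Bool) (i : Fin n) :
    signedLabel ε i < 0 ↔ ε i = true := by
  have := i.2
  cases h : ε i <;> simp [signedLabel, h]

theorem signedLabel_pos_iff (ε : Fin n → Bool) (i : Fin n) :
    0 < signedLabel ε i ↔ ε i = false := by
  have := i.2
  cases h : ε i <;> simp [signedLabel, h]

/-- The condition on the pair `u, v` for avoiding the hyperplanes of the roots `e u ± e v`. -/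
def PairCond (l : Fin n → ℤ) (a b q : ℤ) (S : Fin n → ℤ) (u v : Fin n) : Prop :=
  S u ≠ S v ∧ (S u < S v → 2 * a < S v - S u ∧ (l v < l u → 2 * b < S v - S u)) ∧
    (S v < S u → 2 * a < S u - S v ∧ (l u < l v → 2 * b < S u - S v)) ∧
    (2 * a < S u + S v ∧ (l u + l v < 0 → 2 * b < S u + S v)) ∧
    (2 * a < (q - S u) + (q - S v) ∧ (-l u + -l v < 0 → 2 * b < (q - S u) + (q - S v)))

theorem PairCond.symm {l : Fin n → ℤ} {a b q : ℤ} {S : Fin n → ℤ} {u v : Fin n}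
    (h : PairCond l a b q S u v) : PairCond l a b q S v u := by
  obtain ⟨h1, h2, h3, h4, h5⟩ := h
  refine ⟨h1.symm, h3, h2, ?_, ?_⟩
  · rwa [add_comm (S v), add_comm (l v)]
  · rwa [add_comm (q - S v), add_comm (-l v)]

theorem pairCond_order_iff (r : Equiv.Perm (Fin n)) (l : Fin n → ℤ) {a b : ℤ} (ha : 0 ≤ a) (q : ℤ)
    (S : Fin n → ℤ) :
    ((∀ i j, i < j → PairCond l a b q S i j) ∧ ∀ u v, r u < r v → S u < S v) ↔
      GapCond r l (2 * a) (2 * b) S ∧ FrontPair l (2 * a) (2 * b) S ∧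
        FrontPair (fun u => -l u) (2 * a) (2 * b) (fun u => q - S u) := by
  constructor
  · rintro ⟨h1, h2⟩
    have h : ∀ u v, u ≠ v → PairCond l a b q S u v := by
      intro u v huv
      rcases lt_or_gt_of_ne huv with h | h
      · exact h1 u v h
      · exact (h1 v u h).symm
    refine ⟨fun u v huv => ?_, fun u v huv => (h u v huv).2.2.2.1,
      fun u v huv => (h u v huv).2.2.2.2⟩
    exact (h u v (by rintro rfl; exact lt_irrefl _ huv)).2.1 (h2 u v huv)
  · rintro ⟨h1, h2, h3⟩
    have hlt : ∀ u v, r u < r v → S u < S v := fun u v huv => by linarith [(h1 u v huv).1]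
    refine ⟨fun i j hij => ?_, hlt⟩
    rcases lt_or_gt_of_ne fun h => hij.ne (r.injective h) with h | h
    · have := hlt i j h
      exact ⟨this.ne, fun _ => h1 i j h, fun h' => absurd h' this.asymm, h2 i j hij.ne,
        h3 i j hij.ne⟩
    · have := hlt j i h
      exact ⟨this.ne', fun h' => absurd h' this.asymm, fun _ => h1 j i h, h2 i j hij.ne,
        h3 i j hij.ne⟩

/-- Whatever the sign of coordinate `j`, the two root values are `S i ± S j` up to order if `ε i` is
positive, and their negatives otherwise. A positive value must exceed `2 * b`, a negative one only
`2 * a` in size; the labels encode which bound applies, also after wrapping around by `2 * q`. -/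
theorem avoidsPairs_signed_iff {q : ℕ} (hq : Odd q) {a b : ℤ} (ha : 0 ≤ a) (hab : a ≤ b)
    (hb : 2 * b < q) {π : ℤ} {ε : Fin n → Bool} {S : Fin n → ℤ} (hlow : ∀ u, 0 ≤ S u)
    (hhigh : ∀ u, S u < q) (hpar : ∀ u, Even (S u - π)) :
    AvoidsPairs (-a) b (halve q (signed ε S)) ↔
      ∀ i j, i < j → PairCond (signedLabel ε) a b q S i j := by
  rw [avoidsPairs_halve_iff hq]
  refine forall₃_congr fun i j hij => ?_
  have hqo : Odd (q : ℤ) := by exact_mod_cast hq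
  have hi := hlow i
  have hj := hlow j
  have hi' := hhigh i
  have hj' := hhigh j
  have hsub : Even (S i - S j) := by
    rw [show S i - S j = (S i - π) - (S j - π) by ring]
    exact (hpar i).sub (hpar j)
  have hadd : Even (S i + S j) := by
    rw [show S i + S j = (S i - S j) + 2 * S j by ring]
    exact hsub.add (even_two_mul _)
  have key1 : (∀ k, -a ≤ k → k ≤ b → ¬ (q : ℤ) ∣ (S i - S j) - 2 * k) ↔ _ :=
    forall_not_dvd_sub_two_mul_iff hsub (by linarith) (by linarith) ha hab (by linarith) hqo
  have key2 : (∀ k, -a ≤ k → k ≤ b → ¬ (q : ℤ) ∣ (S i + S j) - 2 * k) ↔ _ :=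
    forall_not_dvd_sub_two_mul_iff hadd (by linarith) (by linarith) ha hab (by linarith) hqo
  have key3 : (∀ k, -a ≤ k → k ≤ b → ¬ (q : ℤ) ∣ -(S i - S j) - 2 * k) ↔ _ :=
    forall_not_dvd_sub_two_mul_iff hsub.neg (by linarith) (by linarith) ha hab (by linarith) hqo
  have key4 : (∀ k, -a ≤ k → k ≤ b → ¬ (q : ℤ) ∣ -(S i + S j) - 2 * k) ↔ _ :=
    forall_not_dvd_sub_two_mul_iff hadd.neg (by linarith) (by linarith) ha hab (by linarith) hqo
  unfold PairCond
  cases hε : ε i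
  · obtain ⟨h1, h2⟩ := signedLabel_of_false hij hε
    have e1 : signed ε S i = -S i := by simp [signed, hε]
    have e2 : signed ε S j = S j ∨ signed ε S j = -S j := by
      simp only [signed]; split_ifs <;> simp
    rcases e2 with e2 | e2
    · rw [e1, e2, show -S i - S j = -(S i + S j) by ring, show -S i + S j = -(S i - S j) by ring,
        key3, key4]
      omega
    · rw [e1, e2, show -S i - -S j = -(S i - S j) by ring, show -S i + -S j = -(S i + S j) by ring,
        key3, key4]
      omega
  · obtain ⟨h1, h2⟩ := signedLabel_of_true hij hε
    have e1 : signed ε S i = S i := by simp [signed, hε]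
    have e2 : signed ε S j = S j ∨ signed ε S j = -S j := by
      simp only [signed]; split_ifs <;> simp
    rcases e2 with e2 | e2
    · rw [e1, e2, key1, key2]
      omega
    · rw [e1, e2, sub_neg_eq_add, ← sub_eq_add_neg, key1, key2]
      omega

theorem avoidsMultiples_two_signed_iff {q : ℕ} (hq : Odd q) {a b : ℤ} (ha : 0 ≤ a) (hab : a ≤ b)
    (hb : 2 * b < q) {ε : Fin n → Bool} {S : Fin n → ℤ} (hlow : Low ε S)
    (hbox : ∀ u, -(q : ℤ) < signed ε S u ∧ signed ε S u ≤ q) :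
    AvoidsMultiples 2 (-a) b (halve q (signed ε S)) ↔
      FrontSingle (signedLabel ε) a b S ∧
        FrontSingle (fun u => -signedLabel ε u) a b (fun u => q - S u) := by
  rw [avoidsMultiples_two_halve_iff hq]
  unfold FrontSingle
  rw [← forall_and]
  refine forall_congr' fun u => ?_
  rw [forall_not_dvd_sub_iff (hbox u).1 (hbox u).2 ha hab (by linarith), signedLabel_neg_iff,
    neg_lt_zero, signedLabel_pos_iff]
  have h1 := hlow u
  have h2 := hbox u
  cases hε : ε u <;> simp only [signed, hε] at * <;> simp at * <;> omega

theorem avoidsMultiples_one_signed_iff {q : ℕ} (hq : Odd q) {a b : ℤ} (ha : 0 ≤ a) (hab : a ≤ b)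
    (hb : 2 * b < q) {ε : Fin n → Bool} {S : Fin n → ℤ} (hlow : Low ε S)
    (hhigh : ∀ u, S u < q) (hpar : ∀ u, Even (S u)) :
    AvoidsMultiples 1 (-a) b (halve q (signed ε S)) ↔
      FrontSingle (signedLabel ε) (2 * a) (2 * b) S := by
  rw [avoidsMultiples_one_halve_iff hq]
  unfold FrontSingle
  refine forall_congr' fun u => ?_
  have hqo : Odd (q : ℤ) := by exact_mod_cast hq
  have h1 := hlow u
  have h2 := hhigh u
  have h3 := hpar u
  rw [signedLabel_neg_iff]
  cases hε : ε u
  · rw [show signed ε S u = -S u by simp [signed, hε],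
      forall_not_dvd_sub_two_mul_iff_of_lt h3.neg (by linarith) (by linarith) ha hab hb hqo]
    simp only [Bool.false_eq_true, false_imp_iff, and_true]
    omega
  · rw [show signed ε S u = S u by simp [signed, hε],
      forall_not_dvd_sub_two_mul_iff_of_lt h3 (by linarith) (by linarith) ha hab hb hqo]
    have h4 : (true = true → 2 * b < S u) ↔ 2 * b < S u := by simp
    rw [h4]
    omega

/-- The endpoint `q` is odd, hence never attained by an even representative. -/
theorem box_zero_iff {q : ℕ} (hq : Odd q) {ε : Fin n → Bool} {S : Fin n → ℤ} (hlow : Low ε S) :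
    Box 0 q (signed ε S) ↔ (∀ u, Even (S u)) ∧ ∀ u, S u < q := by
  unfold Box
  rw [← forall_and]
  refine forall_congr' fun u => ?_
  have h1 := hlow u
  rw [sub_zero]
  have hne : Even (S u) → S u ≠ q := by
    intro h h'
    rw [h', Int.even_coe_nat] at h
    exact Nat.not_even_iff_odd.2 hq h
  cases hε : ε u
  · simp only [signed, hε, Bool.false_eq_true, if_false, even_neg]
    constructor
    · rintro ⟨h2, h3⟩; exact ⟨h3, by omega⟩
    · rintro ⟨h2, h3⟩; exact ⟨by omega, h2⟩
  · simp only [signed, hε, if_true]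
    constructor
    · rintro ⟨h2, h3⟩; exact ⟨h3, by have := hne h3; omega⟩
    · rintro ⟨h2, h3⟩; exact ⟨by omega, h2⟩

theorem frontSingle_zero_iff {l : Fin n → ℤ} {q : ℤ} {S : Fin n → ℤ} :
    FrontSingle l 0 0 (fun u => q - S u) ↔ ∀ u, S u < q := by
  unfold FrontSingle
  refine forall_congr' fun u => ?_
  constructor
  · intro h; linarith [h.1]
  · intro h; exact ⟨by linarith, fun _ => by linarith⟩

/-- Values of a pairwise avoiding vector have distinct absolute values. -/
theorem injective_of_pairCond {l : Fin n → ℤ} {a b q : ℤ} {S : Fin n → ℤ}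
    (h : ∀ i j, i < j → PairCond l a b q S i j) : Function.Injective S := by
  intro i j hij
  by_contra hne
  rcases lt_or_gt_of_ne hne with h' | h'
  · exact (h i j h').1 hij
  · exact (h j i h').1 hij.symm

theorem card_avoids_D {q : ℕ} (hq : Odd q) {a b : ℤ} (ha : 0 ≤ a) (hab : a ≤ b) (hb : 2 * b < q) :
    Nat.card {x : Fin n → ZMod q // AvoidsPairs (-a) b x} =
      ∑ ε : Fin n → Bool, ∑ r : Equiv.Perm (Fin n), Nat.card {S // CondD r ε a b q S} := by
  rw [card_zmod_eq_sum hq 0]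
  · refine Finset.sum_congr rfl fun ε _ => Finset.sum_congr rfl fun r _ =>
      Nat.card_congr (Equiv.subtypeEquivRight fun S => ?_)
    unfold CondD
    rw [frontSingle_zero_iff]
    constructor
    · rintro ⟨⟨h1, h2, h3⟩, h4⟩
      obtain ⟨h5, h6⟩ := (box_zero_iff hq h1).1 h2
      rw [avoidsPairs_signed_iff hq ha hab hb (fun u => (h1 u).1) h6
        (π := 0) (fun u => by rw [sub_zero]; exact h5 u)] at h3
      obtain ⟨h7, h8, h9⟩ := (pairCond_order_iff r _ ha q S).1 ⟨h3, h4⟩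
      exact ⟨h5, h1, h7, h8, h6, h9⟩
    · rintro ⟨h5, h1, h7, h8, h6, h9⟩
      obtain ⟨h3, h4⟩ := (pairCond_order_iff r _ ha q S).2 ⟨h7, h8, h9⟩
      rw [← avoidsPairs_signed_iff hq ha hab hb (fun u => (h1 u).1) h6
        (π := 0) (fun u => by rw [sub_zero]; exact h5 u)] at h3
      exact ⟨⟨h1, (box_zero_iff hq h1).2 ⟨h5, h6⟩, h3⟩, h4⟩
  · intro ε S h1 h2 h3
    obtain ⟨h5, h6⟩ := (box_zero_iff hq h1).1 h2
    rw [avoidsPairs_signed_iff hq ha hab hb (fun u => (h1 u).1) h6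
      (π := 0) (fun u => by rw [sub_zero]; exact h5 u)] at h3
    exact injective_of_pairCond h3

theorem low_of_frontSingle {ε : Fin n → Bool} {l : Fin n → ℤ} {A B : ℤ} {S : Fin n → ℤ}
    (hA : 0 ≤ A) (h : FrontSingle l A B S) : Low ε S :=
  fun u => ⟨by linarith [(h u).1], fun _ => by linarith [(h u).1]⟩

theorem card_avoids_B {q : ℕ} (hq : Odd q) {a b : ℤ} (ha : 0 ≤ a) (hab : a ≤ b) (hb : 2 * b < q) :
    Nat.card {x : Fin n → ZMod q // AvoidsMultiples 1 (-a) b x ∧ AvoidsPairs (-a) b x} =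
      ∑ ε : Fin n → Bool, ∑ r : Equiv.Perm (Fin n), Nat.card {S // CondB r ε a b q S} := by
  rw [card_zmod_eq_sum hq 0]
  · refine Finset.sum_congr rfl fun ε _ => Finset.sum_congr rfl fun r _ =>
      Nat.card_congr (Equiv.subtypeEquivRight fun S => ?_)
    unfold CondB
    rw [frontSingle_zero_iff]
    constructor
    · rintro ⟨⟨h1, h2, h2', h3⟩, h4⟩
      obtain ⟨h5, h6⟩ := (box_zero_iff hq h1).1 h2
      rw [avoidsPairs_signed_iff hq ha hab hb (fun u => (h1 u).1) h6
        (π := 0) (fun u => by rw [sub_zero]; exact h5 u)] at h3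
      rw [avoidsMultiples_one_signed_iff hq ha hab hb h1 h6 h5] at h2'
      obtain ⟨h7, h8, h9⟩ := (pairCond_order_iff r _ ha q S).1 ⟨h3, h4⟩
      exact ⟨h5, h7, h2', h6, h9⟩
    · rintro ⟨h5, h7, h2', h6, h9⟩
      have h1 : Low ε S := low_of_frontSingle (by linarith) h2'
      obtain ⟨h3, h4⟩ := (pairCond_order_iff r _ ha q S).2
        ⟨h7, frontPair_of_frontSingle (by linarith) h2', h9⟩
      rw [← avoidsPairs_signed_iff hq ha hab hb (fun u => (h1 u).1) h6
        (π := 0) (fun u => by rw [sub_zero]; exact h5 u)] at h3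
      rw [← avoidsMultiples_one_signed_iff hq ha hab hb h1 h6 h5] at h2'
      exact ⟨⟨h1, (box_zero_iff hq h1).2 ⟨h5, h6⟩, h2', h3⟩, h4⟩
  · intro ε S h1 h2 h3
    obtain ⟨h5, h6⟩ := (box_zero_iff hq h1).1 h2
    have h3 := h3.2
    rw [avoidsPairs_signed_iff hq ha hab hb (fun u => (h1 u).1) h6
      (π := 0) (fun u => by rw [sub_zero]; exact h5 u)] at h3
    exact injective_of_pairCond h3

/-- Absolute values of doubled coordinates avoiding the hyperplanes of type `BC`. -/
def CondBC (r : Equiv.Perm (Fin n)) (ε : Fin n → Bool) (a b q : ℤ) (S : Fin n → ℤ) : Prop :=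
  (∀ u, Even (S u)) ∧ GapCond r (signedLabel ε) (2 * a) (2 * b) S ∧
    FrontSingle (signedLabel ε) (2 * a) (2 * b) S ∧
    FrontSingle (fun u => -signedLabel ε u) a b (fun u => q - S u)

theorem high_of_frontSingle {l : Fin n → ℤ} {A B q : ℤ} {S : Fin n → ℤ}
    (hA : 0 ≤ A) (h : FrontSingle l A B fun u => q - S u) : ∀ u, S u < q :=
  fun u => by linarith [(h u).1]

/-- At the front the bound from `e i` implies the one from `2 e i`; at the back only `2 e i` acts.
The pair conditions at both ends then follow. -/
theorem card_avoids_BC {q : ℕ} (hq : Odd q) {a b : ℤ} (ha : 0 ≤ a) (hab : a ≤ b)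
    (hb : 2 * b < q) :
    Nat.card {x : Fin n → ZMod q //
      AvoidsMultiples 1 (-a) b x ∧ AvoidsMultiples 2 (-a) b x ∧ AvoidsPairs (-a) b x} =
      ∑ ε : Fin n → Bool, ∑ r : Equiv.Perm (Fin n), Nat.card {S // CondBC r ε a b q S} := by
  rw [card_zmod_eq_sum hq 0]
  · refine Finset.sum_congr rfl fun ε _ => Finset.sum_congr rfl fun r _ =>
      Nat.card_congr (Equiv.subtypeEquivRight fun S => ?_)
    unfold CondBC
    constructor
    · rintro ⟨⟨h1, h2, h2', h2'', h3⟩, h4⟩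
      obtain ⟨h5, h6⟩ := (box_zero_iff hq h1).1 h2
      rw [avoidsPairs_signed_iff hq ha hab hb (fun u => (h1 u).1) h6
        (π := 0) (fun u => by rw [sub_zero]; exact h5 u)] at h3
      rw [avoidsMultiples_one_signed_iff hq ha hab hb h1 h6 h5] at h2'
      rw [avoidsMultiples_two_signed_iff hq ha hab hb h1 fun u => (h2 u).1] at h2''
      obtain ⟨h7, h8, h9⟩ := (pairCond_order_iff r _ ha q S).1 ⟨h3, h4⟩
      exact ⟨h5, h7, h2', h2''.2⟩
    · rintro ⟨h5, h7, h2', h2''⟩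
      have h1 : Low ε S := low_of_frontSingle (by linarith) h2'
      have h6 := high_of_frontSingle ha h2''
      have hbox : Box 0 q (signed ε S) := (box_zero_iff hq h1).2 ⟨h5, h6⟩
      obtain ⟨h3, h4⟩ := (pairCond_order_iff r _ ha q S).2
        ⟨h7, frontPair_of_frontSingle (by linarith) h2',
          frontPair_of_gapCond ha (h7.mirror q) h2''⟩
      have hs : FrontSingle (signedLabel ε) a b S := fun u =>
        ⟨by linarith [(h2' u).1], fun h => by linarith [(h2' u).2 h]⟩
      rw [← avoidsPairs_signed_iff hq ha hab hb (fun u => (h1 u).1) h6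
        (π := 0) (fun u => by rw [sub_zero]; exact h5 u)] at h3
      rw [← avoidsMultiples_one_signed_iff hq ha hab hb h1 h6 h5] at h2'
      exact ⟨⟨h1, hbox, h2', (avoidsMultiples_two_signed_iff hq ha hab hb h1
        fun u => (hbox u).1).2 ⟨hs, h2''⟩, h3⟩, h4⟩
  · intro ε S h1 h2 h3
    obtain ⟨h5, h6⟩ := (box_zero_iff hq h1).1 h2
    have h3 := h3.2.2
    rw [avoidsPairs_signed_iff hq ha hab hb (fun u => (h1 u).1) h6
      (π := 0) (fun u => by rw [sub_zero]; exact h5 u)] at h3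
    exact injective_of_pairCond h3

theorem parity_of_box {π : ℤ} {q : ℕ} {ε : Fin n → Bool} {S : Fin n → ℤ}
    (h : Box π q (signed ε S)) : ∀ u, Even (S u - π) := by
  intro u
  have := (h u).2
  simp only [signed] at this
  split_ifs at this
  · exact this
  · rw [show S u - π = -(-S u - π) - 2 * π by ring]
    exact this.neg.sub (even_two_mul _)

/-- The left side does not involve `π`; this freedom absorbs the change of parity in
`card_condC_shift`. -/
theorem card_avoids_C {q : ℕ} (hq : Odd q) (π : ℤ) {a b : ℤ} (ha : 0 ≤ a) (hab : a ≤ b)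
    (hb : 2 * b < q) :
    Nat.card {x : Fin n → ZMod q // AvoidsMultiples 2 (-a) b x ∧ AvoidsPairs (-a) b x} =
      ∑ ε : Fin n → Bool, ∑ r : Equiv.Perm (Fin n), Nat.card {S // CondC π r ε a b q S} := by
  rw [card_zmod_eq_sum hq π]
  · refine Finset.sum_congr rfl fun ε _ => Finset.sum_congr rfl fun r _ =>
      Nat.card_congr (Equiv.subtypeEquivRight fun S => ?_)
    unfold CondC
    constructor
    · rintro ⟨⟨h1, h2, h2', h3⟩, h4⟩
      have h5 := parity_of_box h2
      rw [avoidsMultiples_two_signed_iff hq ha hab hb h1 fun u => (h2 u).1] at h2'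
      have h6 := high_of_frontSingle ha h2'.2
      rw [avoidsPairs_signed_iff hq ha hab hb (fun u => (h1 u).1) h6 h5] at h3
      obtain ⟨h7, h8, h9⟩ := (pairCond_order_iff r _ ha q S).1 ⟨h3, h4⟩
      exact ⟨h5, h7, h2'⟩
    · rintro ⟨h5, h7, h2', h2''⟩
      have h1 : Low ε S := low_of_frontSingle ha h2'
      have h6 := high_of_frontSingle ha h2''
      have hbox : Box π q (signed ε S) := by
        intro u
        have := h1 u
        have := h6 u
        have := h5 u
        simp only [signed]
        cases hε : ε u
        · simp only [Bool.false_eq_true, if_false]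
          refine ⟨by omega, ?_⟩
          rw [show -S u - π = -(S u - π) - 2 * π by ring]
          exact this.neg.sub (even_two_mul _)
        · simp only [if_true]
          exact ⟨by omega, this⟩
      obtain ⟨h3, h4⟩ := (pairCond_order_iff r _ ha q S).2
        ⟨h7, frontPair_of_gapCond ha h7 h2', frontPair_of_gapCond ha (h7.mirror q) h2''⟩
      rw [← avoidsPairs_signed_iff hq ha hab hb (fun u => (h1 u).1) h6 h5] at h3
      exact ⟨⟨h1, hbox, (avoidsMultiples_two_signed_iff hq ha hab hb h1
        fun u => (hbox u).1).2 ⟨h2', h2''⟩, h3⟩, h4⟩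
  · intro ε S h1 h2 h3
    obtain ⟨h2', h3⟩ := h3
    rw [avoidsMultiples_two_signed_iff hq ha hab hb h1 fun u => (h2 u).1] at h2'
    rw [avoidsPairs_signed_iff hq ha hab hb (fun u => (h1 u).1) (high_of_frontSingle ha h2'.2)
      (parity_of_box h2)] at h3
    exact injective_of_pairCond h3

end Conditions

/-! ### Type A counts, and the translation identities for A, B, C and D. -/

section Translation

variable {n : ℕ}

theorem intCast_bijective {q : ℕ} (hq : 0 < q) (F : (Fin n → ZMod q) → Prop) :
    Function.Bijective
      fun S : {S : Fin n → ℤ // (∀ i, 0 ≤ S i ∧ S i < q) ∧ F fun i => (S i : ZMod q)} =>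
        (⟨fun i => (S.1 i : ZMod q), S.2.2⟩ : {x // F x}) := by
  have : NeZero q := ⟨hq.ne'⟩
  constructor
  · rintro ⟨S, hS, _⟩ ⟨T, hT, _⟩ h
    have h1 : (fun i => (S i : ZMod q)) = fun i => (T i : ZMod q) := congrArg Subtype.val h
    apply Subtype.ext
    funext i
    have h2 := (ZMod.intCast_eq_intCast_iff' _ _ _).1 (congrFun h1 i)
    rwa [Int.emod_eq_of_lt (hS i).1 (hS i).2, Int.emod_eq_of_lt (hT i).1 (hT i).2] at h2
  · rintro ⟨x, hx⟩
    have h1 : (fun i => (((x i).val : ℤ) : ZMod q)) = x := by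
      funext i
      simp
    refine ⟨⟨fun i => (x i).val, fun i => ⟨by positivity, ?_⟩, by rw [h1]; exact hx⟩, ?_⟩
    · change ((x i).val : ℤ) < q
      exact_mod_cast ZMod.val_lt _
    · exact Subtype.ext h1

/-- The cut point has the smallest index, so the step leaving it needs only `a` and the step
returning to it needs `b`. These two bounds also prevent differences of the remaining coordinates
from wrapping around. -/
theorem avoids_A_iff {q : ℕ} {a b : ℤ} (ha : 0 ≤ a) (hab : a ≤ b) (hb : 2 * b < q)
    {S : Fin n → ℤ} (hS : ∀ i, 0 ≤ S i ∧ S i < q) :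
    (AvoidsMultiples (-1) (-a) b (fun i => (S i : ZMod q)) ∧
      AvoidsDifferences (-a) b (fun i => (S i : ZMod q))) ↔
      (∀ i, a < S i ∧ b < q - S i) ∧
        ∀ i j, i < j → S i - S j < -a ∨ b < S i - S j := by
  have h1 : AvoidsMultiples (-1) (-a) b (fun i => (S i : ZMod q)) ↔
      ∀ i, a < S i ∧ b < q - S i := by
    unfold AvoidsMultiples
    refine forall_congr' fun i => ?_
    have h2 := hS i
    have h3 : (∀ k, -a ≤ k → k ≤ b → ¬ (q : ℤ) ∣ -S i - k) ↔ _ :=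
      forall_not_dvd_sub_iff (by linarith) (by linarith) ha hab (by linarith)
    refine Iff.trans (forall₃_congr fun k _ _ => ?_) (h3.trans (by omega))
    rw [← ZMod.intCast_zmod_eq_zero_iff_dvd]
    push_cast
    rw [sub_eq_zero, neg_one_mul]
  rw [h1]
  refine and_congr_right fun h2 => ?_
  unfold AvoidsDifferences
  refine forall₃_congr fun i j hij => ?_
  have hi := h2 i
  have hj := h2 j
  have h3 : (∀ k, -a ≤ k → k ≤ b → ¬ (q : ℤ) ∣ (S i - S j) - k) ↔ _ :=
    forall_not_dvd_sub_iff (by linarith) (by linarith) ha hab (by linarith)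
  refine Iff.trans (forall₃_congr fun k _ _ => ?_) (h3.trans (by omega))
  rw [← ZMod.intCast_zmod_eq_zero_iff_dvd]
  push_cast
  rw [sub_eq_zero]

theorem card_avoids_A {q : ℕ} (hq : 0 < q) {a b : ℤ} (ha : 0 ≤ a) (hab : a ≤ b)
    (hb : 2 * b < q) :
    Nat.card {x : Fin n → ZMod q // AvoidsMultiples (-1) (-a) b x ∧ AvoidsDifferences (-a) b x} =
      ∑ r : Equiv.Perm (Fin n), Nat.card {S // CondA r a b q S} := by
  have : NeZero q := ⟨hq.ne'⟩
  have hbij := intCast_bijective hq fun x : Fin n → ZMod q =>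
    AvoidsMultiples (-1) (-a) b x ∧ AvoidsDifferences (-a) b x
  have := Finite.of_injective _ hbij.1
  rw [← Nat.card_congr (Equiv.ofBijective _ hbij)]
  rw [card_eq_sum_of_existsUnique _ fun (r : Equiv.Perm (Fin n)) (S : Fin n → ℤ) =>
    ∀ u v, r u < r v → S u < S v]
  · refine Finset.sum_congr rfl fun r _ => Nat.card_congr (Equiv.subtypeEquivRight fun S => ?_)
    simp only [CondA, GapCond, FrontSingle]
    constructor
    · rintro ⟨⟨h1, h2⟩, h3⟩
      obtain ⟨h4, h5⟩ := (avoids_A_iff ha hab hb h1).1 h2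
      refine ⟨fun u v huv => ?_, fun u => ⟨(h4 u).1, fun h => by omega⟩,
        fun u => ⟨by linarith [(h4 u).2], fun _ => (h4 u).2⟩⟩
      have h6 := h3 u v huv
      rcases lt_trichotomy u v with h7 | h7 | h7
      · have := h5 u v h7
        rw [Fin.lt_def] at h7
        omega
      · rw [h7] at huv; exact absurd huv (lt_irrefl _)
      · have := h5 v u h7
        rw [Fin.lt_def] at h7
        omega
    · rintro ⟨h1, h2, h3⟩
      have h4 : ∀ i, a < S i ∧ b < q - S i := fun i => ⟨(h2 i).1, (h3 i).2 (by omega)⟩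
      have h5 : ∀ i, 0 ≤ S i ∧ S i < q := fun i => by have := h4 i; omega
      refine ⟨⟨h5, (avoids_A_iff ha hab hb h5).2 ⟨h4, fun i j hij => ?_⟩⟩,
        fun u v huv => by linarith [(h1 u v huv).1]⟩
      rcases lt_or_gt_of_ne fun h => hij.ne (r.injective h) with h | h
      · have := h1 i j h
        omega
      · have := h1 j i h
        rw [Fin.lt_def] at hij
        omega
  · rintro S ⟨h1, h2⟩
    obtain ⟨h4, h5⟩ := (avoids_A_iff ha hab hb h1).1 h2
    refine existsUnique_perm_of_injective S fun i j hij => ?_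
    by_contra hne
    rcases lt_or_gt_of_ne hne with h | h
    · have := h5 i j h; omega
    · have := h5 j i h; omega

theorem eq_comp_of_eval_odd {p₁ p₂ : ℤ[X]} {c : ℤ}
    (h : ∃ Q : ℕ, ∀ q : ℕ, Q ≤ q → Odd q → p₁.eval (q : ℤ) = p₂.eval ((q : ℤ) - c)) :
    p₁ = p₂.comp (X - C c) := by
  obtain ⟨Q, hQ⟩ := h
  refine Polynomial.eq_of_infinite_eval_eq _ _ ?_
  refine Set.infinite_of_injective_forall_mem (f := fun k : ℕ => ((2 * (k + Q) + 1 : ℕ) : ℤ))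
    (fun k l hkl => by simp at hkl; omega) fun k => ?_
  simp only [Set.mem_ofPred_eq, eval_comp, eval_sub, eval_X, eval_C]
  exact hQ _ (by omega) ⟨_, rfl⟩

theorem charPoly_posA_translate (n : ℕ) {a b : ℤ} (ha : 0 ≤ a) (hab : a ≤ b) :
    charPoly (deformation (posA (n + 1)) (-a) b) =
      (charPoly (deformation (posA (n + 1)) 0 (b - a))).comp (X - C (a * (n + 1 : ℕ))) := by
  obtain ⟨Q₁, hQ₁⟩ := charPoly_posA_eval n (-a) b
  obtain ⟨Q₂, hQ₂⟩ := charPoly_posA_eval n 0 (b - a)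
  have hc : 0 ≤ a * ((n + 1 : ℕ) : ℤ) := by positivity
  obtain ⟨c, hc⟩ := Int.eq_ofNat_of_zero_le hc
  -- The bound leaves both `q` and `q - c` large enough for the two evaluations and for windows
  -- shorter than half the circle.
  refine eq_comp_of_eval_odd ⟨Q₁ + Q₂ + c + 2 * b.toNat + 1, fun q hq _ => ?_⟩
  obtain ⟨q', rfl⟩ : ∃ q', q = q' + c := ⟨q - c, by omega⟩
  have h1 := hQ₁ (q' + c) (by omega) (by omega)
  have h2 := hQ₂ q' (by omega) (by omega)
  rw [card_avoids_A (by omega) ha hab (by push_cast; omega)] at h1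
  have h3 := card_avoids_A (n := n) (q := q') (by omega) (le_refl 0) (sub_nonneg.2 hab) (by omega)
  rw [neg_zero] at h3
  rw [h3] at h2
  rw [← h1, hc, Nat.cast_add, add_sub_cancel_right, ← h2]
  congr 1
  refine Finset.sum_congr rfl fun r _ => ?_
  rw [card_condA_shift r ha, show (q' : ℤ) + c - a * (n + 1) = q' by
    push_cast at hc ⊢; linarith]

theorem charPoly_posD_translate {n : ℕ} (hn : 1 ≤ n) {a b : ℤ} (ha : 0 ≤ a) (hab : a ≤ b) :
    charPoly (deformation (posD n) (-a) b) =
      (charPoly (deformation (posD n) 0 (b - a))).comp (X - C (a * (2 * (n : ℤ) - 2))) := by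
  obtain ⟨Q₁, hQ₁⟩ := charPoly_posD_eval n (-a) b
  obtain ⟨Q₂, hQ₂⟩ := charPoly_posD_eval n 0 (b - a)
  have hc : 0 ≤ a * (n - 1) := mul_nonneg ha (by omega)
  obtain ⟨c, hc⟩ := Int.eq_ofNat_of_zero_le hc
  -- The translation is even, so the translated modulus remains odd.
  have hc' : a * (2 * (n : ℤ) - 2) = 2 * c := by linarith
  refine eq_comp_of_eval_odd ⟨Q₁ + Q₂ + 2 * c + 2 * b.toNat + 1, fun q hq hodd => ?_⟩
  obtain ⟨q', rfl⟩ : ∃ q', q = q' + 2 * c := ⟨q - 2 * c, by omega⟩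
  have hodd' : Odd q' := by
    rw [← Nat.not_even_iff_odd] at hodd ⊢
    simpa [Nat.even_add] using hodd
  have h1 := hQ₁ _ (by omega) hodd
  have h2 := hQ₂ q' (by omega) hodd'
  rw [card_avoids_D hodd ha hab (by push_cast; omega)] at h1
  have h3 := card_avoids_D (n := n) hodd' (le_refl 0) (sub_nonneg.2 hab) (by omega)
  rw [neg_zero] at h3
  rw [h3] at h2
  rw [← h1, hc', show ((q' + 2 * c : ℕ) : ℤ) - 2 * c = q' by push_cast; ring, ← h2]
  congr 1
  refine Finset.sum_congr rfl fun ε _ => Finset.sum_congr rfl fun r _ => ?_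
  rw [card_condD_shift r ε ha hab, hc',
    show ((q' + 2 * c : ℕ) : ℤ) - 2 * c = q' by push_cast; ring]

theorem charPoly_posB_translate (n : ℕ) {a b : ℤ} (ha : 0 ≤ a) (hab : a ≤ b) :
    charPoly (deformation (posB n) (-a) b) =
      (charPoly (deformation (posB n) 0 (b - a))).comp (X - C (a * (2 * (n : ℤ)))) := by
  obtain ⟨Q₁, hQ₁⟩ := charPoly_posB_eval n (-a) b
  obtain ⟨Q₂, hQ₂⟩ := charPoly_posB_eval n 0 (b - a)
  have hc : 0 ≤ a * (n : ℤ) := by positivity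
  obtain ⟨c, hc⟩ := Int.eq_ofNat_of_zero_le hc
  have hc' : a * (2 * (n : ℤ)) = 2 * c := by linarith
  refine eq_comp_of_eval_odd ⟨Q₁ + Q₂ + 2 * c + 2 * b.toNat + 1, fun q hq hodd => ?_⟩
  obtain ⟨q', rfl⟩ : ∃ q', q = q' + 2 * c := ⟨q - 2 * c, by omega⟩
  have hodd' : Odd q' := by
    rw [← Nat.not_even_iff_odd] at hodd ⊢
    simpa [Nat.even_add] using hodd
  have h1 := hQ₁ _ (by omega) hodd
  have h2 := hQ₂ q' (by omega) hodd'
  rw [card_avoids_B hodd ha hab (by push_cast; omega)] at h1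
  have h3 := card_avoids_B (n := n) hodd' (le_refl 0) (sub_nonneg.2 hab) (by omega)
  rw [neg_zero] at h3
  rw [h3] at h2
  rw [← h1, hc', show ((q' + 2 * c : ℕ) : ℤ) - 2 * c = q' by push_cast; ring, ← h2]
  congr 1
  refine Finset.sum_congr rfl fun ε _ => Finset.sum_congr rfl fun r _ => ?_
  rw [card_condB_shift r ε ha hab, hc',
    show ((q' + 2 * c : ℕ) : ℤ) - 2 * c = q' by push_cast; ring]

theorem charPoly_posC_translate (n : ℕ) {a b : ℤ} (ha : 0 ≤ a) (hab : a ≤ b) :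
    charPoly (deformation (posC n) (-a) b) =
      (charPoly (deformation (posC n) 0 (b - a))).comp (X - C (a * (2 * (n : ℤ)))) := by
  obtain ⟨Q₁, hQ₁⟩ := charPoly_posC_eval n (-a) b
  obtain ⟨Q₂, hQ₂⟩ := charPoly_posC_eval n 0 (b - a)
  have hc : 0 ≤ a * (n : ℤ) := by positivity
  obtain ⟨c, hc⟩ := Int.eq_ofNat_of_zero_le hc
  have hc' : a * (2 * (n : ℤ)) = 2 * c := by linarith
  refine eq_comp_of_eval_odd ⟨Q₁ + Q₂ + 2 * c + 2 * b.toNat + 1, fun q hq hodd => ?_⟩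
  obtain ⟨q', rfl⟩ : ∃ q', q = q' + 2 * c := ⟨q - 2 * c, by omega⟩
  have hodd' : Odd q' := by
    rw [← Nat.not_even_iff_odd] at hodd ⊢
    simpa [Nat.even_add] using hodd
  have h1 := hQ₁ _ (by omega) hodd
  have h2 := hQ₂ q' (by omega) hodd'
  rw [card_avoids_C hodd 0 ha hab (by push_cast; omega)] at h1
  -- Representatives of the parity of `a` are used here, against even ones in `h1`, to match the
  -- shift.
  have h3 := card_avoids_C (n := n) hodd' (0 + a) (le_refl 0) (sub_nonneg.2 hab) (by omega)
  rw [neg_zero] at h3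
  rw [h3] at h2
  rw [← h1, hc', show ((q' + 2 * c : ℕ) : ℤ) - 2 * c = q' by push_cast; ring, ← h2]
  congr 1
  refine Finset.sum_congr rfl fun ε _ => Finset.sum_congr rfl fun r _ => ?_
  rw [card_condC_shift 0 r ε ha hab, hc',
    show ((q' + 2 * c : ℕ) : ℤ) - 2 * c = q' by push_cast; ring]

end Translation

/-! ### Type BC: each sign vector and ranking contributes a binomial coefficient. -/

section BCCount

variable {n : ℕ}

/-- Absolute values of coordinates on a circle of length `K` avoiding the hyperplanes of type
`BC`. -/
def CondW (r : Equiv.Perm (Fin n)) (ε : Fin n → Bool) (a b K : ℤ) (s : Fin n → ℤ) : Prop :=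
  GapCond r (signedLabel ε) a b s ∧ FrontSingle (signedLabel ε) a b s ∧
    FrontSingle (fun u => -signedLabel ε u) a b (fun u => K - 2 * s u)

theorem card_condBC_eq (r : Equiv.Perm (Fin n)) (ε : Fin n → Bool) (a b q : ℤ) :
    Nat.card {S // CondBC r ε a b q S} = Nat.card {s // CondW r ε a b q s} := by
  have hiff : ∀ s : Fin n → ℤ, CondBC r ε a b q (fun u => 2 * s u) ↔ CondW r ε a b q s := by
    intro s
    unfold CondBC CondW GapCond FrontSingle
    have hev : ∀ u, Even (2 * s u) := fun u => even_two_mul _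
    constructor
    · rintro ⟨-, h2, h3, h4⟩
      exact ⟨fun u v huv => ⟨by linarith [(h2 u v huv).1], fun h => by linarith [(h2 u v huv).2 h]⟩,
        fun u => ⟨by linarith [(h3 u).1], fun h => by linarith [(h3 u).2 h]⟩, h4⟩
    · rintro ⟨h2, h3, h4⟩
      exact ⟨hev, fun u v huv =>
        ⟨by linarith [(h2 u v huv).1], fun h => by linarith [(h2 u v huv).2 h]⟩,
        fun u => ⟨by linarith [(h3 u).1], fun h => by linarith [(h3 u).2 h]⟩, h4⟩
  refine (Nat.card_congr (Equiv.ofBijective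
    (fun s : {s // CondW r ε a b q s} =>
      (⟨fun u => 2 * s.1 u, (hiff s.1).2 s.2⟩ : {S // CondBC r ε a b q S})) ⟨?_, ?_⟩)).symm
  · rintro ⟨s, hs⟩ ⟨t, ht⟩ h
    have h1 : (fun u => 2 * s u) = fun u => 2 * t u := congrArg Subtype.val h
    apply Subtype.ext
    funext u
    have := congrFun h1 u
    simp only at this ⊢
    linarith
  · rintro ⟨S, hS⟩
    have h1 : (fun u => 2 * (S u / 2)) = S := by
      funext u
      exact Int.two_mul_ediv_two_of_even (hS.1 u)
    exact ⟨⟨fun u => S u / 2, (hiff _).1 (by rw [h1]; exact hS)⟩, Subtype.ext h1⟩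

/-- Whether the step to the label of rank `j` is a descent; the step to rank `0` starts at the
label `0`. -/
def descentAt (l : ℕ → ℤ) (j : ℕ) : ℕ :=
  if l j < (if j = 0 then 0 else l (j - 1)) then 1 else 0

/-- The labels in the order of their ranks. -/
def rankedLabel (r : Equiv.Perm (Fin n)) (ε : Fin n → Bool) (j : ℕ) : ℤ :=
  if h : j < n then signedLabel ε (r.symm ⟨j, h⟩) else 0

theorem rankedLabel_apply (r : Equiv.Perm (Fin n)) (ε : Fin n → Bool) (u : Fin n) :
    rankedLabel r ε (r u) = signedLabel ε u := by
  simp [rankedLabel]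

/-- The number of descents around the full symmetric circle. -/
def circularDescents (r : Equiv.Perm (Fin n)) (ε : Fin n → Bool) : ℕ :=
  2 * ∑ j ∈ Finset.range n, descentAt (rankedLabel r ε) j +
    if 0 < rankedLabel r ε (n - 1) then 1 else 0

theorem condW_iff {a b : ℤ} (ha : -1 ≤ a) (hab : a ≤ b) (r : Equiv.Perm (Fin n))
    (ε : Fin n → Bool) (K : ℤ) (s : Fin n → ℤ) : CondW r ε a b K s ↔
      (∀ u v, (r v : ℕ) = r u + 1 →
        a < s v - s u ∧ (signedLabel ε v < signedLabel ε u → b < s v - s u)) ∧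
      (∀ u, (r u : ℕ) = 0 → a < s u ∧ (signedLabel ε u < 0 → b < s u)) ∧
      ∀ u, (r u : ℕ) = n - 1 → a < K - 2 * s u ∧ (0 < signedLabel ε u → b < K - 2 * s u) := by
  unfold CondW
  rw [← gapCond_iff_adjacent r _ ha]
  refine and_congr_right fun hg => ?_
  -- The back condition concerns `K - 2 * s u`, so the gap condition must be mirrored for the
  -- doubled values.
  have hg2 : GapCond r (signedLabel ε) (2 * a + 1) (2 * b + 1) fun u => 2 * s u := fun u v huv =>
    ⟨by linarith [Int.add_one_le_of_lt (hg u v huv).1],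
      fun h => by linarith [Int.add_one_le_of_lt ((hg u v huv).2 h)]⟩
  rw [frontSingle_iff_first hg ha (by linarith),
    frontSingle_iff_first (hg2.mirror K) (by linarith) (by linarith)]
  refine and_congr_right fun _ => forall_congr' fun u => ?_
  have h1 : (((r.trans Fin.revPerm) u : Fin n) : ℕ) = 0 ↔ (r u : ℕ) = n - 1 := by
    have := (r u).2
    simp only [Equiv.trans_apply, Fin.revPerm_apply, Fin.val_rev]
    omega
  rw [h1, neg_lt_zero]

/-- Remove the forced part of every gap: `a + 1` per step, and `b - a` more at a descent. The
symmetric circle has `2 * n + 1` steps, each of the first `n` occurring twice. What remains are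
nonnegative slacks. -/
theorem card_condW_shift {a b : ℤ} (ha : -1 ≤ a) (hab : a ≤ b) (r : Equiv.Perm (Fin n))
    (ε : Fin n → Bool) (K : ℤ) : Nat.card {s // CondW r ε a b K s} =
      Nat.card {s // CondW r ε (-1) (-1)
        (K - (2 * n + 1) * (a + 1) - (b - a) * circularDescents r ε) s} := by
  let D : ℕ → ℤ := fun k => ∑ j ∈ Finset.range (k + 1), (descentAt (rankedLabel r ε) j : ℤ)
  refine card_shift (fun u => (a + 1) * ((r u : ℕ) + 1) + (b - a) * D (r u)) fun s => ?_
  rw [condW_iff ha hab, condW_iff le_rfl le_rfl]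
  refine and_congr (forall₃_congr fun u v huv => ?_)
    (and_congr (forall₂_congr fun u hu => ?_) (forall₂_congr fun u hu => ?_))
  · have h1 : D (r v) = D (r u) + descentAt (rankedLabel r ε) (r v) := by
      simp only [D, huv]
      rw [Finset.sum_range_succ]
    have h2 : descentAt (rankedLabel r ε) (r v) =
        if signedLabel ε v < signedLabel ε u then 1 else 0 := by
      have h3 : (if (r v : ℕ) = 0 then 0 else rankedLabel r ε ((r v : ℕ) - 1)) =
          signedLabel ε u := by
        rw [if_neg (by omega), huv, Nat.add_sub_cancel, rankedLabel_apply]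
      rw [descentAt, rankedLabel_apply, h3]
    rw [h1, h2, huv]
    push_cast
    split_ifs with h
    · simp only [h, forall_const]
      constructor <;> intro h3 <;> constructor <;> linarith [h3.1, h3.2]
    · simp only [h, false_imp_iff, and_true]
      constructor <;> intro h3 <;> linarith
  · have h2 : D (r u) = if signedLabel ε u < 0 then 1 else 0 := by
      have h3 := rankedLabel_apply r ε u
      rw [hu] at h3
      simp only [D, hu, zero_add, Finset.sum_range_one]
      rw [descentAt, if_pos rfl, h3]
      split_ifs <;> rfl
    rw [h2, hu]
    push_cast
    split_ifs with h
    · simp only [h, forall_const]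
      constructor <;> intro h3 <;> constructor <;> linarith [h3.1, h3.2]
    · simp only [h, false_imp_iff, and_true]
      constructor <;> intro h3 <;> linarith
  · have hn := (r u).2
    have h2 : (circularDescents r ε : ℤ) =
        2 * D (r u) + if 0 < signedLabel ε u then 1 else 0 := by
      have h3 := rankedLabel_apply r ε u
      rw [circularDescents, hu] at *
      rw [h3]
      simp only [D, Nat.sub_add_cancel (show 1 ≤ n by omega)]
      push_cast
      rfl
    have h4 : ((r u : ℕ) : ℤ) = n - 1 := by omega
    rw [h2, h4]
    generalize D (r u) = d
    split_ifs with h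
    · simp only [h, forall_const]
      have e1 : K - (2 * n + 1) * (a + 1) - (b - a) * (2 * d + 1) - 2 * s u =
          K - 2 * (s u + ((a + 1) * (n - 1 + 1) + (b - a) * d)) - b - 1 := by ring
      rw [e1]
      constructor <;> intro h3 <;> constructor <;> linarith [h3.1, h3.2]
    · simp only [h, false_imp_iff, and_true]
      have e1 : K - (2 * n + 1) * (a + 1) - (b - a) * (2 * d + 0) - 2 * s u =
          K - 2 * (s u + ((a + 1) * (n - 1 + 1) + (b - a) * d)) - a - 1 := by ring
      rw [e1]
      constructor <;> intro h3 <;> linarith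

/-- The number of strictly increasing integer sequences of length `n` in `[0, N)`. -/
def increasingCount (n : ℕ) (N : ℤ) : ℕ :=
  Nat.card {S : Fin n → ℤ // (∀ i, 0 ≤ S i ∧ S i < N) ∧ ∀ i j, i < j → S i < S j}

theorem card_ordered_eq (r : Equiv.Perm (Fin n)) (N : ℤ) :
    Nat.card {S : Fin n → ℤ // (∀ i, 0 ≤ S i ∧ S i < N) ∧ ∀ u v, r u < r v → S u < S v} =
      increasingCount n N := by
  refine Nat.card_congr ((Equiv.arrowCongr r (Equiv.refl ℤ)).subtypeEquiv fun S => ?_)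
  simp only [Equiv.arrowCongr_apply, Equiv.refl_apply, Function.comp_apply]
  refine and_congr ?_ ?_
  · exact (r.symm.forall_congr_left (p := fun i => 0 ≤ S (r.symm i) ∧ S (r.symm i) < N)).symm.trans
      (by simp) |>.symm.trans (by simp) |>.symm
  · constructor
    · intro h i j hij
      exact h _ _ (by simpa using hij)
    · intro h u v huv
      simpa using h _ _ huv

/-- Here the condition describes weakly increasing sequences in `[0, K / 2]`; adding the rank makes
them strictly increasing. -/
theorem card_condW_neg_one (r : Equiv.Perm (Fin n)) (ε : Fin n → Bool) (K : ℤ) :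
    Nat.card {s // CondW r ε (-1) (-1) K s} = increasingCount n (K / 2 + n) := by
  rw [← card_ordered_eq r, eq_comm]
  refine card_shift (fun u => ((r u : ℕ) : ℤ)) fun s => ?_
  have hg := gapCond_shift r (signedLabel ε) (A := 0) (B := 0) (t := 1) 0 (by norm_num)
    (by norm_num) s
  simp only [one_mul, add_zero, zero_sub] at hg
  have hord : (∀ u v, r u < r v → s u + ((r u : ℕ) : ℤ) < s v + ((r v : ℕ) : ℤ)) ↔
      GapCond r (signedLabel ε) 0 0 fun u => s u + ((r u : ℕ) : ℤ) :=
    forall₃_congr fun u v _ =>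
      ⟨fun h => ⟨by linarith, fun _ => by linarith⟩, fun h => by linarith [h.1]⟩
  rw [hord, and_comm]
  unfold CondW
  rw [hg]
  refine and_congr_right fun h => ?_
  have h' := hg.2 h
  have hs : ∀ S : Fin n → ℤ, ∀ l : Fin n → ℤ, FrontSingle l (-1) (-1) S ↔ ∀ u, 0 ≤ S u :=
    fun S l => forall_congr' fun u =>
      ⟨fun h => by linarith [h.1], fun h => ⟨by linarith, fun _ => by linarith⟩⟩
  have hfront := frontSingle_shift (l := signedLabel ε) (A := -1) (B := -1) (t := 1) (c := 0)
    (S := s) (S' := fun u => s u + ((r u : ℕ) : ℤ)) (A' := 0) (B' := 0) (fun u => by ring) h'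
    (by simpa using h) (by norm_num) (by norm_num) (by norm_num) (by norm_num)
  have hback := frontSingle_shift (r := r.trans Fin.revPerm) (l := fun u => -signedLabel ε u)
    (A := -1) (B := -1) (t := 1) (c := 0)
    (S := fun u => K / 2 - s u) (S' := fun u => (K / 2 + n - 1) - (s u + ((r u : ℕ) : ℤ)))
    (A' := 0) (B' := 0) (fun u => by rw [rev_cast]; ring) (h'.mirror _)
    (by simpa using h.mirror _) (by norm_num) (by norm_num) (by norm_num) (by norm_num)
  simp only [sub_zero, hs] at hfront hback
  rw [hs, hs, ← hfront, forall_and]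
  refine and_congr_right fun _ => ?_
  refine Iff.trans ?_ (hback.trans ?_)
  · refine forall_congr' fun u => ?_
    dsimp only
    omega
  · refine forall_congr' fun u => ?_
    omega

/-- Injections of an `n`-element set into an `N`-element set fall into `n!` classes according to
their ranking. -/
theorem factorial_mul_increasingCount (n N : ℕ) :
    n.factorial * increasingCount n N = N.descFactorial n := by
  have hfin : Finite {S : Fin n → ℤ // (∀ i, 0 ≤ S i ∧ S i < (N : ℤ)) ∧ Function.Injective S} := by
    refine Set.Finite.subset (s := Set.Icc 0 fun _ => (N : ℤ)) (Set.finite_Icc _ _) ?_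
    rintro S ⟨h, -⟩
    exact ⟨fun i => (h i).1, fun i => (h i).2.le⟩
  have h1 := card_eq_sum_of_existsUnique
    (fun S : Fin n → ℤ => (∀ i, 0 ≤ S i ∧ S i < (N : ℤ)) ∧ Function.Injective S)
    (fun (r : Equiv.Perm (Fin n)) S => ∀ u v, r u < r v → S u < S v)
    fun S hS => existsUnique_perm_of_injective S hS.2
  have h2 : ∀ r : Equiv.Perm (Fin n),
      Nat.card {S : Fin n → ℤ // ((∀ i, 0 ≤ S i ∧ S i < (N : ℤ)) ∧ Function.Injective S) ∧
        ∀ u v, r u < r v → S u < S v} = increasingCount n N := by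
    intro r
    rw [← card_ordered_eq r]
    refine Nat.card_congr (Equiv.subtypeEquivRight fun S => ?_)
    constructor
    · rintro ⟨⟨h, -⟩, h'⟩
      exact ⟨h, h'⟩
    · rintro ⟨h, h'⟩
      refine ⟨⟨h, fun u v huv => ?_⟩, h'⟩
      by_contra hne
      rcases lt_or_gt_of_ne fun h => hne (r.injective h) with h3 | h3
      · exact absurd huv (h' u v h3).ne
      · exact absurd huv (h' v u h3).ne'
  simp only [h2, Finset.sum_const, Finset.card_univ, Fintype.card_perm, Fintype.card_fin,
    smul_eq_mul] at h1
  rw [← h1]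
  have h3 : Nat.card {S : Fin n → ℤ // (∀ i, 0 ≤ S i ∧ S i < (N : ℤ)) ∧ Function.Injective S} =
      Nat.card (Fin n ↪ Fin N) := by
    refine Nat.card_congr
      { toFun := fun S => ⟨fun i => ⟨(S.1 i).toNat, ?_⟩, ?_⟩
        invFun := fun f => ⟨fun i => ((f i : ℕ) : ℤ), ?_, ?_⟩
        left_inv := ?_
        right_inv := ?_ }
    · have := S.2.1 i
      omega
    · intro i j hij
      apply S.2.2
      have h4 := S.2.1 i
      have h5 := S.2.1 j
      simp only [Fin.mk.injEq] at hij
      omega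
    · intro i
      exact ⟨Int.natCast_nonneg _, Int.ofNat_lt.2 (f i).2⟩
    · intro i j hij
      apply f.injective
      apply Fin.ext
      exact Int.ofNat_inj.1 hij
    · intro S
      apply Subtype.ext
      funext i
      have := S.2.1 i
      exact Int.toNat_of_nonneg this.1
    · intro f
      ext i
      simp
  rw [h3, Nat.card_eq_fintype_card, Fintype.card_embedding_eq, Fintype.card_fin, Fintype.card_fin]

end BCCount

/-! ### Lattice points of a cube, sorted by signs and tie-broken order. -/

section Cube

variable {n : ℕ}

theorem abs_signedLabel_le (ε : Fin n → Bool) (i : Fin n) :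
    -(n : ℤ) ≤ signedLabel ε i ∧ signedLabel ε i ≤ n := by
  have := i.2
  unfold signedLabel
  split_ifs <;> constructor <;> omega

theorem signedLabel_injective (ε : Fin n → Bool) : Function.Injective (signedLabel ε) := by
  intro i j h
  have hi := i.2
  have hj := j.2
  apply Fin.ext
  unfold signedLabel at h
  split_ifs at h <;> omega

/-- Comparison of integers with ties broken by labels of absolute value at most `n`. -/
theorem lex_lt_iff {n : ℕ} {s t k l : ℤ} (hk : -(n : ℤ) ≤ k ∧ k ≤ n) (hl : -(n : ℤ) ≤ l ∧ l ≤ n)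
    (hkl : k ≠ l) : (2 * n + 1) * s + k < (2 * n + 1) * t + l ↔
      -1 < t - s ∧ (l < k → 0 < t - s) := by
  obtain ⟨d, rfl⟩ : ∃ d, t = s + d := ⟨t - s, by ring⟩
  rw [mul_add, add_sub_cancel_left]
  rcases lt_trichotomy d 0 with hd | rfl | hd
  · have h1 : (2 * (n : ℤ) + 1) * d ≤ -(2 * n + 1) := by nlinarith
    constructor
    · intro h
      omega
    · rintro ⟨h, -⟩
      omega
  · simp only [mul_zero]
    omega
  · have h1 : (2 * (n : ℤ) + 1) ≤ (2 * n + 1) * d := by nlinarith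
    constructor
    · intro h
      omega
    · intro h
      omega

/-- The signs of an integer vector, where `0` counts as negative. -/
def signs (y : Fin n → ℤ) (i : Fin n) : Bool := decide (1 ≤ y i)

/-- Absolute values with ties broken by signed labels. -/
def lexKey (y : Fin n → ℤ) (u : Fin n) : ℤ :=
  (2 * n + 1) * |y u| + signedLabel (signs y) u

theorem lexKey_injective (y : Fin n → ℤ) : Function.Injective (lexKey y) := by
  intro u v h
  by_contra huv
  have hu := abs_signedLabel_le (signs y) u
  have hv := abs_signedLabel_le (signs y) v
  have hne := (signedLabel_injective (signs y)).ne huv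
  have h1 := lex_lt_iff (s := |y u|) (t := |y v|) hu hv hne
  have h2 := lex_lt_iff (s := |y v|) (t := |y u|) hv hu hne.symm
  unfold lexKey at h
  rw [h] at h1 h2
  simp only [lt_irrefl, false_iff] at h1 h2
  omega

theorem signed_signed (ε : Fin n → Bool) (s : Fin n → ℤ) : signed ε (signed ε s) = s := by
  funext i
  simp only [signed]
  split_ifs <;> simp

/-- For bounds `-1` and `0`, a gap may be zero exactly when the label does not drop, so the labels
act as tie-breakers. The end conditions cut out a half-open cube, with `0` counted as negative. -/
theorem cube_iff_condW (r : Equiv.Perm (Fin n)) (ε : Fin n → Bool) (J : ℤ) (s : Fin n → ℤ) :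
    CondW r ε (-1) 0 J s ↔ (∀ i, -J < 2 * signed ε s i ∧ 2 * signed ε s i ≤ J) ∧
      signs (signed ε s) = ε ∧ ∀ u v, r u < r v → lexKey (signed ε s) u < lexKey (signed ε s) v := by
  have hbox : (∀ u, (0 ≤ s u ∧ (ε u = true → 1 ≤ s u)) ∧
      (2 * s u ≤ J ∧ (ε u = false → 2 * s u < J))) ↔
      (∀ i, -J < 2 * signed ε s i ∧ 2 * signed ε s i ≤ J) ∧ signs (signed ε s) = ε := by
    rw [funext_iff, ← forall_and]
    refine forall_congr' fun i => ?_
    cases h : ε i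
    · simp only [signs, signed, h, Bool.false_eq_true, if_false, decide_eq_false_iff_not,
        eq_self, true_imp_iff, false_imp_iff, and_true]
      omega
    · simp only [signs, signed, h, if_true, decide_eq_true_eq, reduceCtorEq,
        eq_self, true_imp_iff, false_imp_iff, and_true]
      omega
  rw [← and_assoc, ← hbox]
  have hfb : FrontSingle (signedLabel ε) (-1) 0 s ∧
      FrontSingle (fun u => -signedLabel ε u) (-1) 0 (fun u => J - 2 * s u) ↔
      ∀ u, (0 ≤ s u ∧ (ε u = true → 1 ≤ s u)) ∧ (2 * s u ≤ J ∧ (ε u = false → 2 * s u < J)) := by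
    unfold FrontSingle
    rw [← forall_and]
    refine forall_congr' fun u => ?_
    rw [signedLabel_neg_iff, neg_lt_zero, signedLabel_pos_iff]
    dsimp only
    refine and_congr (and_congr (by omega) (imp_congr_right fun _ => by omega))
      (and_congr (by omega) (imp_congr_right fun _ => by omega))
  unfold CondW
  rw [hfb, and_comm]
  refine and_congr_right fun h => ?_
  have hs : signs (signed ε s) = ε := (hbox.1 h).2
  have habs : ∀ u, |signed ε s u| = s u := by
    intro u
    have := (h u).1.1
    unfold signed
    split_ifs
    · exact abs_of_nonneg this
    · rw [abs_neg, abs_of_nonneg this]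
  refine forall₃_congr fun u v huv => ?_
  unfold lexKey
  rw [hs, habs, habs, lex_lt_iff (abs_signedLabel_le ε u) (abs_signedLabel_le ε v)
    ((signedLabel_injective ε).ne fun h => by rw [h] at huv; exact lt_irrefl _ huv)]

theorem pow_eq_sum_card_condW (n J : ℕ) :
    J ^ n = ∑ ε : Fin n → Bool, ∑ r : Equiv.Perm (Fin n), Nat.card {s // CondW r ε (-1) 0 J s} := by
  have e : {y : Fin n → ℤ // ∀ i, -(J : ℤ) < 2 * y i ∧ 2 * y i ≤ J} ≃
      (Fin n → Finset.Ioc (-(J : ℤ) / 2) ((J : ℤ) / 2)) :=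
    (Equiv.subtypeEquivRight fun y => forall_congr' fun i => by
      rw [Finset.mem_Ioc]; omega).trans
      (Equiv.subtypePiEquivPi (p := fun _ z => z ∈ Finset.Ioc (-(J : ℤ) / 2) ((J : ℤ) / 2)))
  have hfin : Finite {y : Fin n → ℤ // ∀ i, -(J : ℤ) < 2 * y i ∧ 2 * y i ≤ J} :=
    Finite.of_equiv _ e.symm
  have hcard : Nat.card {y : Fin n → ℤ // ∀ i, -(J : ℤ) < 2 * y i ∧ 2 * y i ≤ J} = J ^ n := by
    rw [Nat.card_congr e, Nat.card_fun, Nat.card_eq_fintype_card, Fintype.card_coe, Int.card_Ioc,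
      Nat.card_eq_fintype_card, Fintype.card_fin]
    congr 1
    omega
  rw [← hcard, card_eq_sum_of_existsUnique _
    (fun (w : (Fin n → Bool) × Equiv.Perm (Fin n)) y =>
      signs y = w.1 ∧ ∀ u v, w.2 u < w.2 v → lexKey y u < lexKey y v), Fintype.sum_prod_type]
  · refine Finset.sum_congr rfl fun ε _ => Finset.sum_congr rfl fun r _ => ?_
    exact (Nat.card_congr (Equiv.subtypeEquiv
      (⟨signed ε, signed ε, signed_signed ε, signed_signed ε⟩ : (Fin n → ℤ) ≃ (Fin n → ℤ))
      fun s => cube_iff_condW r ε J s)).symm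
  · intro y _
    obtain ⟨r, hr, hr'⟩ := existsUnique_perm_of_injective _ (lexKey_injective y)
    refine ⟨(signs y, r), ⟨rfl, hr⟩, ?_⟩
    rintro ⟨ε, r₁⟩ ⟨h1, h2⟩
    exact Prod.ext h1.symm (hr' _ h2)

/-- The number of lattice points of the cube decomposed according to signs and order. -/
theorem pow_eq_sum_increasingCount (n J : ℕ) :
    J ^ n = ∑ ε : Fin n → Bool, ∑ r : Equiv.Perm (Fin n),
      increasingCount n (((J : ℤ) - circularDescents r ε) / 2 + n) := by
  rw [pow_eq_sum_card_condW]
  refine Finset.sum_congr rfl fun ε _ => Finset.sum_congr rfl fun r _ => ?_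
  -- With `a = -1` and `b = 0` the forced length is just the number of descents.
  rw [card_condW_shift le_rfl (by norm_num), card_condW_neg_one]
  norm_num

end Cube

/-! ### Quasi-polynomials of period two and odd dilations. -/

section AlternatingSum

variable {W : Type*} [Fintype W]

/-- The alternating sum of translates of `g` by a family of natural numbers, signed by parity. -/
def altSum (c : W → ℕ) (g : ℚ[X]) : ℚ[X] :=
  ∑ w, C ((-1) ^ c w) * g.comp (X - C (c w : ℚ))

theorem altSum_sub (c : W → ℕ) (g h : ℚ[X]) : altSum c (g - h) = altSum c g - altSum c h := by
  simp only [altSum, sub_comp, mul_sub, Finset.sum_sub_distrib]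

theorem altSum_C_mul (c : W → ℕ) (a : ℚ) (g : ℚ[X]) :
    altSum c (C a * g) = C a * altSum c g := by
  simp only [altSum, mul_comp, C_comp, Finset.mul_sum]
  exact Finset.sum_congr rfl fun w _ => by ring

theorem derivative_altSum (c : W → ℕ) (g : ℚ[X]) :
    derivative (altSum c g) = altSum c (derivative g) := by
  simp only [altSum, derivative_sum]
  refine Finset.sum_congr rfl fun w _ => ?_
  rw [derivative_C_mul, derivative_comp]
  simp

theorem derivative_eq_zero_of_periodic {p : ℚ[X]} (h : p.comp (X - C 1) = p) :
    derivative p = 0 := by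
  have h1 : ∀ k : ℕ, p.eval (-(k : ℚ)) = p.eval 0 := by
    intro k
    induction k with
    | zero => simp
    | succ k ih =>
      rw [← ih]
      conv_rhs => rw [← h]
      rw [eval_comp, eval_sub, eval_X, eval_C]
      congr 1
      push_cast
      ring
  have h2 : p = C (p.eval 0) := by
    refine Polynomial.eq_of_infinite_eval_eq _ _ ?_
    refine Set.infinite_of_injective_forall_mem (f := fun k : ℕ => -(k : ℚ))
      (fun k l hkl => by simpa using hkl) fun k => ?_
    simp only [Set.mem_ofPred_eq, eval_C]
    exact h1 k
  rw [h2, derivative_C]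

/-- The alternating sum commutes with differentiation, so it annihilates all higher derivatives of
`γ` as well. These contain one polynomial of each degree below that of `γ`, hence span everything
there. -/
theorem altSum_eq_zero_of_derivative (c : W → ℕ) {γ : ℚ[X]}
    (h : altSum c (derivative γ) = 0) :
    ∀ g : ℚ[X], g.degree < γ.natDegree → altSum c g = 0 := by
  have hk : ∀ k, altSum c (derivative^[k + 1] γ) = 0 := by
    intro k
    induction k with
    | zero => exact h
    | succ k ih => rw [Function.iterate_succ_apply', ← derivative_altSum, ih, derivative_zero]
  have main : ∀ d ≤ γ.natDegree, ∀ g : ℚ[X], g.degree < d → altSum c g = 0 := by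
    intro d
    induction d with
    | zero =>
      intro _ g hg
      have : g = 0 := by simpa [Nat.cast_withBot] using hg
      simp [this, altSum]
    | succ d ih =>
      intro hd g hg
      obtain ⟨k, hk'⟩ : ∃ k, γ.natDegree = d + (k + 1) := ⟨γ.natDegree - d - 1, by omega⟩
      set f := derivative^[k + 1] γ with hf
      have hfd : f.coeff d ≠ 0 := by
        rw [hf, coeff_iterate_derivative, ← hk', nsmul_eq_mul]
        refine mul_ne_zero ?_ (leadingCoeff_ne_zero.2 fun h0 => by
          rw [h0, natDegree_zero] at hk'
          omega)
        have := Nat.pos_of_ne_zero (Nat.descFactorial_eq_zero_iff_lt.not.2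
          (show ¬ γ.natDegree < k + 1 by omega))
        exact_mod_cast this.ne'
      have hfdeg : f.natDegree ≤ d := by
        have := natDegree_iterate_derivative γ (k + 1)
        rw [← hf] at this
        omega
      have hgdeg : g.natDegree ≤ d := natDegree_le_of_degree_le (Order.lt_succ_iff.1 hg)
      have h1 : altSum c (g - C (g.coeff d / f.coeff d) * f) = 0 := by
        refine ih (by omega) _ ?_
        rw [degree_lt_iff_coeff_zero]
        intro j hj
        rw [coeff_sub, coeff_C_mul]
        rcases hj.eq_or_lt with rfl | hj
        · rw [div_mul_cancel₀ _ hfd, sub_self]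
        · rw [coeff_eq_zero_of_natDegree_lt (hgdeg.trans_lt hj),
            coeff_eq_zero_of_natDegree_lt (hfdeg.trans_lt hj), mul_zero, sub_zero]
      rw [altSum_sub, altSum_C_mul, hk k, mul_zero, sub_zero] at h1
      exact h1
  exact main _ le_rfl

/-- Rescaling the variable by `m` undoes the dilation of the translations; oddness of `m` keeps the
signs. -/
theorem altSum_mul_comp (c : W → ℕ) {m : ℕ} (hm : Odd m) (g : ℚ[X]) :
    (altSum (fun w => m * c w) g).comp (C (m : ℚ) * X) = altSum c (g.comp (C (m : ℚ) * X)) := by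
  simp only [altSum, Polynomial.sum_comp]
  refine Finset.sum_congr rfl fun w _ => ?_
  rw [mul_comp, C_comp, comp_assoc, comp_assoc, pow_mul, hm.neg_one_pow]
  congr 2
  simp only [sub_comp, mul_comp, X_comp, C_comp, Nat.cast_mul, C_mul]
  ring

/-- Periodicity of the alternating sum is inherited by odd dilations of the translations. -/
theorem altSum_mul_periodic (c : W → ℕ) {γ : ℚ[X]}
    (h : (altSum c γ).comp (X - C 1) = altSum c γ) {m : ℕ} (hm : Odd m) :
    (altSum (fun w => m * c w) γ).comp (X - C 1) = altSum (fun w => m * c w) γ := by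
  have h0 : altSum c (derivative γ) = 0 := by
    rw [← derivative_altSum, derivative_eq_zero_of_periodic h]
  have h1 : derivative (altSum (fun w => m * c w) γ) = 0 := by
    rw [derivative_altSum]
    have hm0 : (m : ℚ) ≠ 0 := by exact_mod_cast hm.pos.ne'
    rcases eq_or_ne (derivative γ) 0 with hγ | hγ
    · simp [hγ, altSum]
    -- Rescaling does not raise the degree, so the rescaled derivative is still annihilated.
    have h2 : altSum c ((derivative γ).comp (C (m : ℚ) * X)) = 0 := by
      refine altSum_eq_zero_of_derivative c h0 _ ?_
      have h3 : 0 < γ.natDegree := by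
        by_contra hcon
        refine hγ ?_
        rw [eq_C_of_natDegree_eq_zero (Nat.eq_zero_of_not_pos hcon), derivative_C]
      refine (degree_le_natDegree).trans_lt ?_
      rw [natDegree_comp, natDegree_C_mul_X _ hm0, mul_one]
      exact_mod_cast natDegree_derivative_lt h3.ne'
    rw [← altSum_mul_comp c hm] at h2
    have h4 := congrArg (fun p : ℚ[X] => p.comp (C (m : ℚ)⁻¹ * X)) h2
    simp only [comp_assoc, mul_comp, C_comp, X_comp, zero_comp] at h4
    rwa [← mul_assoc, ← C_mul, mul_inv_cancel₀ hm0, C_1, one_mul, comp_X] at h4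
  rw [eq_C_of_natDegree_eq_zero (derivative_eq_zero.1 h1), C_comp]

/-- Sum of translates of `γ` computing the values at even arguments of a sum of translates of
`K ↦ γ (2 ⌊K / 2⌋)`. -/
def evenSum (c : W → ℕ) (γ : ℚ[X]) : ℚ[X] :=
  ∑ w, γ.comp (X - C ((c w + c w % 2 : ℕ) : ℚ))

/-- Sum of translates of `γ` computing the values at odd arguments of a sum of translates of
`K ↦ γ (2 ⌊K / 2⌋)`. -/
def oddSum (c : W → ℕ) (γ : ℚ[X]) : ℚ[X] :=
  ∑ w, γ.comp (X - C ((c w + (c w + 1) % 2 : ℕ) : ℚ))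

/-- For even `c w` the translations are `c w` and `c w + 1`; for odd `c w` they are exchanged, which
produces the sign. -/
theorem evenSum_sub_oddSum (c : W → ℕ) (γ : ℚ[X]) :
    evenSum c γ - oddSum c γ = altSum c γ - (altSum c γ).comp (X - C 1) := by
  simp only [evenSum, oddSum, altSum, Polynomial.sum_comp, ← Finset.sum_sub_distrib]
  refine Finset.sum_congr rfl fun w _ => ?_
  have h1 : (X - C (c w : ℚ)).comp (X - C 1) = X - C ((c w + 1 : ℕ) : ℚ) := by
    simp only [sub_comp, X_comp, C_comp, Nat.cast_add, Nat.cast_one, C_add]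
    ring
  rw [mul_comp, C_comp, comp_assoc, h1]
  rcases Nat.even_or_odd (c w) with h | h
  · rw [h.neg_one_pow, Nat.even_iff.1 h, Nat.odd_iff.1 h.add_one]
    simp
  · rw [h.neg_one_pow, Nat.odd_iff.1 h, Nat.even_iff.1 h.add_one]
    simp only [add_zero, Nat.cast_add, Nat.cast_one, C_neg, C_1, neg_one_mul]
    ring

theorem sum_floor_eq (c : W → ℕ) {γ : ℚ[X]} {B : ℤ → ℚ}
    (hB : ∀ K : ℤ, 0 ≤ K → B K = γ.eval ((2 * (K / 2) : ℤ) : ℚ)) {K : ℤ} (hK : ((∑ w, c w : ℕ) : ℤ) ≤ K) :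
    ∑ w, B (K - c w) = if Even K then (evenSum c γ).eval (K : ℚ) else
      (oddSum c γ).eval (K : ℚ) := by
  have hc : ∀ w, (c w : ℤ) ≤ K := fun w =>
    (Int.ofNat_le.2 (Finset.single_le_sum (f := c) (fun _ _ => Nat.zero_le _)
      (Finset.mem_univ w))).trans hK
  split_ifs with h
  · simp only [evenSum, eval_finsetSum]
    refine Finset.sum_congr rfl fun w _ => ?_
    rw [hB _ (sub_nonneg.2 (hc w)), eval_comp, eval_sub, eval_X, eval_C]
    congr 1
    have h2 : 2 * ((K - c w) / 2) = K - ((c w + c w % 2 : ℕ) : ℤ) := by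
      rw [Int.even_iff] at h
      omega
    rw [h2]
    push_cast
    rfl
  · simp only [oddSum, eval_finsetSum]
    refine Finset.sum_congr rfl fun w _ => ?_
    rw [hB _ (sub_nonneg.2 (hc w)), eval_comp, eval_sub, eval_X, eval_C]
    congr 1
    have h2 : 2 * ((K - c w) / 2) = K - ((c w + (c w + 1) % 2 : ℕ) : ℤ) := by
      rw [Int.even_iff] at h
      omega
    rw [h2]
    push_cast
    rfl

theorem eq_of_eval_eq_of_large {p₁ p₂ : ℚ[X]} (ρ : ℕ) (N : ℕ)
    (h : ∀ k : ℕ, N ≤ k → p₁.eval ((2 * k + ρ : ℕ) : ℚ) = p₂.eval ((2 * k + ρ : ℕ) : ℚ)) :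
    p₁ = p₂ := by
  refine Polynomial.eq_of_infinite_eval_eq _ _ ?_
  refine Set.infinite_of_injective_forall_mem (f := fun k : ℕ => ((2 * (k + N) + ρ : ℕ) : ℚ))
    (fun k l hkl => ?_) fun k => h _ (by omega)
  have := Nat.cast_injective (R := ℚ) hkl
  omega

/-- If a sum of translates of `K ↦ γ (2 ⌊K / 2⌋)` is a polynomial for large `K`, then so is the
sum obtained by multiplying the translations by an odd number. -/
theorem exists_polynomial_of_odd_dilation (c : W → ℕ) {γ : ℚ[X]} {B : ℤ → ℚ}
    (hB : ∀ K : ℤ, 0 ≤ K → B K = γ.eval ((2 * (K / 2) : ℤ) : ℚ)) (p : ℚ[X])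
    (hp : ∀ K : ℕ, ∑ w, B (K - c w) = p.eval (K : ℚ)) {m : ℕ} (hm : Odd m) :
    ∃ (p' : ℚ[X]) (N : ℕ), ∀ K : ℤ, N ≤ K → ∑ w, B (K - m * c w) = p'.eval (K : ℚ) := by
  have he : evenSum c γ = p := by
    refine eq_of_eval_eq_of_large 0 (∑ w, c w) fun k hk => ?_
    rw [← hp, sum_floor_eq c hB (by omega), if_pos (by simp)]
    simp
  have ho : oddSum c γ = p := by
    refine eq_of_eval_eq_of_large 1 (∑ w, c w) fun k hk => ?_
    rw [← hp, sum_floor_eq c hB (by omega), if_neg (by simp)]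
    simp
  -- Both parities give `p`, so the alternating sum has period one. Periodicity passes to the
  -- dilated sum and makes its two parities agree again.
  have h1 := evenSum_sub_oddSum c γ
  rw [he, ho, sub_self, eq_comm, sub_eq_zero] at h1
  have h2 := altSum_mul_periodic c h1.symm hm
  have h3 := evenSum_sub_oddSum (fun w => m * c w) γ
  rw [h2, sub_self, sub_eq_zero] at h3
  refine ⟨evenSum (fun w => m * c w) γ, ∑ w, m * c w, fun K hK => ?_⟩
  have h4 := sum_floor_eq (fun w => m * c w) hB hK
  rw [← h3, ite_self] at h4
  rw [← h4]
  push_cast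
  rfl

end AlternatingSum

/-! ### Polynomiality of the weighted count for an odd multiplier. -/

section Count

/-- The polynomial whose values at even numbers `2 k` count increasing sequences in
`[0, k + n)`. -/
def countPoly (n : ℕ) : ℚ[X] :=
  C ((n.factorial : ℚ)⁻¹) * (descPochhammer ℚ n).comp (C (1 / 2) * X + C (n : ℚ))

theorem increasingCount_eq_eval (n : ℕ) {K : ℤ} (hK : 0 ≤ K) :
    (increasingCount n (K / 2 + n) : ℚ) = (countPoly n).eval ((2 * (K / 2) : ℤ) : ℚ) := by
  obtain ⟨k, hk⟩ := Int.eq_ofNat_of_zero_le (show 0 ≤ K / 2 by omega)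
  have h1 := factorial_mul_increasingCount n (k + n)
  have h2 : (n.factorial : ℚ) ≠ 0 := by exact_mod_cast n.factorial_ne_zero
  have h3 : ((n.factorial : ℚ)) * increasingCount n ((k + n : ℕ) : ℤ) =
      ((k + n).descFactorial n : ℕ) := by exact_mod_cast h1
  rw [hk, countPoly, eval_mul, eval_C, eval_comp, ← Nat.cast_add, eq_inv_mul_iff_mul_eq₀ h2, h3,
    ← descPochhammer_eval_eq_descFactorial]
  congr 1
  simp

theorem exists_polynomial_sum_increasingCount (n : ℕ) {m : ℕ} (hm : Odd m) :
    ∃ (p : ℚ[X]) (N : ℕ), ∀ K : ℤ, N ≤ K →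
      ((∑ ε : Fin n → Bool, ∑ r : Equiv.Perm (Fin n),
        increasingCount n ((K - m * circularDescents r ε) / 2 + n) : ℕ) : ℚ) =
          p.eval (K : ℚ) := by
  obtain ⟨p, N, h⟩ := exists_polynomial_of_odd_dilation
    (fun w : (Fin n → Bool) × Equiv.Perm (Fin n) => circularDescents w.2 w.1)
    (B := fun K => (increasingCount n (K / 2 + n) : ℚ))
    (fun K hK => increasingCount_eq_eval n hK) (X ^ n) (fun K => by
      rw [Fintype.sum_prod_type, eval_pow, eval_X]
      exact_mod_cast (pow_eq_sum_increasingCount n K).symm) hm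
  refine ⟨p, N, fun K hK => ?_⟩
  rw [← h K hK, Fintype.sum_prod_type]
  push_cast
  rfl

end Count

/-! ### The translation identities for type BC, by the parities of `a` and `b`. -/

section TypeBC

/-- The number of points modulo an odd `Q` avoiding the deformation `[0, m]` of type `BC`, as a
function of all integers `Q`. -/
def bcCount (n m : ℕ) (Q : ℤ) : ℕ :=
  ∑ ε : Fin n → Bool, ∑ r : Equiv.Perm (Fin n),
    increasingCount n ((Q - (2 * n + 1) - m * circularDescents r ε) / 2 + n)

/-- The number to be halved is odd, because `m` and `Q` are even, so lowering it by one does not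
change the floor. -/
theorem bcCount_sub_one {m : ℕ} (hm : Even m) (n : ℕ) {Q : ℤ} (hQ : Even Q) :
    bcCount n m (Q - 1) = bcCount n m Q := by
  refine Finset.sum_congr rfl fun ε _ => Finset.sum_congr rfl fun r _ => ?_
  obtain ⟨k, rfl⟩ := hm
  obtain ⟨Q, rfl⟩ := hQ
  congr 2
  push_cast
  have : ((k : ℤ) + k) * circularDescents r ε = 2 * (k * circularDescents r ε) := by ring
  omega

theorem exists_polynomial_bcCount (n : ℕ) {m : ℕ} (hm : Odd m) :
    ∃ (p : ℚ[X]) (N : ℕ), ∀ Q : ℤ, N ≤ Q → (bcCount n m Q : ℚ) = p.eval (Q : ℚ) := by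
  obtain ⟨p, N, h⟩ := exists_polynomial_sum_increasingCount n hm
  refine ⟨p.comp (X - C ((2 * n + 1 : ℕ) : ℚ)), N + (2 * n + 1), fun Q hQ => ?_⟩
  rw [eval_comp, eval_sub, eval_X, eval_C]
  have h1 := h (Q - (2 * n + 1)) (by push_cast at hQ; linarith)
  push_cast at h1 ⊢
  rw [← h1, bcCount]
  push_cast
  rfl

theorem charPoly_posBC_eval_eq (n : ℕ) {a : ℤ} (ha : 0 ≤ a) (m : ℕ) :
    ∃ N : ℕ, ∀ q : ℕ, N ≤ q → Odd q →
      (charPoly (deformation (posBC n) (-a) (a + m))).eval (q : ℤ) =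
        bcCount n m ((q : ℤ) - (2 * n + 1) * a) := by
  obtain ⟨Q, hQ⟩ := charPoly_posBC_eval n (-a) (a + m)
  refine ⟨Q + 2 * (a + m).toNat + 1, fun q hq hodd => ?_⟩
  rw [← hQ q (by omega) hodd, card_avoids_BC hodd ha (by omega) (by omega), bcCount]
  congr 1
  refine Finset.sum_congr rfl fun ε _ => Finset.sum_congr rfl fun r _ => ?_
  rw [card_condBC_eq, card_condW_shift (by omega) (by omega), card_condW_neg_one,
    add_sub_cancel_left]
  congr 3
  ring

/-- An even translation keeps the modulus odd, so both characteristic polynomials may be evaluated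
as point counts. -/
theorem charPoly_posBC_translate_of_even (n : ℕ) {a b c : ℤ} (ha : 0 ≤ a) (hab : a ≤ b)
    (hc : Even c) (hc0 : 0 ≤ c)
    (h : ∀ m : ℕ, b = a + m → ∀ q : ℤ, Odd q →
      bcCount n m (q - (2 * n + 1) * a) = bcCount n m (q - c)) :
    charPoly (deformation (posBC n) (-a) b) =
      (charPoly (deformation (posBC n) 0 (b - a))).comp (X - C c) := by
  obtain ⟨m, hm⟩ := Int.eq_ofNat_of_zero_le (sub_nonneg.2 hab)
  obtain rfl : b = a + m := by omega
  obtain ⟨c, rfl⟩ := Int.eq_ofNat_of_zero_le hc0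
  obtain ⟨N₁, h₁⟩ := charPoly_posBC_eval_eq n ha m
  obtain ⟨N₂, h₂⟩ := charPoly_posBC_eval_eq n le_rfl m
  rw [neg_zero, zero_add] at h₂
  refine eq_comp_of_eval_odd ⟨N₁ + N₂ + c, fun q hq hodd => ?_⟩
  obtain ⟨q', rfl⟩ : ∃ q', q = q' + c := ⟨q - c, by omega⟩
  have hodd' : Odd q' := by
    rw [← Nat.not_even_iff_odd] at hodd ⊢
    rw [Nat.even_add] at hodd
    have : Even c := by exact_mod_cast hc
    tauto
  rw [h₁ _ (by omega) hodd, h m rfl _ (by exact_mod_cast hodd), add_sub_cancel_left,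
    show ((q' + c : ℕ) : ℤ) - c = q' by push_cast; ring, h₂ q' (by omega) hodd']
  simp

theorem charPoly_posBC_translate_of_odd_odd (n : ℕ) {a b : ℤ} (ha : 0 ≤ a) (hab : a ≤ b)
    (hao : Odd a) (hbo : Odd b) :
    charPoly (deformation (posBC n) (-a) b) =
      (charPoly (deformation (posBC n) 0 (b - a))).comp (X - C ((2 * (n : ℤ) + 1) * a + 1)) := by
  have hodd : Odd ((2 * (n : ℤ) + 1) * a) := (odd_two_mul_add_one _).mul hao
  refine charPoly_posBC_translate_of_even n ha hab hodd.add_one (by positivity)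
    fun m hm q hq => ?_
  have hme : Even m := by
    have : (m : ℤ) = b - a := by omega
    have h := hbo.sub_odd hao
    rw [← this] at h
    exact_mod_cast h
  rw [← bcCount_sub_one hme n (hq.sub_odd hodd), sub_sub]

theorem charPoly_posBC_translate_of_even_left (n : ℕ) {a b : ℤ} (ha : 0 ≤ a) (hab : a ≤ b)
    (hae : Even a) :
    charPoly (deformation (posBC n) (-a) b) =
      (charPoly (deformation (posBC n) 0 (b - a))).comp (X - C ((2 * (n : ℤ) + 1) * a)) :=
  charPoly_posBC_translate_of_even n ha hab (hae.mul_left _) (by positivity) fun _ _ _ _ => rfl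

/-- The translated argument may be even, where the finite field method does not apply. Instead the
polynomial for `bcCount` is identified with the characteristic polynomial on odd arguments, and is
then used at all large integers. -/
theorem charPoly_posBC_translate_of_odd_sub (n : ℕ) {a b : ℤ} (ha : 0 ≤ a) (hab : a ≤ b)
    (hba : Odd (b - a)) :
    charPoly (deformation (posBC n) (-a) b) =
      (charPoly (deformation (posBC n) 0 (b - a))).comp (X - C ((2 * (n : ℤ) + 1) * a)) := by
  obtain ⟨m, hm⟩ := Int.eq_ofNat_of_zero_le (sub_nonneg.2 hab)
  obtain rfl : b = a + m := by omega
  rw [add_sub_cancel_left] at hba ⊢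
  have hmo : Odd m := by exact_mod_cast hba
  obtain ⟨p, N, h⟩ := exists_polynomial_bcCount n hmo
  obtain ⟨d, hd⟩ := Int.eq_ofNat_of_zero_le (show 0 ≤ (2 * (n : ℤ) + 1) * a by positivity)
  obtain ⟨N₁, h₁⟩ := charPoly_posBC_eval_eq n ha m
  obtain ⟨N₂, h₂⟩ := charPoly_posBC_eval_eq n le_rfl m
  rw [neg_zero, zero_add] at h₂
  have hinj : Function.Injective (algebraMap ℤ ℚ) := Int.cast_injective
  have hp : (charPoly (deformation (posBC n) 0 m)).map (algebraMap ℤ ℚ) = p := by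
    refine eq_of_eval_eq_of_large 1 (N + N₂) fun k hk => ?_
    have h3 := h₂ (2 * k + 1) (by omega) (odd_two_mul_add_one k)
    rw [mul_zero, sub_zero] at h3
    have h4 := h ((2 * k + 1 : ℕ) : ℤ) (by omega)
    rw [Int.cast_natCast] at h4
    rw [← h4, ← Int.cast_natCast (R := ℚ) (2 * k + 1), ← eq_intCast (algebraMap ℤ ℚ),
      eval_map_apply, h3]
    simp
  refine eq_comp_of_eval_odd ⟨N + N₁ + d, fun q hq hodd => ?_⟩
  apply hinj
  rw [h₁ q (by omega) hodd, ← eval_map_apply, hp, hd, eq_intCast, eq_intCast, Int.cast_natCast,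
    h _ (by omega)]

end TypeBC

end HypArr

end

/-! ### Assembly of the types. -/

theorem proposition5p3 (n : ℕ) (hn : 1 ≤ n) (a b : ℤ) (ha : 0 ≤ a) (hab : a ≤ b) :
    HypArr.charPoly (HypArr.deformation (HypArr.posA n) (-a) b) =
      (HypArr.charPoly (HypArr.deformation (HypArr.posA n) 0 (b - a))).comp
        (X - C (a * (n : ℤ))) ∧
    HypArr.charPoly (HypArr.deformation (HypArr.posB n) (-a) b) =
      (HypArr.charPoly (HypArr.deformation (HypArr.posB n) 0 (b - a))).comp
        (X - C (a * (2 * (n : ℤ)))) ∧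
    HypArr.charPoly (HypArr.deformation (HypArr.posC n) (-a) b) =
      (HypArr.charPoly (HypArr.deformation (HypArr.posC n) 0 (b - a))).comp
        (X - C (a * (2 * (n : ℤ)))) ∧
    HypArr.charPoly (HypArr.deformation (HypArr.posD n) (-a) b) =
      (HypArr.charPoly (HypArr.deformation (HypArr.posD n) 0 (b - a))).comp
        (X - C (a * (2 * (n : ℤ) - 2))) ∧
    (Odd a ∧ Odd b →
      HypArr.charPoly (HypArr.deformation (HypArr.posBC n) (-a) b) =
        (HypArr.charPoly (HypArr.deformation (HypArr.posBC n) 0 (b - a))).comp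
          (X - C ((2 * (n : ℤ) + 1) * a + 1))) ∧
    (¬ (Odd a ∧ Odd b) →
      HypArr.charPoly (HypArr.deformation (HypArr.posBC n) (-a) b) =
        (HypArr.charPoly (HypArr.deformation (HypArr.posBC n) 0 (b - a))).comp
          (X - C ((2 * (n : ℤ) + 1) * a))) := by
  refine ⟨?_, HypArr.charPoly_posB_translate n ha hab, HypArr.charPoly_posC_translate n ha hab,
    HypArr.charPoly_posD_translate hn ha hab,
    fun h => HypArr.charPoly_posBC_translate_of_odd_odd n ha hab h.1 h.2, fun h => ?_⟩
  · obtain ⟨k, rfl⟩ : ∃ k, n = k + 1 := ⟨n - 1, by omega⟩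
    exact HypArr.charPoly_posA_translate k ha hab
  · rcases Int.even_or_odd a with hae | hao
    · exact HypArr.charPoly_posBC_translate_of_even_left n ha hab hae
    · refine HypArr.charPoly_posBC_translate_of_odd_sub n ha hab ?_
      have hbe : Even b := by
        rw [← Int.not_odd_iff_even]
        exact fun hb => h ⟨hao, hb⟩
      exact hbe.sub_odd hao
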